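/- Let $q=e^{\hbar}$ and $k$ be generic complex numbers, $q^x:=e^{\hbar x}$, $[u]=\frac{q^u-q^{-u}}{q-q^{-1}}$: precisely, $[2m],[km],[(k+2)m]\neq 0$ for all integers $m\ge 1$ and $[k+1]\ne 0$. Consider three commuting Heisenberg algebras $\widetilde\alpha_n,Q_{\widetilde\alpha}$; $\overline\alpha_n,Q_{\overline\alpha}$; $\beta_n,Q_\beta$ $(n\in\mathbb Z)$ with $[\widetilde\alpha_n,\widetilde\alpha_m]=\frac{[(k+2)n][kn]}{n}\delta_{n+m,0}$, $[\overline\alpha_n,\overline\alpha_m]=-\frac{[2n][kn]}{n}\delta_{n+m,0}$, $[\beta_n,\beta_m]=\frac{[2n][(k+2)n]}{n}\delta_{n+m,0}$ (all zero for $n=0$), $[\widetilde\alpha_n,Q_{\widetilde\alpha}]=\delta_{n,0}$, $[\overline\alpha_n,Q_{\overline\alpha}]=-\delta_{n,0}$, $[\beta_n,Q_\beta]=\delta_{n,0}$. Let $|\xi,\rho,\sigma\rangle=e^{\xi Q_{\widetilde\alpha}+\rho Q_{\overline\alpha}+\sigma Q_\beta}|0\rangle$, where $|0\rangle$ is killed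 by all modes with $n\ge 0$, and $\langle\xi,\rho,\sigma|=\langle 0|e^{-\xi Q_{\widetilde\alpha}-\rho Q_{\overline\alpha}-\sigma Q_\beta}$, where $\langle 0|$ is killed by all modes with $n\le 0$. Let $\mathcal F(\xi,\rho,\sigma)$ (resp. $\mathcal F^*(\xi,\rho,\sigma)$) be the space of polynomials in the negative (resp. positive) modes applied to $|\xi,\rho,\sigma\rangle$ (resp. $\langle\xi,\rho,\sigma|$, acting from the right). With $\varepsilon_{\rm NS}=0$, $\varepsilon_{\rm R}=k/2$ and ${\rm A}\in\{{\rm NS},{\rm R}\}$ put $$\mathcal F^{(*)}_{\rm A}(q^\rho,q^\sigma)=\bigoplus_{n\in\mathbb Z}\mathcal F^{(*)}(\varepsilon_{\rm A}+\rho+(k+2)n,\ \rho+2n,\ \sigma).$$ Vertex operators (signs $\pm$, $\epsilon=\pm$): $\widetilde V^\pm(z)=e^{\pm(k+2)Q_{\widetilde\alpha}}z^{\pm\widetilde\alpha_0/k}:\!\exp(\mp\sum_{m\ne0}\frac{z^{-m}}{[km]}\widetilde\alpha_m)\!:$, $Y^\pm(z)=e^{\pm2Q_{\overline\alpha}}z^{\pm\overline\alpha_0/k}:\!\exp(\mp\sum_{m\neq0}q^{\mp\frac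 k2|m|}\frac{z^{-m}}{[km]}\overline\alpha_m)\!:$, $Z_\pm(z)=\exp(\mp(q-q^{-1})\sum_{m\ge1}z^{\mp m}\frac{[m]}{[2m]}\overline\alpha_{\pm m})q^{\mp\overline\alpha_0/2}$, $W_\pm(z)$ the same with $\beta$ in place of $\overline\alpha$, $e_\pm(z)=:\!Y^+(z)Z_\pm(q^{\mp\frac{k+2}2}z)W_\pm(q^{\mp\frac k2}z)\!:$, $f_\pm(z)=:\!Y^-(z)Z_\pm(q^{\pm\frac{k+2}2}z)W_\pm(q^{\pm\frac k2}z)^{-1}\!:$. The currents of the twisted Wakimoto representation of the quantum $\mathcal N=2$ superconformal algebra are $\mathbf K^\pm(z)=q^{\widetilde\alpha_0}\exp((q-q^{-1})\sum_{\pm m>0}\widetilde\alpha_mz^{-m})$, $\mathbf K(z)=\mathbf K^-(z)\mathbf K^+(z)$, $$\mathbf T(z)=\,:\!\widetilde V^+(q^{-1}z)\widetilde V^-(qz)\Bigl(q^{-1}e_+f_--\tfrac{[k+2]}{[k+1]}e_+f_++q\,e_-f_+\Bigr)\!:,\quad e_\pm=e_\pm(q^{-\frac{k+2}2}z),\ f_\pm=f_\pm(q^{\frac{k+2}2}z),$$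 $\mathbf G^\pm(z)=z^{1/2}(\mathbf G^\pm_+(z)-\mathbf G^\pm_-(z))$ with $\mathbf G^+_\epsilon(z)=\frac{1}{q-q^{-1}}\widetilde V^+(q^{-k-2}z)e_\epsilon(q^{-\frac{3k+4}2}z)$, $\mathbf G^-_\epsilon(z)=\frac{-1}{q-q^{-1}}\widetilde V^-(q^{k+2}z)f_\epsilon(q^{\frac{3k+4}2}z)$. Modes are defined by $\mathbf X(z)=\sum_m\mathbf X_mz^{-m}$; on $\mathcal F_{\rm A}^{(*)}$ the index $m$ is an integer for $\mathbf K^\pm,\mathbf K,\mathbf T$, and $m\in\mathbb Z+\frac12$ (NS) or $m\in\mathbb Z$ (R) for $\mathbf G^\pm$. Let $$S^\pm(z)=\exp\Bigl(\sum_{m\ge1}\tfrac{z^m}{[2m]}(q^{\pm\frac k2m}\beta_{-m}\pm q^{\pm\frac{k+2}2m}\overline\alpha_{-m})\Bigr)\exp\Bigl(-\sum_{m\ge1}\tfrac{z^{-m}}{[2m]}(q^{\pm\frac k2m}\beta_{m}\pm q^{\pm\frac{k+2}2m}\overline\alpha_{m})\Bigr)e^{(k+2)Q_\beta\pm kQ_{\overline\alpha}}z^{\frac12(\beta_0\pm\overline\alpha_0)},$$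 $J=\frac1k(\widetilde\alpha_0+\overline\alpha_0)$, $d_0(\xi,\rho,\sigma)=\frac{\xi^2}{2k(k+2)}-\frac{\rho^2}{4k}+\frac{\sigma(\sigma+2)}{4(k+2)}$ and $$d=\tfrac{\widetilde\alpha_0^2}{2k(k+2)}-\tfrac{\overline\alpha_0^2}{4k}+\tfrac{\beta_0(\beta_0+2)}{4(k+2)}+\sum_{m>0}\Bigl(\tfrac{m^2}{[(k+2)m][km]}\widetilde\alpha_{-m}\widetilde\alpha_m-\tfrac{m^2}{[2m][km]}\overline\alpha_{-m}\overline\alpha_m+\tfrac{m^2}{[2m][(k+2)m]}\beta_{-m}\beta_m\Bigr).$$ **Proposition.** Let ${\rm A}\in\{{\rm NS},{\rm R}\}$ and choose a sign $\pm$. (1) For $\rho',\sigma'\in\mathbb C$, only integral powers of $z$ occur in $S^\pm(z)$ on $\mathcal F_{\rm A}(q^{\rho'},q^{\sigma'})$ (i.e. $S^\pm(z)=\sum_{n\in\mathbb Z}S^\pm_nz^{-n}$ there) if and only if $\frac{\mp\rho'+\sigma'}2\in\mathbb Z$; the same equivalence holds on $\mathcal F^*_{\rm A}(q^{\rho'},q^{\sigma'})$.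 (2) If $\frac{\mp\rho'+\sigma'}2\in\mathbb Z$, then every $S^\pm_m$ maps $\mathcal F_{\rm A}(q^{\rho'},q^{\sigma'})\to\mathcal F_{\rm A}(q^{\rho'\pm(k+2)},q^{\sigma'+k+2})$ and, acting from the right, $\mathcal F^*_{\rm A}(q^{\rho'},q^{\sigma'})\to\mathcal F^*_{\rm A}(q^{\rho'\mp(k+2)},q^{\sigma'-k-2})$. On both $\mathcal F_{\rm A}(q^{\rho'},q^{\sigma'})$ and $\mathcal F_{\rm A}^*(q^{\rho'},q^{\sigma'})$ the screening charge $Q^\pm=\frac1{2\pi\sqrt{-1}}\oint S^\pm(z)\,dz=S^\pm_1$ commutes with $d$, with all $\mathbf K_m$, $\mathbf K^+_m$, $\mathbf K^-_m$ and with all $\mathbf T_m$, and anticommutes with all $\mathbf G^+_m$ and $\mathbf G^-_m$. All these Fock spaces are stable under the modes $\mathbf K^\pm_m,\mathbf T_m,\mathbf G^\pm_m$, and hence $Q^\pm$ is an (odd) intertwiner for their action between the Fock spaces just named, and between the dual ones. (3) Call a nonzero vector $\chi\in\mathcal F_{\rm A}(q^\rho,q^\sigma)$ singular if it is a joint eigenvector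 of $\mathbf T_0$ and $\mathbf K^\pm_0$ (with the same eigenvalue for $\mathbf K_0^+$ and $\mathbf K_0^-$), with eigenvalues $(\tau,\kappa)\neq(h,u)$ if ${\rm A}={\rm NS}$ and $(\tau,\kappa)\ne(q^{-1}h,q^{k/2}u)$ if ${\rm A}={\rm R}$, where $u=q^\rho$, $v=q^\sigma$, $h=quv-\frac{[k+2]}{[k+1]}u^2+q^{-1}uv^{-1}$, and if $\mathbf K^+_m\chi=\mathbf T_m\chi=\mathbf G^+_m\chi=\mathbf G^-_m\chi=0$ for $m>0$ and, if ${\rm A}={\rm R}$, also $\mathbf G^+_0\chi=0$. On $\mathcal F^*_{\rm A}(q^\rho,q^\sigma)$ the definition is the same, with the right action, $\mathbf K^-_m,\mathbf T_m,\mathbf G^\pm_m$ for $m<0$, and $\mathbf G^-_0$ instead of $\mathbf G^+_0$. Say that $\chi$ in either space has $p$-degree $a$ and $x$-degree $b$ if $d$ acts on it by $d_0(\varepsilon_{\rm A}+\rho,\rho,\sigma)+a$ and $J$ by $\varepsilon_{\rm A}/k+b$. For $m\in\mathbb Z_{\ge0}$ and $b=\pm1$ put $\deg_{\rm NS}(m,b)=m+\frac12$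 and $\deg_{\rm R}(m,b)=m+\frac{1+b}2$. Let $$g(\ell;u,v)=\frac{-u}{(q-q^{-1})^2}\bigl(q^{\frac{\ell+1}2}u^{\frac12}v^{\frac12}-q^{-\frac{\ell+1}2}u^{-\frac12}v^{-\frac12}\bigr)\bigl(q^{\frac{\ell-1}2}u^{\frac12}v^{-\frac12}-q^{-\frac{\ell-1}2}u^{-\frac12}v^{\frac12}\bigr).$$ (a) If $-1-\frac{\mp\rho+\sigma}2=m\in\mathbb Z_{\ge0}$ and $\rho'=\rho\mp(k+2)$, $\sigma'=\sigma-(k+2)$, then $Q^\pm|\varepsilon_{\rm A}+\rho',\rho',\sigma'\rangle$ lies in $\mathcal F(\varepsilon_{\rm A}+\rho\mp(k+2),\rho\mp2,\sigma)$ and is a singular vector of $\mathcal F_{\rm A}(q^\rho,q^\sigma)$ (in particular nonzero) of $p$-degree $\deg_{\rm A}(m,\mp1)$ and $x$-degree $\mp1$; moreover $g(\mp(2m+1);q^\rho,q^\sigma)=0$. (b) If $\frac{\mp\rho+\sigma}2=m\in\mathbb Z_{\ge0}$ and $\rho'=\rho\pm(k+2)$, $\sigma'=\sigma+(k+2)$,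 then $\langle\varepsilon_{\rm A}+\rho',\rho',\sigma'|Q^\pm$ lies in $\mathcal F^*(\varepsilon_{\rm A}+\rho\pm(k+2),\rho\pm2,\sigma)$ and is a singular vector of $\mathcal F^*_{\rm A}(q^\rho,q^\sigma)$ of $p$-degree $\deg_{\rm A}(m,\pm1)$ and $x$-degree $\pm1$; moreover $g(\pm(2m+1);q^\rho,q^\sigma)=0$. (c) For $m\in\mathbb Z_{\ge0}$ and $u,v\in\mathbb C^\times$, $$g(\pm(2m+1);u,v)=\frac{u}{(q-q^{-1})^2}\bigl(q^{m+1}u^{\pm\frac12}v^{\frac12}-q^{-m-1}u^{\mp\frac12}v^{-\frac12}\bigr)\bigl(q^{-m}u^{\mp\frac12}v^{\frac12}-q^{m}u^{\pm\frac12}v^{-\frac12}\bigr).$$ If $g(\pm(2m+1);u,v)=0$, then there are $\rho,\sigma$ with $q^\rho=u$, $q^\sigma=v$ such that either $-1-\frac{\pm\rho+\sigma}2=m$ and $Q^\mp|\varepsilon_{\rm A}+\rho\pm(k+2),\rho\pm(k+2),\sigma-(k+2)\rangle$ is a singular vector of $\mathcal F_{\rm A}(q^\rho,q^\sigma)$,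 or $\frac{\mp\rho+\sigma}2=m$ and $\langle\varepsilon_{\rm A}+\rho\pm(k+2),\rho\pm(k+2),\sigma+(k+2)|Q^\pm$ is a singular vector of $\mathcal F^*_{\rm A}(q^\rho,q^\sigma)$, in both cases of $p$-degree $\deg_{\rm A}(m,\pm1)$ and $x$-degree $\pm1$. -/

import Mathlib

namespace SVir

noncomputable section

/-- `q ^ x` for the deformation parameter `q = exp ħ`. -/
def qpow (ħ x : ℂ) : ℂ := Complex.exp (ħ * x)

/-- The number `q - q⁻¹`. -/
def qdiff (ħ : ℂ) : ℂ := qpow ħ 1 - qpow ħ (-1)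

/-- The `q`-number `[u] = (q ^ u - q ^ (-u)) / (q - q⁻¹)`. -/
def qnum (ħ u : ℂ) : ℂ := (qpow ħ u - qpow ħ (-u)) / qdiff ħ

/-- Genericity of `q = exp ħ` and `k`: the `q`-numbers by which one divides do not vanish
(in particular `q` is not a root of unity, `k ≠ 0` and `k ≠ -2`). -/
structure Generic (ħ k : ℂ) : Prop where
  two : ∀ m : ℕ, 0 < m → qnum ħ (2 * m) ≠ 0
  level : ∀ m : ℕ, 0 < m → qnum ħ (k * m) ≠ 0
  shifted : ∀ m : ℕ, 0 < m → qnum ħ ((k + 2) * m) ≠ 0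
  kone : qnum ħ (k + 1) ≠ 0

/-! ### Heisenberg algebra and Fock spaces

The three bosons `α̃`, `ᾱ`, `β` are numbered `0`, `1`, `2`. -/

/-- `comm ħ k i m = [a^i_m, a^i_{-m}]` for `m > 0`. -/
def comm (ħ k : ℂ) (i : Fin 3) (m : ℕ+) : ℂ :=
  ![qnum ħ ((k + 2) * (m : ℕ)) * qnum ħ (k * (m : ℕ)) / (m : ℕ),
    -(qnum ħ (2 * (m : ℕ)) * qnum ħ (k * (m : ℕ)) / (m : ℕ)),
    qnum ħ (2 * (m : ℕ)) * qnum ħ ((k + 2) * (m : ℕ)) / (m : ℕ)] i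

/-- Polynomials in the creation modes: for the Fock spaces `X (i, m)` is `a^i_{-m}`, for the dual
Fock spaces `X (i, m)` is `a^i_m`. -/
abbrev Osc := MvPolynomial (Fin 3 × ℕ+) ℂ

/-- Momenta `(ξ, ρ, σ)`. -/
abbrev Mom := Fin 3 → ℂ

/-- The sum over all momenta of the spaces `ℂ[a^i_{-m}] |ξ, ρ, σ⟩`; operators act from the left. -/
abbrev Fock := Mom →₀ Osc

/-- The sum over all momenta of the spaces `⟨ξ, ρ, σ| ℂ[a^i_m]`; operators act from the right. -/
abbrev DualFock := Mom →₀ Osc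

/-- The vector `|ξ, ρ, σ⟩`. -/
def ket (ξ ρ σ : ℂ) : Fock := Finsupp.single ![ξ, ρ, σ] 1

/-- The vector `⟨ξ, ρ, σ|`. -/
def bra (ξ ρ σ : ℂ) : DualFock := Finsupp.single ![ξ, ρ, σ] 1

/-- Eigenvalue of the zero mode `a^i_0` on `|ξ, ρ, σ⟩` and on `⟨ξ, ρ, σ|`. The sign for `ᾱ_0` comes
from `[ᾱ_0, Q_ᾱ] = -1`. -/
def zeroEig (μ : Mom) (i : Fin 3) : ℂ := ![μ 0, -μ 1, μ 2] i

/-- The mode that acts by multiplication: `a^i_{-m}` on the Fock space from the left,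
`a^i_m` on the dual Fock space from the right. -/
def raise (j : Fin 3 × ℕ+) : Module.End ℂ Osc := LinearMap.mulLeft ℂ (MvPolynomial.X j)

/-- The mode that acts by differentiation: `a^i_m` on the Fock space from the left,
`a^i_{-m}` on the dual Fock space from the right. -/
def lower (ħ k : ℂ) (j : Fin 3 × ℕ+) : Module.End ℂ Osc :=
  comm ħ k j.1 j.2 • (MvPolynomial.pderiv j).toLinearMap

/-- For commuting operators `u m`, the coefficient of `x ^ n` in `exp (∑_{m > 0} u m x ^ m)`. -/
def expCoeff (u : ℕ+ → Module.End ℂ Osc) (n : ℕ) : Module.End ℂ Osc :=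
  ∑ j ∈ Finset.range (n + 1), ((j.factorial : ℂ)⁻¹) •
    PowerSeries.coeff n
      ((PowerSeries.mk fun m => if h : 0 < m then u ⟨m, h⟩ else 0) ^ j)

/-- Weight of a monomial: the variable `X (i, m)` has weight `m`. -/
def weight (s : (Fin 3 × ℕ+) →₀ ℕ) : ℕ := s.sum fun j n => n * (j.2 : ℕ)

/-! ### Vertex operators -/

/-- The data of a normally ordered exponential
`:exp (∑_i ∑_{m ≠ 0} osc i m z^{-m} a^i_m + ∑_i chg i Q_i):  z^{∑_i zpw i a^i_0} q^{∑_i qpw i a^i_0}`.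
The value of `osc` at `m = 0` is not used. -/
structure Vertex where
  osc : Fin 3 → ℤ → ℂ
  chg : Fin 3 → ℂ
  zpw : Fin 3 → ℂ
  qpw : Fin 3 → ℂ

/-- The normally ordered product `:V W:`. -/
instance : Add Vertex where
  add V W := ⟨V.osc + W.osc, V.chg + W.chg, V.zpw + W.zpw, V.qpw + W.qpw⟩

/-- The inverse `:V⁻¹:`. -/
instance : Neg Vertex where
  neg V := ⟨-V.osc, -V.chg, -V.zpw, -V.qpw⟩

/-- The substitution `z ↦ q ^ s z`. -/
def Vertex.dilate (ħ s : ℂ) (V : Vertex) : Vertex where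
  osc i m := qpow ħ (-s * m) * V.osc i m
  chg := V.chg
  zpw := V.zpw
  qpw := V.qpw + s • V.zpw

/-- The coefficient of `z ^ N` in the oscillator part of a vertex operator acting from the left:
first the positive modes act (total power `z ^ (-b)`), then the negative modes. Only `b` at most the
weight of the monomial can contribute. -/
def oscLeft (ħ k : ℂ) (V : Vertex) (N : ℤ) : Module.End ℂ Osc :=
  (MvPolynomial.basisMonomials (Fin 3 × ℕ+) ℂ).constr ℂ fun s =>
    ∑ b ∈ Finset.range (weight s + 1),
      if 0 ≤ N + b then
        expCoeff (fun m => ∑ i, V.osc i (-(m : ℕ)) • raise (i, m)) (N + b).toNat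
          (expCoeff (fun m => ∑ i, V.osc i (m : ℕ) • lower ħ k (i, m)) b
            (MvPolynomial.monomial s 1))
      else 0

/-- The coefficient of `z ^ N` in the oscillator part of a vertex operator acting from the right:
first the negative modes act (total power `z ^ b`), then the positive modes. Only `b` at most the
weight of the monomial can contribute. -/
def oscRight (ħ k : ℂ) (V : Vertex) (N : ℤ) : Module.End ℂ Osc :=
  (MvPolynomial.basisMonomials (Fin 3 × ℕ+) ℂ).constr ℂ fun s =>
    ∑ b ∈ Finset.range (weight s + 1),
      if 0 ≤ b - N then
        expCoeff (fun m => ∑ i, V.osc i (m : ℕ) • raise (i, m)) (b - N).toNat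
          (expCoeff (fun m => ∑ i, V.osc i (-(m : ℕ)) • lower ħ k (i, m)) b
            (MvPolynomial.monomial s 1))
      else 0

/-- `intPart f r` is `f N` if `r` is an integer `N`, and `0` otherwise. -/
def intPart (f : ℤ → Module.End ℂ Osc) (r : ℂ) : Module.End ℂ Osc :=
  open Classical in if (⌊r.re⌋ : ℂ) = r then f ⌊r.re⌋ else 0

/-- The coefficient of `z ^ r`, for a complex exponent `r`, of a vertex operator acting on `Fock`:
`e^{∑ chg i Q_i}` adds `chg` to the momentum after the zero modes have acted. -/
def Vertex.left (ħ k : ℂ) (V : Vertex) (r : ℂ) : Module.End ℂ Fock :=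
  Finsupp.lsum ℂ fun μ : Mom =>
    qpow ħ (∑ i, V.qpw i * zeroEig μ i) •
      ((Finsupp.lsingle (μ + V.chg) : Osc →ₗ[ℂ] Fock) ∘ₗ
        intPart (oscLeft ħ k V) (r - ∑ i, V.zpw i * zeroEig μ i))

/-- The coefficient of `z ^ r` of a vertex operator acting on `DualFock` from the right:
`e^{∑ chg i Q_i}` subtracts `chg` from the momentum before the zero modes act. -/
def Vertex.right (ħ k : ℂ) (V : Vertex) (r : ℂ) : Module.End ℂ DualFock :=
  Finsupp.lsum ℂ fun μ : Mom =>
    qpow ħ (∑ i, V.qpw i * zeroEig (μ - V.chg) i) •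
      ((Finsupp.lsingle (μ - V.chg) : Osc →ₗ[ℂ] DualFock) ∘ₗ
        intPart (oscRight ħ k V) (r - ∑ i, V.zpw i * zeroEig (μ - V.chg) i))

/-- A current `∑ c z ^ e V(z)`, given as the list of its terms `(c, e, V)`. -/
abbrev Current := List (ℂ × ℂ × Vertex)

/-- The mode `A_m`, i.e. the coefficient of `z ^ (-m)` of a current `A(z)`, acting on `Fock`.
The index may be any complex number. -/
def Current.left (ħ k : ℂ) (A : Current) (m : ℂ) : Module.End ℂ Fock :=
  (A.map fun t => t.1 • t.2.2.left ħ k (-m - t.2.1)).sum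

/-- The mode `A_m` of a current acting on `DualFock` from the right. -/
def Current.right (ħ k : ℂ) (A : Current) (m : ℂ) : Module.End ℂ DualFock :=
  (A.map fun t => t.1 • t.2.2.right ħ k (-m - t.2.1)).sum

/-! ### The vertex operators of the twisted Wakimoto representation

The signs `±` are elements `s` of `ℤˣ`. -/

/-- The sign `s` as a complex number. -/
def sgn (s : ℤˣ) : ℂ := ((s : ℤ) : ℂ)

/-- The oscillator coefficients of `∑_{m ≠ 0} f m z^{-m} a^i_m` for a single boson `i`. -/
def only (i : Fin 3) (f : ℤ → ℂ) : Fin 3 → ℤ → ℂ := fun j m => if j = i then f m else 0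

/-- `Ṽ^±(z) = e^{±(k+2) Q_α̃} z^{± α̃_0 / k} :exp(∓ ∑_{m≠0} z^{-m} α̃_m / [km]):`. -/
def Vt (ħ k : ℂ) (s : ℤˣ) : Vertex where
  osc := only 0 fun m => -sgn s / qnum ħ (k * m)
  chg := ![sgn s * (k + 2), 0, 0]
  zpw := ![sgn s / k, 0, 0]
  qpw := 0

/-- `Y^±(z) = e^{±2 Q_ᾱ} z^{± ᾱ_0 / k} :exp(∓ ∑_{m≠0} q^{∓k|m|/2} z^{-m} ᾱ_m / [km]):`. -/
def Y (ħ k : ℂ) (s : ℤˣ) : Vertex where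
  osc := only 1 fun m => -sgn s * qpow ħ (-sgn s * k / 2 * (|m| : ℤ)) / qnum ħ (k * m)
  chg := ![0, sgn s * 2, 0]
  zpw := ![0, sgn s / k, 0]
  qpw := 0

/-- `Z_±(z) = exp(∓(q-q⁻¹) ∑_{m>0} z^{∓m} ([m]/[2m]) ᾱ_{±m}) q^{∓ ᾱ_0 / 2}`. -/
def Z (ħ : ℂ) (s : ℤˣ) : Vertex where
  osc := only 1 fun m => if 0 < (s : ℤ) * m then
    -sgn s * qdiff ħ * (qnum ħ (|m| : ℤ) / qnum ħ (2 * (|m| : ℤ))) else 0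
  chg := 0
  zpw := 0
  qpw := ![0, -sgn s / 2, 0]

/-- `W_±(z) = exp(∓(q-q⁻¹) ∑_{m>0} z^{∓m} ([m]/[2m]) β_{±m}) q^{∓ β_0 / 2}`. -/
def W (ħ : ℂ) (s : ℤˣ) : Vertex where
  osc := only 2 fun m => if 0 < (s : ℤ) * m then
    -sgn s * qdiff ħ * (qnum ħ (|m| : ℤ) / qnum ħ (2 * (|m| : ℤ))) else 0
  chg := 0
  zpw := 0
  qpw := ![0, 0, -sgn s / 2]

/-- `e_±(z) = :Y^+(z) Z_±(q^{∓(k+2)/2} z) W_±(q^{∓k/2} z):`. -/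
def e (ħ k : ℂ) (s : ℤˣ) : Vertex :=
  Y ħ k 1 + (Z ħ s).dilate ħ (-sgn s * (k + 2) / 2) + (W ħ s).dilate ħ (-sgn s * k / 2)

/-- `f_±(z) = :Y^-(z) Z_±(q^{±(k+2)/2} z) W_±(q^{±k/2} z)⁻¹:`. -/
def f (ħ k : ℂ) (s : ℤˣ) : Vertex :=
  Y ħ k (-1) + (Z ħ s).dilate ħ (sgn s * (k + 2) / 2) + -((W ħ s).dilate ħ (sgn s * k / 2))

/-- `K^±(z) = q^{α̃_0} exp((q-q⁻¹) ∑_{±m>0} α̃_m z^{-m})` as a vertex operator. -/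
def KVertex (ħ : ℂ) (s : ℤˣ) : Vertex where
  osc := only 0 fun m => if 0 < (s : ℤ) * m then qdiff ħ else 0
  chg := 0
  zpw := 0
  qpw := ![1, 0, 0]

/-- The current `K^±(z)`. -/
def Kpm (ħ : ℂ) (s : ℤˣ) : Current := [(1, 0, KVertex ħ s)]

/-- The current `K(z) = K^-(z) K^+(z)`; this product is already normally ordered. -/
def K (ħ : ℂ) : Current := [(1, 0, KVertex ħ (-1) + KVertex ħ 1)]

/-- `:Ṽ^+(q⁻¹ z) Ṽ^-(q z) e_ε(q^{-(k+2)/2} z) f_ε'(q^{(k+2)/2} z):`. -/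
def TVertex (ħ k : ℂ) (ε ε' : ℤˣ) : Vertex :=
  (Vt ħ k 1).dilate ħ (-1) + (Vt ħ k (-1)).dilate ħ 1 +
    (e ħ k ε).dilate ħ (-(k + 2) / 2) + (f ħ k ε').dilate ħ ((k + 2) / 2)

/-- The current `T(z) = :Ṽ^+(q⁻¹ z) Ṽ^-(q z): T_PF(z)`, where `T_PF(z)` is
`q⁻¹ :e_+ f_-: - ([k+2]/[k+1]) :e_+ f_+: + q :e_- f_+:` with arguments
`q^{-(k+2)/2} z` of `e_±` and `q^{(k+2)/2} z` of `f_±`. -/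
def T (ħ k : ℂ) : Current :=
  [(qpow ħ (-1), 0, TVertex ħ k 1 (-1)),
   (-(qnum ħ (k + 2) / qnum ħ (k + 1)), 0, TVertex ħ k 1 1),
   (qpow ħ 1, 0, TVertex ħ k (-1) 1)]

/-- `Ṽ^±(q^{∓(k+2)} z)` times `e_ε(q^{-(3k+4)/2} z)` for the upper sign and
times `f_ε(q^{(3k+4)/2} z)` for the lower sign. -/
def GVertex (ħ k : ℂ) (s ε : ℤˣ) : Vertex :=
  (Vt ħ k s).dilate ħ (-sgn s * (k + 2)) +
    (if s = 1 then (e ħ k ε).dilate ħ (-(3 * k + 4) / 2)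
      else (f ħ k ε).dilate ħ ((3 * k + 4) / 2))

/-- The current `G^±(z) = z^{1/2} (G^±_+(z) - G^±_-(z))`, where `G^±_ε(z)` is `±1/(q-q⁻¹)` times
the vertex operator `GVertex`. -/
def G (ħ k : ℂ) (s : ℤˣ) : Current :=
  [(sgn s / qdiff ħ, 1 / 2, GVertex ħ k s 1), (-(sgn s / qdiff ħ), 1 / 2, GVertex ħ k s (-1))]

/-! ### The fermionic screening currents -/

/-- `S^±(z) = exp(∑_{m>0} (z^m/[2m]) (q^{±km/2} β_{-m} ± q^{±(k+2)m/2} ᾱ_{-m}))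
exp(-∑_{m>0} (z^{-m}/[2m]) (q^{±km/2} β_m ± q^{±(k+2)m/2} ᾱ_m))
e^{(k+2) Q_β ± k Q_ᾱ} z^{(β_0 ± ᾱ_0)/2}`. Since `[-u] = -[u]`, both exponentials have the
coefficients `-q^{±k|m|/2}/[2m]` of `z^{-m} β_m` and `∓q^{±(k+2)|m|/2}/[2m]` of `z^{-m} ᾱ_m`. -/
def SVertex (ħ k : ℂ) (s : ℤˣ) : Vertex where
  osc := only 2 (fun m => -qpow ħ (sgn s * k / 2 * (|m| : ℤ)) / qnum ħ (2 * m)) +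
    only 1 (fun m => -sgn s * qpow ħ (sgn s * (k + 2) / 2 * (|m| : ℤ)) / qnum ħ (2 * m))
  chg := ![0, sgn s * k, k + 2]
  zpw := ![0, sgn s / 2, 1 / 2]
  qpw := 0

/-- The screening current `S^±(z)`. -/
def S (ħ k : ℂ) (s : ℤˣ) : Current := [(1, 0, SVertex ħ k s)]

/-- The screening charge `Q^± = (2πi)⁻¹ ∮ S^±(z) dz`, the coefficient of `z⁻¹`, on `Fock`. -/
def QLeft (ħ k : ℂ) (s : ℤˣ) : Module.End ℂ Fock := (S ħ k s).left ħ k 1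

/-- The screening charge `Q^±`, acting on `DualFock` from the right. -/
def QRight (ħ k : ℂ) (s : ℤˣ) : Module.End ℂ DualFock := (S ħ k s).right ħ k 1

/-! ### Degree operators -/

/-- `d_0(ξ, ρ, σ)`. -/
def d0 (k ξ ρ σ : ℂ) : ℂ :=
  ξ ^ 2 / (2 * k * (k + 2)) - ρ ^ 2 / (4 * k) + σ * (σ + 2) / (4 * (k + 2))

/-- The coefficient of `a^i_{-m} a^i_m` in the degree operator `d`. -/
def dCoeff (ħ k : ℂ) (j : Fin 3 × ℕ+) : ℂ :=
  ![((j.2 : ℕ) : ℂ) ^ 2 / (qnum ħ ((k + 2) * (j.2 : ℕ)) * qnum ħ (k * (j.2 : ℕ))),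
    -(((j.2 : ℕ) : ℂ) ^ 2 / (qnum ħ (2 * (j.2 : ℕ)) * qnum ħ (k * (j.2 : ℕ)))),
    ((j.2 : ℕ) : ℂ) ^ 2 / (qnum ħ (2 * (j.2 : ℕ)) * qnum ħ ((k + 2) * (j.2 : ℕ)))] j.1

/-- The oscillator part `∑ dCoeff (i, m) a^i_{-m} a^i_m` of `d`. On a monomial only the finitely many
modes that occur in it contribute. In the action from the right `a^i_{-m}` acts first and is the
lowering operator, so that the same formula describes both actions. -/
def dOsc (ħ k : ℂ) : Module.End ℂ Osc :=
  (MvPolynomial.basisMonomials (Fin 3 × ℕ+) ℂ).constr ℂ fun s =>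
    ∑ j ∈ s.support, dCoeff ħ k j • raise j (lower ħ k j (MvPolynomial.monomial s 1))

/-- The degree operator
`d = α̃_0²/(2k(k+2)) - ᾱ_0²/(4k) + β_0(β_0+2)/(4(k+2)) + ∑ dCoeff (i, m) a^i_{-m} a^i_m`,
acting on `Fock` from the left and on `DualFock` from the right. -/
def dOp (ħ k : ℂ) : Module.End ℂ (Mom →₀ Osc) :=
  Finsupp.lsum ℂ fun μ : Mom =>
    (Finsupp.lsingle μ : Osc →ₗ[ℂ] (Mom →₀ Osc)) ∘ₗ
      (d0 k (zeroEig μ 0) (zeroEig μ 1) (zeroEig μ 2) • LinearMap.id + dOsc ħ k)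

/-- The operator `J = (α̃_0 + ᾱ_0)/k`, acting on `Fock` from the left and on `DualFock` from the
right. -/
def JOp (k : ℂ) : Module.End ℂ (Mom →₀ Osc) :=
  Finsupp.lsum ℂ fun μ : Mom =>
    ((zeroEig μ 0 + zeroEig μ 1) / k) • (Finsupp.lsingle μ : Osc →ₗ[ℂ] (Mom →₀ Osc))

/-! ### Fock representations in the two sectors -/

/-- Neveu-Schwarz and Ramond sector. -/
inductive Sector where
  | NS
  | R

/-- `ε_NS = 0`, `ε_R = k/2`. -/
def Sector.eps (k : ℂ) : Sector → ℂ
  | NS => 0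
  | R => k / 2

/-- The `n`-th mode index of the supercurrents: `n + 1/2` in the NS sector, `n` in the R sector. -/
def Sector.idx (n : ℤ) : Sector → ℂ
  | NS => n + 1 / 2
  | R => n

/-- `𝓕(ξ, ρ, σ)`. -/
def fock0 (ξ ρ σ : ℂ) : Submodule ℂ Fock :=
  LinearMap.range (Finsupp.lsingle ![ξ, ρ, σ] : Osc →ₗ[ℂ] Fock)

/-- `𝓕*(ξ, ρ, σ)`. -/
def dualFock0 (ξ ρ σ : ℂ) : Submodule ℂ DualFock :=
  LinearMap.range (Finsupp.lsingle ![ξ, ρ, σ] : Osc →ₗ[ℂ] DualFock)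

/-- `𝓕_A(q^ρ, q^σ) = ⨁_{n ∈ ℤ} 𝓕(ε_A + ρ + (k+2) n, ρ + 2n, σ)`. -/
def fockA (k : ℂ) (A : Sector) (ρ σ : ℂ) : Submodule ℂ Fock :=
  ⨆ n : ℤ, fock0 (A.eps k + ρ + (k + 2) * n) (ρ + 2 * n) σ

/-- `𝓕*_A(q^ρ, q^σ) = ⨁_{n ∈ ℤ} 𝓕*(ε_A + ρ + (k+2) n, ρ + 2n, σ)`. -/
def dualFockA (k : ℂ) (A : Sector) (ρ σ : ℂ) : Submodule ℂ DualFock :=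
  ⨆ n : ℤ, dualFock0 (A.eps k + ρ + (k + 2) * n) (ρ + 2 * n) σ

/-- The generators `K^±_m`, `T_m`, `G^±_m` of the algebra; `G s n` is the supercurrent mode with
index `Sector.idx n`. (`K^±_m` is zero unless `±m ≥ 0`.) -/
inductive Gen where
  | K (s : ℤˣ) (m : ℤ)
  | T (m : ℤ)
  | G (s : ℤˣ) (n : ℤ)

/-- `-1` for the odd generators `G^±_m`, `1` for the even ones. -/
def Gen.parity : Gen → ℂ
  | K _ _ => 1
  | T _ => 1
  | G _ _ => -1

/-- The action of the generators on the Fock spaces. -/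
def Gen.left (ħ k : ℂ) (A : Sector) : Gen → Module.End ℂ Fock
  | K s m => (Kpm ħ s).left ħ k m
  | T m => (SVir.T ħ k).left ħ k m
  | G s n => (SVir.G ħ k s).left ħ k (A.idx n)

/-- The action of the generators on the dual Fock spaces, from the right. -/
def Gen.right (ħ k : ℂ) (A : Sector) : Gen → Module.End ℂ DualFock
  | K s m => (Kpm ħ s).right ħ k m
  | T m => (SVir.T ħ k).right ħ k m
  | G s n => (SVir.G ħ k s).right ħ k (A.idx n)

/-- `Φ` restricts to an odd intertwiner `V → V'` of representations: both subspaces are stable under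
the generators, `Φ` maps `V` to `V'`, commutes with the even generators and anticommutes with
the odd ones. -/
structure IsIntertwiner {F : Type} [AddCommGroup F] [Module ℂ F] (act : Gen → Module.End ℂ F)
    (Φ : Module.End ℂ F) (V V' : Submodule ℂ F) : Prop where
  stable_source : ∀ g, ∀ v ∈ V, act g v ∈ V
  stable_target : ∀ g, ∀ v ∈ V', act g v ∈ V'
  maps : ∀ v ∈ V, Φ v ∈ V'
  intertwines : ∀ g, ∀ v ∈ V, act g (Φ v) = g.parity • Φ (act g v)

/-- A series with complex exponents, given by its modes `c m` (the coefficients of `z ^ (-m)`),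
has a Fourier expansion on `V`: only integral powers of `z` occur. -/
def HasFourierExpansion {F : Type} [AddCommGroup F] [Module ℂ F] (c : ℂ → Module.End ℂ F)
    (V : Submodule ℂ F) : Prop :=
  ∀ v ∈ V, ∀ m : ℂ, (∀ n : ℤ, m ≠ n) → c m v = 0

/-! ### Singular vectors and the vanishing lines -/

/-- `h(u, v) = q u v - ([k+2]/[k+1]) u² + q⁻¹ u v⁻¹`. -/
def h (ħ k u v : ℂ) : ℂ :=
  qpow ħ 1 * u * v - qnum ħ (k + 2) / qnum ħ (k + 1) * u ^ 2 + qpow ħ (-1) * u * v⁻¹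

/-- The eigenvalue of `K^±_0` on the highest weight vector: `u` in the NS sector, `q^{k/2} u` in the
R sector. -/
def hwK (ħ k : ℂ) : Sector → ℂ → ℂ
  | .NS, u => u
  | .R, u => qpow ħ (k / 2) * u

/-- The eigenvalue of `T_0` on the highest weight vector: `h(u, v)` in the NS sector, `q⁻¹ h(u, v)`
in the R sector. -/
def hwT (ħ k : ℂ) : Sector → ℂ → ℂ → ℂ
  | .NS, u, v => h ħ k u v
  | .R, u, v => qpow ħ (-1) * h ħ k u v

/-- `χ` is a singular vector of `𝓕_A(q^ρ, q^σ)`: a nonzero joint eigenvector of `K^±_0` and `T_0`,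
with eigenvalues different from those of the highest weight vector, killed by `K^+_m`, `T_m` for
`m > 0`, by `G^±_m` for `m > 0`, and in the R sector also by `G^+_0`. -/
def IsSingular (ħ k : ℂ) (A : Sector) (ρ σ : ℂ) (χ : Fock) : Prop :=
  χ ∈ fockA k A ρ σ ∧ χ ≠ 0 ∧
  (∃ κ τ : ℂ, (∀ s, (Kpm ħ s).left ħ k 0 χ = κ • χ) ∧ (T ħ k).left ħ k 0 χ = τ • χ ∧
    (τ, κ) ≠ (hwT ħ k A (qpow ħ ρ) (qpow ħ σ), hwK ħ k A (qpow ħ ρ))) ∧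
  (∀ m : ℤ, 0 < m → (Kpm ħ 1).left ħ k m χ = 0 ∧ (T ħ k).left ħ k m χ = 0) ∧
  (match A with
    | .NS => ∀ s, ∀ n : ℤ, 0 ≤ n → (G ħ k s).left ħ k (n + 1 / 2) χ = 0
    | .R => (∀ n : ℤ, 0 ≤ n → (G ħ k 1).left ħ k n χ = 0) ∧
        ∀ n : ℤ, 0 < n → (G ħ k (-1)).left ħ k n χ = 0)

/-- `χ` is a singular vector of `𝓕*_A(q^ρ, q^σ)`: a nonzero joint eigenvector of `K^±_0` and `T_0`,
with eigenvalues different from those of the highest weight vector, killed by `K^-_m`, `T_m` for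
`m < 0`, by `G^±_m` for `m < 0`, and in the R sector also by `G^-_0`. -/
def IsDualSingular (ħ k : ℂ) (A : Sector) (ρ σ : ℂ) (χ : DualFock) : Prop :=
  χ ∈ dualFockA k A ρ σ ∧ χ ≠ 0 ∧
  (∃ κ τ : ℂ, (∀ s, (Kpm ħ s).right ħ k 0 χ = κ • χ) ∧ (T ħ k).right ħ k 0 χ = τ • χ ∧
    (τ, κ) ≠ (hwT ħ k A (qpow ħ ρ) (qpow ħ σ), hwK ħ k A (qpow ħ ρ))) ∧
  (∀ m : ℤ, m < 0 → (Kpm ħ (-1)).right ħ k m χ = 0 ∧ (T ħ k).right ħ k m χ = 0) ∧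
  (match A with
    | .NS => ∀ s, ∀ n : ℤ, n < 0 → (G ħ k s).right ħ k (n + 1 / 2) χ = 0
    | .R => (∀ n : ℤ, n ≤ 0 → (G ħ k (-1)).right ħ k n χ = 0) ∧
        ∀ n : ℤ, n < 0 → (G ħ k 1).right ħ k n χ = 0)

/-- `χ`, in the (dual) Fock space with parameters `ρ, σ`, is homogeneous of `p`-degree `p` and
`x`-degree `x`, i.e. of `d`-degree `d_0(ε_A + ρ, ρ, σ) + p` and `J`-degree `ε_A/k + x`. -/
def HasDegree (ħ k : ℂ) (A : Sector) (ρ σ : ℂ) (χ : Mom →₀ Osc) (p x : ℂ) : Prop :=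
  dOp ħ k χ = (d0 k (A.eps k + ρ) ρ σ + p) • χ ∧ JOp k χ = (A.eps k / k + x) • χ

/-- `m + 1/2` in the NS sector and `m + (1 + x)/2` in the R sector. -/
def Sector.pdeg (m : ℕ) (x : ℂ) : Sector → ℂ
  | NS => m + 1 / 2
  | R => m + (1 + x) / 2

/-- `g(ℓ; u, v)`. For `u, v ≠ 0` its value does not depend on the choice of the square roots. -/
def g (ħ ℓ u v : ℂ) : ℂ :=
  -u / qdiff ħ ^ 2 *
    (qpow ħ ((ℓ + 1) / 2) * u ^ (1 / 2 : ℂ) * v ^ (1 / 2 : ℂ) -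
      qpow ħ (-(ℓ + 1) / 2) * u ^ (-1 / 2 : ℂ) * v ^ (-1 / 2 : ℂ)) *
    (qpow ħ ((ℓ - 1) / 2) * u ^ (1 / 2 : ℂ) * v ^ (-1 / 2 : ℂ) -
      qpow ħ (-(ℓ - 1) / 2) * u ^ (-1 / 2 : ℂ) * v ^ (1 / 2 : ℂ))

end

end SVir

/-!
Write `V(z)` for a normally ordered exponential, given by a `Vertex`. By Wick's formula
(`oscLeft_oscLeft`), the products `V(z) S(w)` and `S(w) V(z)` are the normally ordered product
`:V(z) S(w):` times scalar series, the exponentials of the contractions (`contr`), expanded in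
`w / z` and in `z / w`. For the vertex operators which occur in the currents these scalar factors
are expansions of a rational function with at most one simple pole, so that
`V(z) S(w) - η S(w) V(z) = κ w ^ n δ(w / (q ^ a z)) :V(z) S(q ^ a z):` with `η = ±1` (`OPE`,
`OPE.left`, `oscLeft_commutator`).

* For `K^±` and `K` there is no contraction with `S^±`, so the fields commute.
* For `G^t_ε` and `S^s` with `t = -s` the factor is a polynomial and the fields anticommute. For
  `t = s` there is a pole, at a point which depends on `ε`, but the normally ordered products at
  the poles for `ε = 1` and `ε = -1` coincide (`ef_add_SVertex`). After taking the residue in `w`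
  they enter `G^t = G^t_+ - G^t_-` with opposite signs and cancel.
* In `T`, one of the three terms has a vanishing delta function, and the other two have the same
  normally ordered product at the pole; the coefficients `q^{∓1}` and `[k+2]/[k+1]` are such that
  the residues cancel (`Screens.commute_T`).

The action from the right is reduced to the action from the left by `Vertex.right_eq`, which
exchanges creation and annihilation modes and inverts `z`. The commutation with the degree operator
`d` holds because the oscillator part of `d` is the derivation which measures the weight
(`dOsc_eq_degDer`) and because `S^±` has conformal weight one (`d0Mom_add_SVertex_chg`).

The vacuum vectors are killed by the modes which have to kill singular vectors, since on these
vectors such modes are coefficients of the creation part of negative degree, hence zero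
(`isHighest_ket`, `isHighest_bra`); by the (anti)commutation relations the same is true for their
images under `Q^±`. Such an image is a coefficient of the creation part of `S^±`. It is nonzero
because the contraction of `S^±` with `e` or `f` is that of a simple pole, all of whose Taylor
coefficients are nonzero (`cre_SVertex_ne_zero`). Its `K_0`-eigenvalue differs from that of the
highest weight vector by a factor `q ^ (±(k + 2)) ≠ 1`. Finally, `g(±(2m+1); u, v) = 0` says that
`q ^ (2m+2) u ^ {±1} v = 1` or `q ^ (-2m) u ^ {∓1} v = 1` (`g_eq_zero_iff`), and a choice of
logarithms turns these equations into the two conditions on `ρ` and `σ` under which the singular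
vectors were constructed.
-/

namespace SVir

noncomputable section

/-! ### Exponentials of power series -/

section

/-- The derivation `x d/dx` of formal power series. -/
def theta {E : Type*} [Semiring E] (F : PowerSeries E) : PowerSeries E :=
  PowerSeries.mk fun n => n • PowerSeries.coeff n F

section Ring

variable {E : Type*} [Ring E]

@[simp] lemma coeff_theta (F : PowerSeries E) (n : ℕ) :
    PowerSeries.coeff n (theta F) = n • PowerSeries.coeff n F := by
  simp [theta]

lemma theta_mul (F G : PowerSeries E) : theta (F * G) = theta F * G + F * theta G := by
  ext n
  simp only [coeff_theta, PowerSeries.coeff_mul, map_add, Finset.smul_sum,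
    ← Finset.sum_add_distrib]
  refine Finset.sum_congr rfl fun x hx => ?_
  rw [← Finset.HasAntidiagonal.mem_antidiagonal.mp hx, add_smul, smul_mul_assoc, mul_smul_comm]

lemma theta_sub (F G : PowerSeries E) : theta (F - G) = theta F - theta G := by
  ext n
  simp [smul_sub]

lemma theta_one : theta (1 : PowerSeries E) = 0 := by
  ext n
  rcases n with _ | n <;> simp [PowerSeries.coeff_one]

lemma theta_pow {F : PowerSeries E} (h : Commute F (theta F)) (j : ℕ) :
    theta (F ^ (j + 1)) = (j + 1) • (theta F * F ^ j) := by
  induction j with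
  | zero => simp
  | succ j ih =>
    rw [pow_succ' F (j + 1), theta_mul, ih, mul_smul_comm, ← mul_assoc, h.eq, mul_assoc,
      ← pow_succ', succ_nsmul' _ (j + 1)]

/-- The linear differential equation `x H' = F H` with `F 0 = 0` determines `H` by its constant
term. Identities between exponentials are proved below by comparing such equations. -/
lemma eq_zero_of_theta_eq [Algebra ℂ E] {F H : PowerSeries E} (hF : PowerSeries.coeff 0 F = 0)
    (h0 : PowerSeries.coeff 0 H = 0) (h : theta H = F * H) : H = 0 := by
  ext n
  induction n using Nat.strong_induction_on with
  | _ n ih =>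
    rcases Nat.eq_zero_or_pos n with rfl | hn
    · simpa using h0
    have hc := congrArg (PowerSeries.coeff n) h
    rw [coeff_theta, PowerSeries.coeff_mul, Finset.sum_eq_zero] at hc
    · rw [← Nat.cast_smul_eq_nsmul ℂ] at hc
      simpa [hn.ne'] using hc
    · rintro ⟨a, b⟩ hx
      rw [Finset.HasAntidiagonal.mem_antidiagonal] at hx
      simp only at hx ⊢
      rcases Nat.eq_zero_or_pos a with rfl | ha
      · rw [hF, zero_mul]
      · rw [ih b (by omega)]
        simp

lemma eq_of_theta_eq [Algebra ℂ E] {F H H' : PowerSeries E} (hF : PowerSeries.coeff 0 F = 0)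
    (h0 : PowerSeries.coeff 0 H = PowerSeries.coeff 0 H')
    (h : theta H = F * H) (h' : theta H' = F * H') : H = H' := by
  refine sub_eq_zero.mp (eq_zero_of_theta_eq hF (by rw [map_sub, h0, sub_self]) ?_)
  rw [theta_sub, h, h', mul_sub]

/-- The series `∑_{m > 0} u m x ^ m`. -/
def genSeries (u : ℕ+ → E) : PowerSeries E :=
  PowerSeries.mk fun m => if h : 0 < m then u ⟨m, h⟩ else 0

@[simp] lemma coeff_zero_genSeries (u : ℕ+ → E) : PowerSeries.coeff 0 (genSeries u) = 0 := by
  simp [genSeries]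

@[simp] lemma coeff_pnat_genSeries (u : ℕ+ → E) (m : ℕ+) :
    PowerSeries.coeff (m : ℕ) (genSeries u) = u m := by
  rw [genSeries, PowerSeries.coeff_mk, dif_pos m.pos]
  rfl

lemma coeff_genSeries_pow_of_lt (u : ℕ+ → E) {n j : ℕ} (h : n < j) :
    PowerSeries.coeff n (genSeries u ^ j) = 0 := by
  induction j generalizing n with
  | zero => omega
  | succ j ih =>
    rw [pow_succ', PowerSeries.coeff_mul]
    refine Finset.sum_eq_zero ?_
    rintro ⟨a, b⟩ hx
    rw [Finset.HasAntidiagonal.mem_antidiagonal] at hx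
    simp only at hx ⊢
    rcases Nat.eq_zero_or_pos a with rfl | ha
    · rw [coeff_zero_genSeries, zero_mul]
    · rw [ih (by omega), mul_zero]

lemma commute_series {F G : PowerSeries E}
    (h : ∀ m n, Commute (PowerSeries.coeff m F) (PowerSeries.coeff n G)) : Commute F G := by
  ext n
  rw [PowerSeries.coeff_mul, PowerSeries.coeff_mul, ← Finset.Nat.sum_antidiagonal_swap]
  exact Finset.sum_congr rfl fun x _ => (h _ _).eq

lemma coeff_genSeries_eq (u : ℕ+ → E) (n : ℕ) :
    PowerSeries.coeff n (genSeries u) = 0 ∨ ∃ m, PowerSeries.coeff n (genSeries u) = u m := by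
  rcases Nat.eq_zero_or_pos n with rfl | h
  · exact Or.inl (coeff_zero_genSeries u)
  · exact Or.inr ⟨⟨n, h⟩, coeff_pnat_genSeries u ⟨n, h⟩⟩

lemma commute_genSeries {u v : ℕ+ → E} (h : ∀ m n, Commute (u m) (v n)) (m n : ℕ) :
    Commute (PowerSeries.coeff m (genSeries u)) (PowerSeries.coeff n (genSeries v)) := by
  rcases coeff_genSeries_eq u m with hm | ⟨m, hm⟩ <;>
  rcases coeff_genSeries_eq v n with hn | ⟨n, hn⟩ <;> simp [hm, hn, h]

variable [Algebra ℂ E]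

/-- The series `exp (∑_{m > 0} u m x ^ m)`. -/
def expSeries (u : ℕ+ → E) : PowerSeries E :=
  PowerSeries.mk fun n => ∑ j ∈ Finset.range (n + 1), ((j.factorial : ℂ)⁻¹) •
    PowerSeries.coeff n (genSeries u ^ j)

@[simp] lemma coeff_zero_expSeries (u : ℕ+ → E) : PowerSeries.coeff 0 (expSeries u) = 1 := by
  simp [expSeries]

lemma coeff_expSeries (u : ℕ+ → E) {n N : ℕ} (h : n < N) :
    PowerSeries.coeff n (expSeries u) = ∑ j ∈ Finset.range N, ((j.factorial : ℂ)⁻¹) •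
      PowerSeries.coeff n (genSeries u ^ j) := by
  rw [expSeries, PowerSeries.coeff_mk]
  refine Finset.sum_subset (Finset.range_mono h) fun j _ hj => ?_
  rw [coeff_genSeries_pow_of_lt u (by simpa using hj), smul_zero]

/-- The logarithmic derivative of the exponential of commuting coefficients. -/
lemma theta_expSeries {u : ℕ+ → E} (hu : ∀ m n, Commute (u m) (u n)) :
    theta (expSeries u) = theta (genSeries u) * expSeries u := by
  have hc : Commute (genSeries u) (theta (genSeries u)) :=
    commute_series fun m n => by
      rw [coeff_theta]
      exact (commute_genSeries hu m n).smul_right n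
  ext n
  rw [coeff_theta, coeff_expSeries u (N := n + 2) (by omega), Finset.sum_range_succ',
    PowerSeries.coeff_mul]
  have h1 : ∀ j : ℕ, n • ((((j + 1).factorial : ℕ) : ℂ)⁻¹ •
      PowerSeries.coeff n (genSeries u ^ (j + 1))) = ((j.factorial : ℂ)⁻¹) •
        PowerSeries.coeff n (theta (genSeries u) * genSeries u ^ j) := by
    intro j
    rw [smul_comm, ← coeff_theta, theta_pow hc, map_nsmul, ← Nat.cast_smul_eq_nsmul ℂ, smul_smul]
    congr 1
    rw [Nat.factorial_succ]
    have : ((j : ℂ) + 1) ≠ 0 := by exact_mod_cast j.succ_ne_zero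
    push_cast
    field_simp
  rw [smul_add, Finset.smul_sum, Finset.sum_congr rfl fun j _ => h1 j]
  have h2 : n • (((Nat.factorial 0 : ℕ) : ℂ)⁻¹ • PowerSeries.coeff n (genSeries u ^ 0)) = 0 := by
    rcases n with _ | n <;> simp [PowerSeries.coeff_one]
  rw [h2, add_zero]
  simp_rw [PowerSeries.coeff_mul, Finset.smul_sum]
  rw [Finset.sum_comm]
  refine Finset.sum_congr rfl fun x hx => ?_
  rw [coeff_expSeries u (N := n + 1) (by
    have := Finset.HasAntidiagonal.mem_antidiagonal.mp hx; omega), Finset.mul_sum]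
  exact Finset.sum_congr rfl fun j _ => (mul_smul_comm _ _ _).symm

lemma expSeries_eq {u : ℕ+ → E} (hu : ∀ m n, Commute (u m) (u n)) {F : PowerSeries E}
    (h0 : PowerSeries.coeff 0 F = 1) (h : theta F = theta (genSeries u) * F) :
    expSeries u = F :=
  eq_of_theta_eq (by simp) (by simp [h0]) (theta_expSeries hu) h

/-- The recursion `n eₙ = ∑ a uₐ e_b`, over `a + b = n`, for the coefficients of the exponential. -/
lemma nsmul_coeff_expSeries {u : ℕ+ → E} (hu : ∀ m n, Commute (u m) (u n)) (n : ℕ) :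
    n • PowerSeries.coeff n (expSeries u) = ∑ x ∈ Finset.HasAntidiagonal.antidiagonal n,
      x.1 • (PowerSeries.coeff x.1 (genSeries u) * PowerSeries.coeff x.2 (expSeries u)) := by
  rw [← coeff_theta, theta_expSeries hu, PowerSeries.coeff_mul]
  simp only [coeff_theta, smul_mul_assoc]

lemma commute_coeff_expSeries {u : ℕ+ → E} {a : E} (ha : ∀ m, Commute (u m) a) (n : ℕ) :
    Commute (PowerSeries.coeff n (expSeries u)) a := by
  rw [expSeries, PowerSeries.coeff_mk]
  refine Commute.sum_left _ _ _ fun j _ => Commute.smul_left ?_ _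
  clear * - ha
  have h : ∀ m, Commute (PowerSeries.coeff m (genSeries u)) a := fun m => by
    rcases coeff_genSeries_eq u m with hm | ⟨m, hm⟩ <;> simp [hm, ha]
  induction j generalizing n with
  | zero => rcases n with _ | n <;> simp [PowerSeries.coeff_one]
  | succ j ih' =>
    rw [pow_succ, PowerSeries.coeff_mul]
    exact Commute.sum_left _ _ _ fun x _ => (ih' _).mul_left (h _)

lemma expSeries_add {u v : ℕ+ → E} (hu : ∀ m n, Commute (u m) (u n))
    (hv : ∀ m n, Commute (v m) (v n)) (huv : ∀ m n, Commute (u m) (v n)) :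
    expSeries (u + v) = expSeries u * expSeries v := by
  have hgen : theta (genSeries (u + v)) = theta (genSeries u) + theta (genSeries v) := by
    ext n
    rcases Nat.eq_zero_or_pos n with rfl | h
    · rw [map_add, coeff_theta, coeff_theta, coeff_theta]
      simp
    · simp only [coeff_theta, genSeries, PowerSeries.coeff_mk, map_add, dif_pos h, ← smul_add]
      rfl
  refine expSeries_eq (fun m n => ?_) (by simp [PowerSeries.coeff_mul]) ?_
  · exact ((hu m n).add_right (huv m n)).add_left ((huv n m).symm.add_right (hv m n))
  · have hc : Commute (expSeries u) (theta (genSeries v)) := commute_series fun m n => by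
      rw [coeff_theta]
      refine Commute.smul_right ?_ n
      refine commute_coeff_expSeries (fun l => ?_) m
      rcases coeff_genSeries_eq v n with hn | ⟨n, hn⟩ <;> simp [hn, huv]
    rw [theta_mul, theta_expSeries hu, theta_expSeries hv, hgen, ← mul_assoc, hc.eq]
    noncomm_ring

lemma coeff_expSeries_rescale (c : ℂ) (u : ℕ+ → E) (n : ℕ) :
    PowerSeries.coeff n (expSeries fun m => c ^ (m : ℕ) • u m) =
      c ^ n • PowerSeries.coeff n (expSeries u) := by
  have h : ∀ j m, PowerSeries.coeff m ((genSeries fun m => c ^ (m : ℕ) • u m) ^ j) =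
      c ^ m • PowerSeries.coeff m (genSeries u ^ j) := by
    intro j
    induction j with
    | zero => intro m; rcases m with _ | m <;> simp [PowerSeries.coeff_one]
    | succ j ih =>
      intro m
      rw [pow_succ, pow_succ, PowerSeries.coeff_mul, PowerSeries.coeff_mul, Finset.smul_sum]
      refine Finset.sum_congr rfl fun x hx => ?_
      rw [← Finset.HasAntidiagonal.mem_antidiagonal.mp hx, ih, pow_add, mul_smul, smul_mul_assoc]
      congr 1
      rw [← mul_smul_comm]
      congr 1
      rcases Nat.eq_zero_or_pos x.2 with h0 | h0
      · simp [h0]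
      · simp [genSeries, h0]
  simp_rw [expSeries, PowerSeries.coeff_mk, h, Finset.smul_sum]
  exact Finset.sum_congr rfl fun j _ => smul_comm _ _ _

end Ring

lemma expCoeff_eq (u : ℕ+ → Module.End ℂ Osc) (n : ℕ) :
    expCoeff u n = PowerSeries.coeff n (expSeries u) := by
  rw [expSeries, PowerSeries.coeff_mk]
  rfl

lemma map_coeff_expSeries {R E : Type*} [Ring R] [Algebra ℂ R] [Ring E] [Algebra ℂ E]
    (φ : R →ₐ[ℂ] E) (u : ℕ+ → R) (n : ℕ) :
    φ (PowerSeries.coeff n (expSeries u)) =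
      PowerSeries.coeff n (expSeries fun m => φ (u m)) := by
  have h : (genSeries fun m => φ (u m)) = PowerSeries.map (φ : R →+* E) (genSeries u) := by
    ext n
    rcases Nat.eq_zero_or_pos n with rfl | h
    · simp [genSeries]
    · simp [genSeries, h]
  simp [expSeries, h, ← map_pow]

end

/-! ### Heisenberg exponentials as vertex operators -/

section

variable (ħ k : ℂ)

/-- The coefficient of `z ^ m` in the exponent of the creation part of `V(z)`. -/
def crePart (V : Vertex) (m : ℕ+) : Osc :=
  ∑ i, V.osc i (-(m : ℕ)) • MvPolynomial.X (i, m)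

/-- The coefficient of `z ^ (-m)` in the exponent of the annihilation part of `V(z)`. -/
def annOp (V : Vertex) (m : ℕ+) : Module.End ℂ Osc :=
  ∑ i, V.osc i (m : ℕ) • lower ħ k (i, m)

/-- The coefficient of `z ^ n` in the creation part of `V(z)`; it is a polynomial, which acts by
multiplication, and is zero for `n < 0`. -/
def cre (V : Vertex) (n : ℤ) : Osc :=
  if 0 ≤ n then PowerSeries.coeff n.toNat (expSeries (crePart V)) else 0

/-- The coefficient of `z ^ (-n)` in the annihilation part of `V(z)`. -/
def ann (V : Vertex) (n : ℕ) : Module.End ℂ Osc :=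
  PowerSeries.coeff n (expSeries (annOp ħ k V))

/-- The coefficient of `(w / z) ^ m` in the contraction of `V(z)` with `W(w)`, that is, in the
commutator of the annihilation exponent of `V(z)` with the creation exponent of `W(w)`. -/
def contr (V W : Vertex) (m : ℕ+) : ℂ :=
  ∑ i, V.osc i (m : ℕ) * W.osc i (-(m : ℕ)) * comm ħ k i m

lemma cre_of_neg (V : Vertex) {n : ℤ} (h : n < 0) : cre V n = 0 := if_neg (by omega)

lemma cre_natCast (V : Vertex) (n : ℕ) :
    cre V n = PowerSeries.coeff n (expSeries (crePart V)) := by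
  simp [cre]

lemma expCoeff_raise (V : Vertex) (n : ℕ) (p : Osc) :
    expCoeff (fun m => ∑ i, V.osc i (-(m : ℕ)) • raise (i, m)) n p =
      PowerSeries.coeff n (expSeries (crePart V)) * p := by
  have h : (fun m : ℕ+ => ∑ i, V.osc i (-(m : ℕ)) • raise (i, m)) =
      fun m => Algebra.lmul ℂ Osc (crePart V m) := by
    funext m
    simp only [crePart, map_sum, map_smul]
    rfl
  rw [expCoeff_eq, h, ← map_coeff_expSeries]
  rfl

lemma lower_mul (j : Fin 3 × ℕ+) (p q : Osc) :
    lower ħ k j (p * q) = lower ħ k j p * q + p * lower ħ k j q := by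
  simp only [lower, LinearMap.smul_apply, Derivation.coeFn_coe, Derivation.leibniz,
    smul_eq_mul, MvPolynomial.smul_eq_C_mul]
  ring

lemma annOp_mul (V : Vertex) (m : ℕ+) (p q : Osc) :
    annOp ħ k V m (p * q) = annOp ħ k V m p * q + p * annOp ħ k V m q := by
  simp only [annOp, LinearMap.sum_apply, LinearMap.smul_apply, lower_mul, smul_add,
    Finset.sum_add_distrib, Finset.sum_mul, Finset.mul_sum, smul_mul_assoc, mul_smul_comm]

lemma annOp_one (V : Vertex) (m : ℕ+) : annOp ħ k V m 1 = 0 := by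
  simp [annOp, lower]

lemma commute_lower (i j : Fin 3 × ℕ+) : Commute (lower ħ k i) (lower ħ k j) := by
  refine (Commute.smul_left ?_ _).smul_right _
  have h : ⁅(MvPolynomial.pderiv i : Derivation ℂ Osc Osc), MvPolynomial.pderiv j⁆ = 0 :=
    MvPolynomial.derivation_ext fun l => by
      rw [Derivation.commutator_apply, MvPolynomial.pderiv_X, MvPolynomial.pderiv_X,
        Pi.single_apply, Pi.single_apply]
      split_ifs <;> simp
  refine LinearMap.ext fun p => ?_
  have h2 := DFunLike.congr_fun h p
  rw [Derivation.commutator_apply, Derivation.zero_apply, sub_eq_zero] at h2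
  exact h2

lemma commute_annOp (V W : Vertex) (m n : ℕ+) :
    Commute (annOp ħ k V m) (annOp ħ k W n) :=
  Commute.sum_left _ _ _ fun _ _ => Commute.sum_right _ _ _ fun _ _ =>
    ((commute_lower ħ k _ _).smul_left _).smul_right _

lemma commute_ann (V W : Vertex) (m n : ℕ) : Commute (ann ħ k V m) (ann ħ k W n) :=
  commute_coeff_expSeries (fun l => (commute_coeff_expSeries
    (fun l' => commute_annOp ħ k W V l' l) n).symm) m

lemma ann_zero (V : Vertex) : ann ħ k V 0 = 1 := coeff_zero_expSeries _

lemma annOp_crePart (V W : Vertex) (l m : ℕ+) :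
    annOp ħ k V l (crePart W m) = if l = m then MvPolynomial.C (contr ħ k V W l) else 0 := by
  simp only [annOp, crePart, LinearMap.sum_apply, LinearMap.smul_apply, map_sum, map_smul, lower,
    Derivation.coeFn_coe, MvPolynomial.pderiv_X, Pi.single_apply, Prod.mk.injEq]
  split_ifs with h
  · subst h
    rw [contr, map_sum]
    refine Finset.sum_congr rfl fun i _ => ?_
    rw [Finset.sum_eq_single i]
    · simp only [and_self, if_true, MvPolynomial.smul_eq_C_mul, mul_one, map_mul]
      ring
    · intro b _ hb
      simp [hb.symm]
    · simp
  · have h' : ∀ a b : Fin 3, ¬ (a = b ∧ m = l) := fun a b hab => h hab.2.symm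
    simp [h']

lemma nsmul_ann_apply (V : Vertex) (n : ℕ) (p : Osc) :
    n • ann ħ k V n p = ∑ x ∈ Finset.HasAntidiagonal.antidiagonal n,
      x.1 • (PowerSeries.coeff x.1 (genSeries (annOp ħ k V)) (ann ħ k V x.2 p)) := by
  have h := nsmul_coeff_expSeries (commute_annOp ħ k V V) n
  have h2 := LinearMap.congr_fun h p
  rw [LinearMap.sum_apply] at h2
  exact h2

/-- Creation exponentials are eigenvectors of the annihilation operators. -/
lemma annOp_cre (V W : Vertex) (l : ℕ+) (n : ℤ) :
    annOp ħ k V l (cre W n) = contr ħ k V W l • cre W (n - (l : ℕ)) := by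
  rcases lt_or_ge n 0 with h | h
  · rw [cre_of_neg _ h, cre_of_neg _ (by omega)]
    simp
  obtain ⟨n, rfl⟩ := Int.eq_ofNat_of_zero_le h
  set E := expSeries (crePart W) with hE
  have hcomm : ∀ m n, Commute (crePart W m) (crePart W n) := fun _ _ => Commute.all _ _
  set F : PowerSeries Osc := PowerSeries.mk fun n => annOp ħ k V l (PowerSeries.coeff n E) with hF
  set Q : PowerSeries Osc := PowerSeries.C (MvPolynomial.C (contr ħ k V W l)) *
    PowerSeries.X ^ (l : ℕ) with hQ
  have hθQ : theta Q = PowerSeries.mk fun a =>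
      a • annOp ħ k V l (PowerSeries.coeff a (genSeries (crePart W))) := by
    ext1 a
    rw [hQ, coeff_theta, PowerSeries.coeff_C_mul, PowerSeries.coeff_X_pow, PowerSeries.coeff_mk]
    rcases Nat.eq_zero_or_pos a with rfl | ha
    · simp
    · lift a to ℕ+ using ha
      rw [coeff_pnat_genSeries, annOp_crePart]
      simp only [PNat.coe_inj, mul_ite, mul_one, mul_zero, eq_comm]
  have hθF : theta F = theta (genSeries (crePart W)) * F + theta Q * E := by
    ext1 n
    rw [coeff_theta, hF, PowerSeries.coeff_mk, ← map_nsmul, hE, nsmul_coeff_expSeries hcomm,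
      map_sum, map_add, PowerSeries.coeff_mul, PowerSeries.coeff_mul, ← Finset.sum_add_distrib]
    refine Finset.sum_congr rfl fun x _ => ?_
    rw [map_nsmul, annOp_mul, hθQ, PowerSeries.coeff_mk, PowerSeries.coeff_mk, coeff_theta,
      nsmul_add, smul_mul_assoc, smul_mul_assoc, add_comm]
  have hθE : theta E = theta (genSeries (crePart W)) * E := theta_expSeries hcomm
  have key : F - Q * E = 0 := by
    refine eq_zero_of_theta_eq (F := theta (genSeries (crePart W))) ?_ ?_ ?_
    · rw [coeff_theta, zero_smul]
    · rw [map_sub, hF, PowerSeries.coeff_mk, hE, coeff_zero_expSeries, annOp_one, hQ, mul_assoc,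
        PowerSeries.coeff_C_mul, PowerSeries.coeff_X_pow_mul', if_neg (by have := l.pos; omega)]
      simp
    · rw [theta_sub, hθF, theta_mul Q E, hθE]
      ring
  have := congrArg (PowerSeries.coeff n) (sub_eq_zero.mp key)
  rw [hF, PowerSeries.coeff_mk, hQ, mul_assoc, PowerSeries.coeff_C_mul,
    PowerSeries.coeff_X_pow_mul', ← MvPolynomial.smul_eq_C_mul] at this
  rw [cre_natCast, this]
  split_ifs with hl
  · rw [← cre_natCast, Nat.cast_sub hl]
  · rw [cre_of_neg _ (by omega)]

lemma ann_cre (V W : Vertex) (i : ℕ) (n : ℤ) :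
    ann ħ k V i (cre W n) =
      PowerSeries.coeff i (expSeries (contr ħ k V W)) • cre W (n - i) := by
  induction i using Nat.strong_induction_on with
  | _ i ih =>
    rcases Nat.eq_zero_or_pos i with rfl | hi
    · simp [ann_zero]
    have h1 := nsmul_ann_apply ħ k V i (cre W n)
    have h2 := congrArg (· • cre W (n - i))
      (nsmul_coeff_expSeries (u := contr ħ k V W) (fun _ _ => Commute.all _ _) i)
    simp only [Finset.sum_smul] at h2
    have h3 : i • ann ħ k V i (cre W n) =
        i • PowerSeries.coeff i (expSeries (contr ħ k V W)) • cre W (n - i) := by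
      rw [h1, ← smul_assoc, h2]
      refine Finset.sum_congr rfl ?_
      rintro ⟨a, b⟩ hx
      rw [Finset.HasAntidiagonal.mem_antidiagonal] at hx
      simp only at hx ⊢
      rcases Nat.eq_zero_or_pos a with rfl | ha
      · simp
      · lift a to ℕ+ using ha
        rw [ih b (by have := a.pos; omega), coeff_pnat_genSeries, coeff_pnat_genSeries, map_smul,
          annOp_cre, smul_assoc, mul_comm, mul_smul]
        congr 4
        omega
    rw [← Nat.cast_smul_eq_nsmul ℂ, ← Nat.cast_smul_eq_nsmul ℂ i] at h3
    exact smul_right_injective _ (by exact_mod_cast hi.ne') h3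

/-- The annihilation part of `V(z)` is the exponential of a derivation, hence multiplicative. -/
lemma ann_mul (V : Vertex) (n : ℕ) (p q : Osc) :
    ann ħ k V n (p * q) = ∑ x ∈ Finset.HasAntidiagonal.antidiagonal n,
      ann ħ k V x.1 p * ann ħ k V x.2 q := by
  set D := expSeries (annOp ħ k V) with hD
  set P := theta (genSeries (annOp ħ k V)) with hP
  set M : PowerSeries (Module.End ℂ Osc) :=
    PowerSeries.mk fun n => Algebra.lmul ℂ Osc (ann ħ k V n p) with hM
  have hθ : theta D = P * D := theta_expSeries (commute_annOp ħ k V V)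
  have hθM : theta M = P * M - M * P := by
    ext1 n
    rw [coeff_theta, map_sub, PowerSeries.coeff_mul, PowerSeries.coeff_mul,
      ← Finset.Nat.sum_antidiagonal_swap (f := fun x => PowerSeries.coeff x.1 M * _),
      ← Finset.sum_sub_distrib, hM, PowerSeries.coeff_mk, ← map_nsmul, nsmul_ann_apply, map_sum]
    refine Finset.sum_congr rfl fun x _ => ?_
    rw [PowerSeries.coeff_mk, hP, Prod.fst_swap, Prod.snd_swap, PowerSeries.coeff_mk, coeff_theta,
      smul_mul_assoc, mul_smul_comm, map_nsmul]
    refine Eq.trans ?_ (nsmul_sub _ _ _)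
    congr 1
    refine LinearMap.ext fun q => ?_
    rcases coeff_genSeries_eq (annOp ħ k V) x.1 with h | ⟨m, h⟩
    · simp [h]
    · simp [h, annOp_mul]
  have key : D * PowerSeries.C (Algebra.lmul ℂ Osc p) = M * D := by
    refine eq_of_theta_eq (F := P) (by simp [hP]) ?_ ?_ ?_
    · rw [PowerSeries.coeff_mul, PowerSeries.coeff_mul]
      simp [hD, hM, ann_zero]
    · rw [theta_mul, hθ, mul_assoc]
      have : theta (PowerSeries.C (Algebra.lmul ℂ Osc p)) = 0 := by
        ext1 n
        rcases n with _ | n <;> simp [PowerSeries.coeff_C]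
      rw [this, mul_zero, add_zero]
    · rw [theta_mul, hθM, hθ, sub_mul, mul_assoc, mul_assoc, sub_add_cancel]
  have := LinearMap.congr_fun (congrArg (PowerSeries.coeff n) key) q
  rw [PowerSeries.coeff_mul_C, PowerSeries.coeff_mul, LinearMap.sum_apply] at this
  rw [hM] at this
  simp only [PowerSeries.coeff_mk] at this
  exact this

end

/-! ### The degree derivation -/

section

variable (ħ k : ℂ)

/-- The derivation that multiplies `X (i, m)` by `m`. -/
def degDer : Derivation ℂ Osc Osc :=
  MvPolynomial.mkDerivation ℂ fun j => ((j.2 : ℕ) : ℂ) • MvPolynomial.X j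

lemma degDer_X (j : Fin 3 × ℕ+) :
    degDer (MvPolynomial.X j) = ((j.2 : ℕ) : ℂ) • MvPolynomial.X j :=
  MvPolynomial.mkDerivation_X _ _ _

lemma degDer_monomial (s : (Fin 3 × ℕ+) →₀ ℕ) (a : ℂ) :
    degDer (MvPolynomial.monomial s a) = (weight s : ℂ) • MvPolynomial.monomial s a := by
  rw [degDer, MvPolynomial.mkDerivation_monomial, weight]
  simp only [Finsupp.sum]
  rw [Nat.cast_sum, Finset.sum_smul, Finset.smul_sum]
  refine Finset.sum_congr rfl fun j hj => ?_
  have hX : (MvPolynomial.X j : Osc) * MvPolynomial.monomial (s - Finsupp.single j 1) (s j : ℂ) =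
      (s j) • MvPolynomial.monomial s 1 := by
    rw [← MvPolynomial.X_mul_pderiv_monomial, MvPolynomial.pderiv_monomial, one_mul]
  rw [smul_eq_mul, mul_smul_comm, mul_comm, hX, smul_comm, ← Nat.cast_smul_eq_nsmul ℂ,
    smul_smul, smul_smul, MvPolynomial.smul_monomial, MvPolynomial.smul_monomial]
  congr 1
  push_cast
  simp
  ring

lemma coeff_degDer (t : (Fin 3 × ℕ+) →₀ ℕ) (p : Osc) :
    MvPolynomial.coeff t (degDer p) = weight t * MvPolynomial.coeff t p := by
  induction p using MvPolynomial.induction_on' with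
  | monomial s a =>
    rw [degDer_monomial, MvPolynomial.coeff_smul, MvPolynomial.coeff_monomial]
    split_ifs with h
    · rw [h, smul_eq_mul]
    · simp
  | add p q hp hq =>
    rw [map_add, MvPolynomial.coeff_add, MvPolynomial.coeff_add, hp, hq, mul_add]

lemma degDer_crePart (V : Vertex) (m : ℕ+) : degDer (crePart V m) = (m : ℕ) • crePart V m := by
  simp only [crePart, map_sum, Derivation.map_smul, degDer_X, Finset.smul_sum]
  refine Finset.sum_congr rfl fun i _ => ?_
  rw [smul_comm, Nat.cast_smul_eq_nsmul]

lemma degDer_cre (V : Vertex) (n : ℤ) : degDer (cre V n) = (n : ℂ) • cre V n := by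
  rcases lt_or_ge n 0 with h | h
  · rw [cre_of_neg _ h]
    simp
  lift n to ℕ using h
  set E := expSeries (crePart V) with hE
  have hcomm : ∀ m n, Commute (crePart V m) (crePart V n) := fun _ _ => Commute.all _ _
  have hθE : theta E = theta (genSeries (crePart V)) * E := theta_expSeries hcomm
  set F : PowerSeries Osc := PowerSeries.mk fun n => degDer (PowerSeries.coeff n E) with hF
  have hgen : ∀ a, degDer (PowerSeries.coeff a (genSeries (crePart V))) =
      PowerSeries.coeff a (theta (genSeries (crePart V))) := fun a => by
    rcases Nat.eq_zero_or_pos a with rfl | ha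
    · rw [coeff_zero_genSeries, coeff_theta]
      simp
    · lift a to ℕ+ using ha
      rw [coeff_theta, coeff_pnat_genSeries, degDer_crePart]
  have hθF : theta F = theta (genSeries (crePart V)) * F +
      theta (theta (genSeries (crePart V))) * E := by
    ext1 n
    rw [coeff_theta, hF, PowerSeries.coeff_mk, ← map_nsmul, hE, nsmul_coeff_expSeries hcomm,
      map_sum, map_add, PowerSeries.coeff_mul, PowerSeries.coeff_mul, ← Finset.sum_add_distrib]
    refine Finset.sum_congr rfl fun x _ => ?_
    rw [map_nsmul, Derivation.leibniz, hgen, PowerSeries.coeff_mk, coeff_theta, coeff_theta,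
      coeff_theta, nsmul_add, smul_eq_mul, smul_eq_mul, smul_mul_assoc, smul_mul_assoc]
    congr 2
    exact mul_comm _ _
  have key : F - theta E = 0 := by
    refine eq_zero_of_theta_eq (F := theta (genSeries (crePart V))) ?_ ?_ ?_
    · rw [coeff_theta, zero_smul]
    · rw [map_sub, hF, PowerSeries.coeff_mk, coeff_theta, hE, coeff_zero_expSeries]
      simp
    · rw [theta_sub, hθF, congrArg theta hθE, theta_mul]
      ring
  have := congrArg (PowerSeries.coeff n) (sub_eq_zero.mp key)
  rw [hF, PowerSeries.coeff_mk, coeff_theta] at this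
  rw [cre_natCast, this, Int.cast_natCast, Nat.cast_smul_eq_nsmul]

lemma degDer_lower (j : Fin 3 × ℕ+) (p : Osc) :
    degDer (lower ħ k j p) = lower ħ k j (degDer p) - (j.2 : ℕ) • lower ħ k j p := by
  have h : ⁅degDer, (MvPolynomial.pderiv j : Derivation ℂ Osc Osc)⁆ =
      -(((j.2 : ℕ) : ℂ) • MvPolynomial.pderiv j) :=
    MvPolynomial.derivation_ext fun l => by
      rw [Derivation.commutator_apply, MvPolynomial.pderiv_X, degDer_X, Derivation.neg_apply,
        Derivation.smul_apply, Derivation.map_smul, MvPolynomial.pderiv_X, Pi.single_apply]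
      split_ifs with h
      · simp [h]
      · simp
  have h2 := DFunLike.congr_fun h p
  rw [Derivation.commutator_apply, Derivation.neg_apply, Derivation.smul_apply,
    sub_eq_iff_eq_add] at h2
  simp only [lower, LinearMap.smul_apply, Derivation.coeFn_coe, Derivation.map_smul, h2]
  rw [← Nat.cast_smul_eq_nsmul ℂ]
  module

lemma degDer_annOp (V : Vertex) (m : ℕ+) (p : Osc) :
    degDer (annOp ħ k V m p) = annOp ħ k V m (degDer p) - (m : ℕ) • annOp ħ k V m p := by
  simp only [annOp, LinearMap.sum_apply, LinearMap.smul_apply, map_sum, Derivation.map_smul,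
    degDer_lower, Finset.smul_sum, ← Finset.sum_sub_distrib, smul_sub]
  exact Finset.sum_congr rfl fun i _ => by rw [smul_comm]

lemma degDer_ann (V : Vertex) (n : ℕ) (p : Osc) :
    degDer (ann ħ k V n p) = ann ħ k V n (degDer p) - n • ann ħ k V n p := by
  induction n using Nat.strong_induction_on with
  | _ n ih =>
    rcases Nat.eq_zero_or_pos n with rfl | hn
    · simp [ann_zero]
    have h : n • degDer (ann ħ k V n p) =
        n • (ann ħ k V n (degDer p) - n • ann ħ k V n p) := by
      rw [← map_nsmul, nsmul_ann_apply, map_sum, smul_sub, nsmul_ann_apply ħ k V n (degDer p),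
        Finset.smul_sum, ← Finset.sum_sub_distrib]
      refine Finset.sum_congr rfl ?_
      rintro ⟨a, b⟩ hx
      rw [Finset.HasAntidiagonal.mem_antidiagonal] at hx
      simp only at hx ⊢
      rcases Nat.eq_zero_or_pos a with rfl | ha
      · simp
      · lift a to ℕ+ using ha
        rw [coeff_pnat_genSeries, map_nsmul, degDer_annOp, ih b (by have := a.pos; omega), map_sub,
          map_nsmul, ← hx]
        module
    rw [← Nat.cast_smul_eq_nsmul ℂ, ← Nat.cast_smul_eq_nsmul ℂ n] at h
    exact smul_right_injective _ (by exact_mod_cast hn.ne') h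

/-- The eigenvalues of the degree derivation are natural numbers. -/
lemma eq_zero_of_degDer {p : Osc} {c : ℂ} (h : degDer p = c • p) (hc : ∀ n : ℕ, (n : ℂ) ≠ c) :
    p = 0 := by
  ext t
  have h1 := congrArg (MvPolynomial.coeff t) h
  rw [coeff_degDer, MvPolynomial.coeff_smul, smul_eq_mul, ← sub_eq_zero, ← sub_mul] at h1
  simpa [sub_eq_zero, hc] using h1

/-- Polynomials of weight at most `w`. -/
def weightLE (w : ℕ) : Submodule ℂ Osc :=
  Submodule.span ℂ {p | ∃ s, weight s ≤ w ∧ p = MvPolynomial.monomial s 1}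

lemma exists_mem_weightLE (p : Osc) : ∃ w, p ∈ weightLE w := by
  refine ⟨p.support.sup weight, ?_⟩
  rw [p.as_sum]
  refine Submodule.sum_mem _ fun s hs => ?_
  have : MvPolynomial.monomial s (p.coeff s) = p.coeff s • MvPolynomial.monomial s (1 : ℂ) := by
    simp [MvPolynomial.smul_monomial]
  rw [this]
  exact Submodule.smul_mem _ _ (Submodule.subset_span
    ⟨s, Finset.le_sup (f := weight) (by rwa [← p.as_sum]), rfl⟩)

/-- Annihilation operators of total degree above the weight kill a polynomial; this makes all mode
sums finite. -/
lemma ann_ann_eq_zero {w : ℕ} {p : Osc} (hp : p ∈ weightLE w) (V W : Vertex) {i j : ℕ}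
    (h : w < i + j) : ann ħ k V i (ann ħ k W j p) = 0 := by
  induction hp using Submodule.span_induction with
  | mem p hp =>
    obtain ⟨s, hs, rfl⟩ := hp
    refine eq_zero_of_degDer (c := (weight s : ℂ) - j - i) ?_ ?_
    · rw [degDer_ann, degDer_ann, degDer_monomial]
      simp only [map_sub, map_smul, map_nsmul]
      module
    · intro n hn
      have : ((n + i + j : ℕ) : ℂ) = (weight s : ℕ) := by
        push_cast
        rw [hn]
        ring
      have := Nat.cast_injective this
      omega
  | zero => simp
  | add p q _ _ hp hq => simp [hp, hq]
  | smul c p _ hp => simp [hp]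

lemma ann_eq_zero {w : ℕ} {p : Osc} (hp : p ∈ weightLE w) (V : Vertex) {i : ℕ}
    (h : w < i) : ann ħ k V i p = 0 := by
  simpa [ann_zero] using ann_ann_eq_zero ħ k hp V V (i := i) (j := 0) h

/-- The defining sum of `oscLeft`, which depends on the weight of a monomial, can be cut off at any
`B` above the weight. -/
lemma oscLeft_eq {w B : ℕ} {p : Osc} (hp : p ∈ weightLE w) (hB : w < B) (V : Vertex) (N : ℤ) :
    oscLeft ħ k V N p = ∑ b ∈ Finset.range B, cre V (N + b) * ann ħ k V b p := by
  induction hp using Submodule.span_induction with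
  | mem p hp =>
    obtain ⟨s, hs, rfl⟩ := hp
    have h1 : oscLeft ħ k V N (MvPolynomial.monomial s 1) = ∑ b ∈ Finset.range (weight s + 1),
        cre V (N + b) * ann ħ k V b (MvPolynomial.monomial s 1) := by
      have := (MvPolynomial.basisMonomials (Fin 3 × ℕ+) ℂ).constr_basis ℂ (fun s =>
        ∑ b ∈ Finset.range (weight s + 1),
        if 0 ≤ N + b then
        expCoeff (fun m => ∑ i, V.osc i (-(m : ℕ)) • raise (i, m)) (N + b).toNat
          (expCoeff (fun m => ∑ i, V.osc i (m : ℕ) • lower ħ k (i, m)) b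
            (MvPolynomial.monomial s 1)) else 0) s
      rw [MvPolynomial.coe_basisMonomials] at this
      refine this.trans (Finset.sum_congr rfl fun b _ => ?_)
      rw [cre]
      split_ifs
      · rw [expCoeff_raise, expCoeff_eq]
        rfl
      · rw [zero_mul]
    rw [h1]
    refine Finset.sum_subset (Finset.range_mono (by omega)) fun b _ hb => ?_
    rw [ann_eq_zero ħ k (w := weight s) (Submodule.subset_span ⟨s, le_rfl, rfl⟩) V
      (by simp at hb; omega), mul_zero]
  | zero => simp
  | add p q _ _ hp hq => simp [hp, hq, mul_add, Finset.sum_add_distrib]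
  | smul c p _ hp => simp [hp, Finset.smul_sum]

lemma degDer_oscLeft (V : Vertex) (N : ℤ) (p : Osc) :
    degDer (oscLeft ħ k V N p) = oscLeft ħ k V N (degDer p) + (N : ℂ) • oscLeft ħ k V N p := by
  obtain ⟨w, hp⟩ := exists_mem_weightLE p
  obtain ⟨w', hp'⟩ := exists_mem_weightLE (degDer p)
  rw [oscLeft_eq ħ k hp (B := w + w' + 1) (by omega),
    oscLeft_eq ħ k hp' (B := w + w' + 1) (by omega), Finset.smul_sum, ← Finset.sum_add_distrib,
    map_sum]
  refine Finset.sum_congr rfl fun b _ => ?_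
  rw [Derivation.leibniz, degDer_cre, degDer_ann]
  simp only [smul_eq_mul, mul_sub, MvPolynomial.smul_eq_C_mul, nsmul_eq_mul]
  push_cast
  simp only [map_add, map_natCast]
  ring

lemma oscLeft_one (V : Vertex) (N : ℤ) : oscLeft ħ k V N 1 = cre V N := by
  have h : (1 : Osc) ∈ weightLE 0 := Submodule.subset_span ⟨0, by simp [weight], rfl⟩
  rw [oscLeft_eq ħ k h (B := 1) (by omega)]
  simp [ann_zero]

end

/-! ### Products of the oscillator parts -/

section

variable (ħ k : ℂ)

/-- The coefficient of `z ^ P w ^ R` in the normally ordered product `:V(z) W(w):` applied to `p`.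
The annihilation degrees are cut off at `J`, which is harmless once `J` exceeds the weight of `p`.
-/
def normProd (V W : Vertex) (J : ℕ) (P R : ℤ) (p : Osc) : Osc :=
  ∑ x ∈ Finset.range J ×ˢ Finset.range J,
    cre V (P + x.1) * cre W (R + x.2) * ann ħ k V x.1 (ann ħ k W x.2 p)

lemma normProd_comm (V W : Vertex) (J : ℕ) (P R : ℤ) (p : Osc) :
    normProd ħ k V W J P R p = normProd ħ k W V J R P p := by
  rw [normProd, normProd, Finset.sum_product_right, Finset.sum_product]
  refine Finset.sum_congr rfl fun i _ => Finset.sum_congr rfl fun j _ => ?_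
  have h := LinearMap.congr_fun (commute_ann ħ k V W j i).eq p
  simp only [Module.End.mul_apply] at h
  rw [h]
  ring

lemma normProd_eq_zero (V W : Vertex) {J : ℕ} {P R : ℤ} (p : Osc) (h : P + J ≤ 0 ∨ R + J ≤ 0) :
    normProd ħ k V W J P R p = 0 := by
  refine Finset.sum_eq_zero fun x hx => ?_
  simp only [Finset.mem_product, Finset.mem_range] at hx
  rcases h with h | h
  · rw [cre_of_neg V (by omega), zero_mul, zero_mul]
  · rw [cre_of_neg W (by omega), mul_zero, zero_mul]

lemma sum_antidiagonal_eq_sum_box {M : Type*} [AddCommMonoid M] (f : ℕ × ℕ → M) {I J B : ℕ}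
    (hB : I + J ≤ B) (hf : ∀ x, I ≤ x.1 ∨ J ≤ x.2 → f x = 0) :
    ∑ b ∈ Finset.range B, ∑ x ∈ Finset.HasAntidiagonal.antidiagonal b, f x =
      ∑ x ∈ Finset.range I ×ˢ Finset.range J, f x := by
  rw [← Finset.sum_fiberwise_of_maps_to (t := Finset.range B) (g := fun x : ℕ × ℕ => x.1 + x.2)]
  · refine Finset.sum_congr rfl fun b _ => (Finset.sum_subset ?_ ?_).symm
    · intro x hx
      simp only [Finset.mem_filter] at hx
      exact Finset.HasAntidiagonal.mem_antidiagonal.mpr hx.2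
    · intro x hx hx'
      rw [Finset.HasAntidiagonal.mem_antidiagonal] at hx
      apply hf
      by_contra! hc
      simp [hc, hx] at hx'
  · intro x hx
    simp only [Finset.mem_product, Finset.mem_range] at hx ⊢
    omega

/-- Extension by zero of the coefficients of a power series to negative indices. -/
def coeffZ (F : PowerSeries ℂ) (n : ℤ) : ℂ := if 0 ≤ n then PowerSeries.coeff n.toNat F else 0

lemma support_normProd_subset (V W : Vertex) (J : ℕ) (P R : ℤ) (p : Osc) :
    (Function.support fun i : ℤ => normProd ħ k V W J (P + i) (R - i) p) ⊆
      Finset.Icc (-P - J) (R + J) := by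
  intro i hi
  by_contra hc
  simp only [Finset.coe_Icc, Set.mem_Icc] at hc
  exact hi (normProd_eq_zero ħ k V W p (by omega))

lemma hasFiniteSupport_smul_normProd (V W : Vertex) (J : ℕ) (P R : ℤ) (p : Osc) (c : ℤ → ℂ) :
    (fun i : ℤ => c i • normProd ħ k V W J (P + i) (R - i) p).HasFiniteSupport := by
  refine (Finset.finite_toSet _).subset fun i hi =>
    support_normProd_subset ħ k V W J P R p fun h0 => hi ?_
  show c i • _ = _
  rw [show normProd ħ k V W J (P + i) (R - i) p = 0 from h0, smul_zero]

/-- Wick's formula `V(z) W(w) = exp (∑ contr (w / z) ^ m) :V(z) W(w):` in terms of coefficients. -/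
lemma oscLeft_oscLeft {w J : ℕ} {p : Osc} (hp : p ∈ weightLE w) (hJ : w < J) (V W : Vertex)
    (N M : ℤ) :
    oscLeft ħ k V N (oscLeft ħ k W M p) =
      ∑ᶠ i : ℤ, coeffZ (expSeries (contr ħ k V W)) i • normProd ħ k V W J (N + i) (M - i) p := by
  obtain ⟨I, hI⟩ : ∃ I : ℕ, M + J ≤ I := ⟨(M + J).toNat, Int.self_le_toNat _⟩
  obtain ⟨w', hp'⟩ := exists_mem_weightLE (oscLeft ħ k W M p)
  rw [oscLeft_eq ħ k hp' (B := w' + 1 + (I + J)) (by omega), oscLeft_eq ħ k hp hJ]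
  simp_rw [map_sum, Finset.mul_sum]
  rw [Finset.sum_comm]
  have h1 : ∀ c ∈ Finset.range J, ∑ b ∈ Finset.range (w' + 1 + (I + J)),
      cre V (N + b) * ann ħ k V b (cre W (M + c) * ann ħ k W c p) =
      ∑ i ∈ Finset.range I, ∑ j ∈ Finset.range J,
        PowerSeries.coeff i (expSeries (contr ħ k V W)) •
          (cre V (N + i + j) * cre W (M - i + c) * ann ħ k V j (ann ħ k W c p)) := by
    intro c hc
    rw [Finset.mem_range] at hc
    rw [← Finset.sum_product', ← sum_antidiagonal_eq_sum_box (B := w' + 1 + (I + J))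
      (f := fun x => PowerSeries.coeff x.1 (expSeries (contr ħ k V W)) •
          (cre V (N + x.1 + x.2) * cre W (M - x.1 + c) * ann ħ k V x.2 (ann ħ k W c p)))
      (by omega)]
    · refine Finset.sum_congr rfl fun b _ => ?_
      rw [ann_mul, Finset.mul_sum]
      refine Finset.sum_congr rfl fun x hx => ?_
      rw [Finset.HasAntidiagonal.mem_antidiagonal] at hx
      rw [ann_cre, ← hx, Nat.cast_add, ← add_assoc, add_sub_right_comm, smul_mul_assoc,
        mul_smul_comm, mul_assoc]
    · rintro x (h | h)
      · rw [cre_of_neg W (by omega)]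
        simp
      · rw [ann_ann_eq_zero ħ k hp V W (by omega)]
        simp
  rw [Finset.sum_congr rfl h1, Finset.sum_comm]
  have h2 : (Function.support fun i : ℤ => coeffZ (expSeries (contr ħ k V W)) i •
      normProd ħ k V W J (N + i) (M - i) p) ⊆
        (Finset.range I).map ⟨fun i : ℕ => (i : ℤ), Nat.cast_injective⟩ := by
    intro i hi
    have h0 : 0 ≤ i := by
      by_contra hc
      exact hi (by simp only [coeffZ, if_neg hc, zero_smul])
    lift i to ℕ using h0
    by_contra hc
    simp at hc
    exact hi (by
      show _ • _ = _
      rw [normProd_eq_zero ħ k V W p (by omega), smul_zero])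
  rw [finsum_eq_sum_of_support_subset _ h2, Finset.sum_map]
  refine Finset.sum_congr rfl fun i _ => ?_
  simp only [Function.Embedding.coeFn_mk, coeffZ, Nat.cast_nonneg, if_true, Int.toNat_natCast,
    normProd, Finset.sum_product_right, Finset.smul_sum]

lemma add_osc (V W : Vertex) : (V + W).osc = V.osc + W.osc := rfl

lemma crePart_add (V W : Vertex) : crePart (V + W) = crePart V + crePart W := by
  funext m
  simp [crePart, add_osc, add_smul, Finset.sum_add_distrib]

lemma annOp_add (V W : Vertex) : annOp ħ k (V + W) = annOp ħ k V + annOp ħ k W := by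
  funext m
  simp [annOp, add_osc, add_smul, Finset.sum_add_distrib]

lemma qpow_add (x y : ℂ) : qpow ħ (x + y) = qpow ħ x * qpow ħ y := by
  rw [qpow, mul_add, Complex.exp_add, qpow, qpow]

lemma qpow_ne_zero (x : ℂ) : qpow ħ x ≠ 0 := Complex.exp_ne_zero _

lemma qpow_zero : qpow ħ 0 = 1 := by simp [qpow]

lemma qpow_neg (x : ℂ) : qpow ħ (-x) = (qpow ħ x)⁻¹ := by
  rw [qpow, mul_neg, Complex.exp_neg, qpow]

lemma qpow_mul_intCast (x : ℂ) (n : ℤ) : qpow ħ (x * n) = qpow ħ x ^ n := by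
  rw [qpow, qpow, ← Complex.exp_int_mul]
  ring_nf

lemma qpow_mul_natCast (x : ℂ) (n : ℕ) : qpow ħ (x * n) = qpow ħ x ^ n := by
  exact_mod_cast qpow_mul_intCast ħ x n

lemma cre_dilate (a : ℂ) (V : Vertex) (n : ℤ) :
    cre (V.dilate ħ a) n = qpow ħ a ^ n • cre V n := by
  rcases lt_or_ge n 0 with h | h
  · simp [cre_of_neg _ h]
  lift n to ℕ using h
  have : crePart (V.dilate ħ a) = fun m : ℕ+ => qpow ħ a ^ (m : ℕ) • crePart V m := by
    funext m
    rw [crePart, crePart, Finset.smul_sum]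
    refine Finset.sum_congr rfl fun i _ => ?_
    rw [smul_smul, ← qpow_mul_natCast]
    simp [Vertex.dilate]
  rw [cre_natCast, cre_natCast, this, coeff_expSeries_rescale, zpow_natCast]

lemma ann_dilate (a : ℂ) (V : Vertex) (n : ℕ) :
    ann ħ k (V.dilate ħ a) n = (qpow ħ a)⁻¹ ^ n • ann ħ k V n := by
  have : annOp ħ k (V.dilate ħ a) = fun m : ℕ+ => (qpow ħ a)⁻¹ ^ (m : ℕ) • annOp ħ k V m := by
    funext m
    rw [annOp, annOp, Finset.smul_sum]
    refine Finset.sum_congr rfl fun i _ => ?_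
    rw [smul_smul, ← qpow_neg, ← qpow_mul_natCast]
    simp [Vertex.dilate]
  rw [ann, ann, this, coeff_expSeries_rescale]

lemma normProd_dilate (V W : Vertex) (a : ℂ) (J : ℕ) (P R : ℤ) (p : Osc) :
    normProd ħ k V (W.dilate ħ a) J P R p = qpow ħ a ^ R • normProd ħ k V W J P R p := by
  rw [normProd, normProd, Finset.smul_sum]
  refine Finset.sum_congr rfl fun x _ => ?_
  rw [cre_dilate, ann_dilate, LinearMap.smul_apply, map_smul, mul_smul_comm, mul_smul_comm,
    smul_mul_assoc, smul_smul, mul_comm, zpow_add₀ (qpow_ne_zero ħ a), zpow_natCast, mul_assoc,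
    ← mul_pow, mul_inv_cancel₀ (qpow_ne_zero ħ a), one_pow, mul_one]

lemma ann_add (V W : Vertex) (n : ℕ) :
    ann ħ k (V + W) n = ∑ x ∈ Finset.HasAntidiagonal.antidiagonal n,
      ann ħ k V x.1 * ann ħ k W x.2 := by
  rw [ann, annOp_add, expSeries_add (commute_annOp ħ k V V) (commute_annOp ħ k W W)
    (commute_annOp ħ k V W), PowerSeries.coeff_mul]
  rfl

lemma cre_add (V W : Vertex) {n lo hi : ℤ} (hlo : lo ≤ 0) (hhi : n ≤ hi) :
    cre (V + W) n = ∑ l ∈ Finset.Icc lo hi, cre V (n - l) * cre W l := by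
  rcases lt_or_ge n 0 with h | h
  · rw [cre_of_neg _ h, Finset.sum_eq_zero]
    intro l _
    rcases lt_or_ge l 0 with hl | hl
    · rw [cre_of_neg W hl, mul_zero]
    · rw [cre_of_neg V (by omega), zero_mul]
  lift n to ℕ using h
  rw [cre_natCast, crePart_add, expSeries_add (fun _ _ => Commute.all _ _)
    (fun _ _ => Commute.all _ _) (fun _ _ => Commute.all _ _), PowerSeries.coeff_mul,
    ← Finset.Nat.sum_antidiagonal_swap, Finset.Nat.sum_antidiagonal_eq_sum_range_succ_mk]
  have h2 : (Finset.range n.succ).map ⟨fun i : ℕ => (i : ℤ), Nat.cast_injective⟩ ⊆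
      Finset.Icc lo hi := by
    intro l hl
    simp only [Finset.mem_map, Finset.mem_range, Function.Embedding.coeFn_mk] at hl
    obtain ⟨i, hi, rfl⟩ := hl
    rw [Finset.mem_Icc]
    omega
  rw [← Finset.sum_subset h2, Finset.sum_map]
  · refine Finset.sum_congr rfl fun i hi => ?_
    rw [Finset.mem_range] at hi
    simp only [Function.Embedding.coeFn_mk, Prod.swap]
    rw [← Nat.cast_sub (by omega), cre_natCast, cre_natCast]
  · intro l _ hl
    rcases lt_or_ge l 0 with h0 | h0
    · rw [cre_of_neg W h0, mul_zero]
    · lift l to ℕ using h0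
      simp at hl
      rw [cre_of_neg V (by omega), zero_mul]

/-- The restriction of `:V(z) W(w):` to `w = z`. -/
lemma oscLeft_add {w J : ℕ} {p : Osc} (hp : p ∈ weightLE w) (hJ : w < J) (V W : Vertex) (N : ℤ) :
    oscLeft ħ k (V + W) N p = ∑ᶠ R : ℤ, normProd ħ k V W J (N - R) R p := by
  have h2 : (Function.support fun R : ℤ => normProd ħ k V W J (N - R) R p) ⊆
      Finset.Icc (-J - |N|) (|N| + J) := by
    intro i hi
    by_contra hc
    simp only [Finset.coe_Icc, Set.mem_Icc] at hc
    have := le_abs_self N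
    have := abs_nonneg N
    exact hi (normProd_eq_zero ħ k V W p (by omega))
  rw [finsum_eq_sum_of_support_subset _ h2, oscLeft_eq ħ k hp (B := J + J) (by omega)]
  simp_rw [ann_add, LinearMap.sum_apply, Finset.mul_sum]
  have h3 := sum_antidiagonal_eq_sum_box (I := J) (J := J) (B := J + J)
    (f := fun x => cre (V + W) (N + (x.1 + x.2 : ℕ)) * (ann ħ k V x.1 * ann ħ k W x.2) p) le_rfl
    (fun x hx => by
      rw [Module.End.mul_apply, ann_ann_eq_zero ħ k hp V W (by omega), mul_zero])
  refine Eq.trans (Finset.sum_congr rfl fun b _ => Finset.sum_congr rfl fun x hx => ?_)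
    (h3.trans ?_)
  · rw [Finset.HasAntidiagonal.mem_antidiagonal.mp hx]
  simp only [normProd]
  rw [Finset.sum_comm]
  refine Finset.sum_congr rfl fun x hx => ?_
  simp only [Finset.mem_product, Finset.mem_range] at hx
  have := le_abs_self N
  have := abs_nonneg N
  rw [cre_add V W (lo := -J - |N| + x.2) (hi := |N| + J + x.2) (by omega) (by omega),
    Module.End.mul_apply, Finset.sum_mul]
  rw [← Finset.image_add_right_Icc, Finset.sum_image (by simp)]
  refine Finset.sum_congr rfl fun R _ => ?_
  congr 3
  push_cast
  ring

/-- If the contraction factors of `V(z) S(w)` and `S(w) V(z)` have expansions, in opposite domains,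
whose difference is a multiple of `δ(w / (q ^ a z))`, then the commutator of the two fields is
supported at `w = q ^ a z`, where it is a multiple of the normally ordered product. -/
theorem oscLeft_commutator (V S : Vertex) (n : ℤ) (γ η κ a : ℂ)
    (h : ∀ j : ℤ, γ * coeffZ (expSeries (contr ħ k V S)) (j + n) -
      η * coeffZ (expSeries (contr ħ k S V)) (-j) = κ * qpow ħ a ^ (-j)) (P R : ℤ) (p : Osc) :
    γ • oscLeft ħ k V (P - n) (oscLeft ħ k S R p) - η • oscLeft ħ k S (R - n) (oscLeft ħ k V P p) =
      (κ * qpow ħ a ^ (n - R)) • oscLeft ħ k (V + S.dilate ħ a) (P + R - n) p := by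
  obtain ⟨w, hp⟩ := exists_mem_weightLE p
  rw [oscLeft_oscLeft ħ k hp w.lt_succ_self, oscLeft_oscLeft ħ k hp w.lt_succ_self,
    oscLeft_add ħ k hp w.lt_succ_self]
  -- All three sums are reindexed to run over `:V S:` at the exponents `P + j`, `R - n - j`.
  have h1 := finsum_comp_equiv (Equiv.addRight n) (f := fun i : ℤ =>
    coeffZ (expSeries (contr ħ k V S)) i • normProd ħ k V S w.succ (P - n + i) (R - i) p)
  have h2 := finsum_comp_equiv (Equiv.neg ℤ) (f := fun i : ℤ =>
    coeffZ (expSeries (contr ħ k S V)) i • normProd ħ k S V w.succ (R - n + i) (P - i) p)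
  have h3 := finsum_comp_equiv (Equiv.subLeft (R - n)) (f := fun l : ℤ =>
    normProd ħ k V (S.dilate ħ a) w.succ (P + R - n - l) l p)
  have e1 : ∀ j, P - n + (j + n) = P + j := fun j => by ring
  have e2 : ∀ j, R - (j + n) = R - n - j := fun j => by ring
  have e3 : ∀ j, P + R - n - (R - n - j) = P + j := fun j => by ring
  have e4 : ∀ j, R - n + -j = R - n - j := fun j => by ring
  simp only [Equiv.coe_addRight, Equiv.neg_apply, Equiv.subLeft_apply, normProd_dilate, e1, e2, e3,
    e4, normProd_comm ħ k S V, sub_neg_eq_add] at h1 h2 h3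
  simp_rw [normProd_dilate, normProd_comm ħ k S V]
  rw [← h1, ← h2, ← h3, smul_finsum, smul_finsum, smul_finsum, ← finsum_sub_distrib]
  · refine finsum_congr fun j => ?_
    rw [smul_smul, smul_smul, smul_smul, ← sub_smul, h, mul_assoc,
      ← zpow_add₀ (qpow_ne_zero ħ a)]
    congr 3
    ring
  · simp_rw [smul_smul]
    exact hasFiniteSupport_smul_normProd ħ k V S _ P (R - n) p _
  · simp_rw [smul_smul]
    exact hasFiniteSupport_smul_normProd ħ k V S _ P (R - n) p _

end

/-! ### Momenta and the exchange relation of two vertex operators -/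

section

variable (ħ k : ℂ)

lemma intPart_intCast (f : ℤ → Module.End ℂ Osc) (n : ℤ) : intPart f n = f n := by
  simp [intPart]

lemma intPart_eq_zero (f : ℤ → Module.End ℂ Osc) {r : ℂ} (h : ∀ n : ℤ, r ≠ n) :
    intPart f r = 0 := by
  rw [intPart, if_neg fun h' => h _ h'.symm]

lemma intPart_neg (f : ℤ → Module.End ℂ Osc) (r : ℂ) :
    intPart f (-r) = intPart (fun n => f (-n)) r := by
  by_cases h : ∃ n : ℤ, r = n
  · obtain ⟨n, rfl⟩ := h
    rw [← Int.cast_neg, intPart_intCast, intPart_intCast]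
  · push Not at h
    rw [intPart_eq_zero _ h, intPart_eq_zero]
    intro n hn
    exact h (-n) (by rw [Int.cast_neg, ← hn, neg_neg])

@[simp] lemma zeroEig_add (μ ν : Mom) (i : Fin 3) :
    zeroEig (μ + ν) i = zeroEig μ i + zeroEig ν i := by
  fin_cases i <;> simp [zeroEig]; ring

@[simp] lemma zeroEig_neg (μ : Mom) (i : Fin 3) : zeroEig (-μ) i = -zeroEig μ i := by
  fin_cases i <;> simp [zeroEig]

/-- The exponent of `z` that the zero modes in `V(z)` contribute at momentum `μ`. -/
def Vertex.zExp (V : Vertex) (μ : Mom) : ℂ := ∑ i, V.zpw i * zeroEig μ i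

/-- The exponent of `q` that the zero modes in `V(z)` contribute at momentum `μ`. -/
def Vertex.qExp (V : Vertex) (μ : Mom) : ℂ := ∑ i, V.qpw i * zeroEig μ i

/-- The vertex operator whose action from the left is the action of `V` from the right, up to a
scalar, a power of `z` and the substitution `z ↦ z⁻¹`: creation and annihilation modes are
exchanged, and momenta are shifted in the opposite direction. -/
def Vertex.rev (V : Vertex) : Vertex where
  osc i m := V.osc i (-m)
  chg := -V.chg
  zpw := -V.zpw
  qpw := V.qpw

namespace Vertex

variable (V W S : Vertex) (μ ν : Mom)

lemma zExp_add : V.zExp (μ + ν) = V.zExp μ + V.zExp ν := by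
  simp [zExp, mul_add, Finset.sum_add_distrib]

lemma qExp_add : V.qExp (μ + ν) = V.qExp μ + V.qExp ν := by
  simp [qExp, mul_add, Finset.sum_add_distrib]

lemma zExp_neg : V.zExp (-μ) = -V.zExp μ := by simp [zExp]

lemma qExp_neg : V.qExp (-μ) = -V.qExp μ := by simp [qExp]

lemma add_zExp : (V + W).zExp μ = V.zExp μ + W.zExp μ := by
  show ∑ i, (V.zpw i + W.zpw i) * _ = _
  simp [zExp, add_mul, Finset.sum_add_distrib]

lemma add_qExp : (V + W).qExp μ = V.qExp μ + W.qExp μ := by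
  show ∑ i, (V.qpw i + W.qpw i) * _ = _
  simp [qExp, add_mul, Finset.sum_add_distrib]

lemma add_chg : (V + W).chg = V.chg + W.chg := rfl

lemma dilate_zExp (a : ℂ) : (V.dilate ħ a).zExp μ = V.zExp μ := rfl

lemma dilate_qExp (a : ℂ) : (V.dilate ħ a).qExp μ = V.qExp μ + a * V.zExp μ := by
  show ∑ i, (V.qpw i + a • V.zpw i) * _ = _
  simp [qExp, zExp, add_mul, Finset.sum_add_distrib, Finset.mul_sum, mul_assoc]

lemma dilate_chg (a : ℂ) : (V.dilate ħ a).chg = V.chg := rfl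

lemma rev_zExp : V.rev.zExp μ = -V.zExp μ := by simp [rev, zExp]

lemma rev_qExp : V.rev.qExp μ = V.qExp μ := rfl

lemma rev_chg : V.rev.chg = -V.chg := rfl

lemma rev_add_dilate (a : ℂ) : (V + S.dilate ħ a).rev = V.rev + S.rev.dilate ħ (-a) := by
  show Vertex.mk _ _ _ _ = Vertex.mk _ _ _ _
  congr 1
  · funext i m
    simp [dilate, rev, add_osc]
  · funext i
    simp [dilate, rev, add_chg, add_comm]
  · funext i
    show -(V.zpw i + S.zpw i) = -V.zpw i + -S.zpw i
    ring
  · funext i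
    show V.qpw i + (S.qpw i + a * S.zpw i) = V.qpw i + (S.qpw i + -a * -S.zpw i)
    ring

lemma left_single (r : ℂ) (x : Osc) :
    V.left ħ k r (Finsupp.single μ x) = qpow ħ (V.qExp μ) •
      Finsupp.single (μ + V.chg) (intPart (oscLeft ħ k V) (r - V.zExp μ) x) := by
  simp [left, qExp, zExp]

lemma left_single_intCast {r : ℂ} {N : ℤ} (h : r - V.zExp μ = N) (x : Osc) :
    V.left ħ k r (Finsupp.single μ x) = qpow ħ (V.qExp μ) •
      Finsupp.single (μ + V.chg) (oscLeft ħ k V N x) := by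
  rw [left_single, h, intPart_intCast]

lemma left_single_eq_zero {r : ℂ} (h : ∀ N : ℤ, r - V.zExp μ ≠ N) (x : Osc) :
    V.left ħ k r (Finsupp.single μ x) = 0 := by
  rw [left_single, intPart_eq_zero _ h]
  simp

lemma oscRight_eq (N : ℤ) : oscRight ħ k V N = oscLeft ħ k V.rev (-N) := by
  unfold oscRight oscLeft
  congr 1
  funext s
  refine Finset.sum_congr rfl fun b _ => ?_
  rw [neg_add_eq_sub]
  simp only [rev, neg_neg]

lemma right_eq (r : ℂ) :
    V.right ħ k r = qpow ħ (-V.qExp V.chg) • V.rev.left ħ k (-r - V.zExp V.chg) := by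
  refine Finsupp.lhom_ext fun μ x => ?_
  rw [LinearMap.smul_apply, left_single, rev_zExp, rev_qExp, smul_smul, ← qpow_add]
  have h : -r - V.zExp V.chg - -V.zExp μ = -(r - V.zExp (μ - V.chg)) := by
    rw [sub_eq_add_neg μ, zExp_add, zExp_neg]
    ring
  rw [h, intPart_neg, rev_chg, ← sub_eq_add_neg, neg_add_eq_sub, sub_eq_add_neg (V.qExp μ),
    ← qExp_neg, ← qExp_add, ← sub_eq_add_neg]
  simp_rw [← oscRight_eq]
  simp [right, qExp, zExp]

end Vertex

/-- Data for the exchange relation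
`V(z) S(w) - η S(w) V(z) = κ w ^ n δ(w / (q ^ a z)) :V(z) S(q ^ a z):`
of two vertex operators. The zero modes contribute `z ^ n` to `V(z) S(w)` and `w ^ n` to
`S(w) V(z)`; `coeff_eq` compares the coefficients of `(w / z) ^ (j + n)` and `(z / w) ^ (-j)` of the
two contraction factors. -/
structure OPE (V S : Vertex) (n : ℤ) (η κ a : ℂ) : Prop where
  qpw_eq : S.qpw = 0
  exp_left : V.zExp S.chg = n
  exp_right : S.zExp V.chg = n
  coeff_eq : ∀ j : ℤ, qpow ħ (V.qExp S.chg) * coeffZ (expSeries (contr ħ k V S)) (j + n) -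
      η * coeffZ (expSeries (contr ħ k S V)) (-j) = κ * qpow ħ a ^ (-j)

namespace OPE

variable {ħ k}
variable {V S : Vertex} {n : ℤ} {η κ a : ℂ}

lemma qExp_eq_zero (h : OPE ħ k V S n η κ a) (μ : Mom) : S.qExp μ = 0 := by
  simp [Vertex.qExp, h.qpw_eq]

/-- The exchange relation in terms of modes; `S` has integral exponents at `μ`. -/
theorem left (h : OPE ħ k V S n η κ a) (p : ℂ) (r : ℤ) {μ : Mom}
    (hμ : ∃ N : ℤ, S.zExp μ = N) (x : Osc) :
    V.left ħ k p (S.left ħ k r (Finsupp.single μ x)) -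
      η • S.left ħ k r (V.left ħ k p (Finsupp.single μ x)) =
    (κ * qpow ħ (a * (n - r))) • (V + S.dilate ħ a).left ħ k (p + r - n) (Finsupp.single μ x) := by
  obtain ⟨N, hN⟩ := hμ
  rw [S.left_single_intCast ħ k μ (N := r - N) (by rw [hN]; push_cast; ring)]
  by_cases hp : ∃ P : ℤ, p - V.zExp μ = P
  · obtain ⟨P, hP⟩ := hp
    rw [V.left_single_intCast ħ k μ hP, map_smul, map_smul,
      V.left_single_intCast ħ k (N := P - n) (μ := μ + S.chg)
        (by rw [Vertex.zExp_add, h.exp_left]; push_cast; rw [← hP]; ring),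
      S.left_single_intCast ħ k (N := r - N - n) (μ := μ + V.chg)
        (by rw [Vertex.zExp_add, h.exp_right, hN]; push_cast; ring),
      Vertex.left_single_intCast (N := P + (r - N) - n) (h := by
        rw [Vertex.add_zExp, Vertex.dilate_zExp, hN]; push_cast; rw [← hP]; ring)]
    have key := oscLeft_commutator ħ k V S n _ η κ a h.coeff_eq P (r - N) x
    rw [h.qExp_eq_zero, h.qExp_eq_zero, Vertex.qExp_add, Vertex.add_qExp, Vertex.dilate_qExp,
      h.qExp_eq_zero, qpow_zero, one_smul, one_smul]
    simp only [Finsupp.smul_single, Vertex.add_chg, Vertex.dilate_chg, add_assoc,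
      add_comm S.chg V.chg]
    rw [← Finsupp.single_sub]
    congr 1
    rw [smul_comm η, qpow_add ħ, mul_smul, ← smul_sub, key, smul_smul, smul_smul, hN]
    congr 1
    rw [← qpow_mul_intCast, qpow_add, zero_add]
    have : qpow ħ (a * (n - (r - N : ℤ) : ℤ)) = qpow ħ (a * (n - r)) * qpow ħ (a * N) := by
      rw [← qpow_add]
      congr 1
      push_cast
      ring
    rw [this]
    ring
  · push Not at hp
    have h1 : ∀ P : ℤ, p - V.zExp (μ + S.chg) ≠ P := fun P hP => hp (P + n) (by
      rw [Vertex.zExp_add, h.exp_left] at hP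
      push_cast
      rw [← hP]
      ring)
    have h2 : ∀ P : ℤ, p + r - n - (V + S.dilate ħ a).zExp μ ≠ P :=
      fun P hP => hp (P + n - r + N) (by
        rw [Vertex.add_zExp, Vertex.dilate_zExp, hN] at hP
        push_cast
        rw [← hP]
        ring)
    rw [V.left_single_eq_zero ħ k μ hp, map_smul, V.left_single_eq_zero ħ k _ h1,
      Vertex.left_single_eq_zero _ _ _ _ h2]
    simp

lemma contr_rev (V W : Vertex) : contr ħ k V.rev W.rev = contr ħ k W V := by
  funext m
  refine Finset.sum_congr rfl fun i _ => ?_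
  simp only [Vertex.rev, neg_neg]
  ring

/-- Reversal exchanges the two orders of the product, which turns `η` into `η⁻¹ = η`. -/
lemma rev (h : OPE ħ k V S n η κ a) (hη : η * η = 1) :
    OPE ħ k V.rev S.rev n η (-η * κ * qpow ħ (a * n - V.qExp S.chg)) (-a) where
  qpw_eq := h.qpw_eq
  exp_left := by rw [Vertex.rev_zExp, Vertex.rev_chg, Vertex.zExp_neg, neg_neg, h.exp_left]
  exp_right := by rw [Vertex.rev_zExp, Vertex.rev_chg, Vertex.zExp_neg, neg_neg, h.exp_right]
  coeff_eq j := by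
    have h1 := h.coeff_eq (-j - n)
    rw [contr_rev, contr_rev, Vertex.rev_qExp, Vertex.rev_chg, Vertex.qExp_neg, qpow_neg,
      sub_eq_add_neg (a * n), qpow_add, qpow_neg, qpow_neg, qpow_mul_intCast]
    have e1 : -j - n + n = -j := by ring
    have e2 : -(-j - n) = j + n := by ring
    rw [e1, e2] at h1
    have hγ := qpow_ne_zero ħ (V.qExp S.chg)
    rw [inv_zpow, zpow_neg, inv_inv]
    rw [zpow_add₀ (qpow_ne_zero ħ a)] at h1
    field_simp
    linear_combination (-η) * h1 - coeffZ (expSeries (contr ħ k S V)) (j + n) * hη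

/-- The exchange relation for the modes acting from the right; it follows from the one for the
reversed vertex operators. -/
theorem right (h : OPE ħ k V S n η κ a) (hη : η * η = 1) (hS : ∃ N : ℤ, S.zExp S.chg = N)
    (p : ℂ) (r : ℤ) {μ : Mom} (hμ : ∃ N : ℤ, S.zExp μ = N) (x : Osc) :
    V.right ħ k p (S.right ħ k r (Finsupp.single μ x)) -
      η • S.right ħ k r (V.right ħ k p (Finsupp.single μ x)) =
    (-η * κ * qpow ħ (a * (n - r))) •
      (V + S.dilate ħ a).right ħ k (p + r - n) (Finsupp.single μ x) := by
  obtain ⟨M, hM⟩ := hS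
  obtain ⟨N, hN⟩ := hμ
  have h1 := (h.rev hη).left (-p - V.zExp V.chg) (-r - M) (μ := μ)
    ⟨-N, by rw [Vertex.rev_zExp, hN, Int.cast_neg]⟩ x
  simp only [Vertex.right_eq, LinearMap.smul_apply, map_smul, h.qExp_eq_zero, hM, neg_zero,
    qpow_zero, one_smul]
  have e : -(r : ℂ) - M = ((-r - M : ℤ) : ℂ) := by push_cast; ring
  rw [e, smul_comm η, ← smul_sub, h1, Vertex.rev_add_dilate, smul_smul, smul_smul]
  have e2 : -(p + r - n) - (V + S.dilate ħ a).zExp (V + S.dilate ħ a).chg =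
      -p - V.zExp V.chg + ((-r - M : ℤ) : ℂ) - n := by
    rw [Vertex.add_zExp, Vertex.dilate_zExp, Vertex.add_chg, Vertex.dilate_chg, Vertex.zExp_add,
      Vertex.zExp_add, h.exp_left, h.exp_right, hM]
    push_cast
    ring
  rw [e2]
  congr 1
  rw [Vertex.add_qExp, Vertex.dilate_qExp, Vertex.add_chg, Vertex.dilate_chg, Vertex.qExp_add,
    h.qExp_eq_zero, Vertex.zExp_add, h.exp_right, hM]
  have e3 : ∀ b c d : ℂ, qpow ħ b * (-η * κ * qpow ħ c * qpow ħ d) =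
      -η * κ * qpow ħ (b + c + d) := fun b c d => by rw [qpow_add, qpow_add]; ring
  have e4 : ∀ b c : ℂ, -η * κ * qpow ħ b * qpow ħ c = -η * κ * qpow ħ (b + c) :=
    fun b c => by rw [qpow_add]; ring
  rw [e3, e4]
  congr 2
  push_cast
  ring

end OPE

end

/-! ### Contractions with the screening current -/

section

variable {ħ k : ℂ}

/-- The vertex operators `e_ε` (`t = 1`) and `f_ε` (`t = -1`). -/
def ef (ħ k : ℂ) (t ε : ℤˣ) : Vertex := if t = 1 then e ħ k ε else f ħ k ε

lemma add_qpw (V W : Vertex) : (V + W).qpw = V.qpw + W.qpw := rfl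

lemma neg_qpw (V : Vertex) : (-V).qpw = -V.qpw := rfl

lemma neg_osc (V : Vertex) : (-V).osc = -V.osc := rfl

lemma qdiff_ne_zero (hgen : Generic ħ k) : qdiff ħ ≠ 0 := fun h => by
  simpa [qnum, h] using hgen.two 1 one_pos

/-- The `q`-powers and `q`-numbers in the contractions, as rational functions of `a = q ^ (k m / 2)`
and `b = q ^ m`; the left-hand sides are in the form that `simp` produces. -/
structure ExpTable (ħ k : ℂ) (m : ℕ) (a b : ℂ) : Prop where
  ha : a ≠ 0
  hb : b ≠ 0
  q1 : qpow ħ (-k / 2 * m) = a⁻¹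
  q2 : qpow ħ (-((-2 + -k) / 2 * m)) = a * b
  q3 : qpow ħ ((k + 2) / 2 * m) = a * b
  q4 : qpow ħ (-(-k / 2 * m)) = a
  q5 : qpow ħ (k / 2 * m) = a
  q6 : qpow ħ (-((k + 2) / 2 * m)) = (a * b)⁻¹
  q7 : qpow ħ ((-2 + -k) / 2 * m) = (a * b)⁻¹
  q8 : qpow ħ (-(k / 2 * m)) = a⁻¹
  q9 : qpow ħ m = b
  q10 : qpow ħ (-m) = b⁻¹
  p1 : qpow ħ 1 ^ m = b
  p2 : qpow ħ (-1) ^ m = b⁻¹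
  p3 : qpow ħ (k + 1) ^ m = a ^ 2 * b
  p4 : qpow ħ (-(k + 1)) ^ m = (a ^ 2 * b)⁻¹
  p5 : qpow ħ (-1 + -k) ^ m = (a ^ 2 * b)⁻¹
  n1 : qnum ħ m = (b - b⁻¹) / qdiff ħ
  n2 : qnum ħ (2 * m) = (b ^ 2 - (b ^ 2)⁻¹) / qdiff ħ
  n3 : qnum ħ (k * m) = (a ^ 2 - (a ^ 2)⁻¹) / qdiff ħ
  n4 : qnum ħ ((k + 2) * m) = (a ^ 2 * b ^ 2 - (a ^ 2 * b ^ 2)⁻¹) / qdiff ħ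

lemma expTable (m : ℕ) : ExpTable ħ k m (qpow ħ (k / 2 * m)) (qpow ħ m) := by
  have key : ∀ (x : ℂ) (i j : ℤ), x = i * (k / 2 * m) + j * m →
      qpow ħ x = qpow ħ (k / 2 * m) ^ i * qpow ħ m ^ j := by
    rintro x i j rfl
    rw [qpow_add, mul_comm (i : ℂ), mul_comm (j : ℂ), qpow_mul_intCast, qpow_mul_intCast]
  constructor
  · exact qpow_ne_zero _ _
  · exact qpow_ne_zero _ _
  · rw [key _ (-1) 0 (by push_cast; ring)]; simp
  · rw [key _ 1 1 (by push_cast; ring)]; simp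
  · rw [key _ 1 1 (by push_cast; ring)]; simp
  · rw [key _ 1 0 (by push_cast; ring)]; simp
  · rfl
  · rw [key _ (-1) (-1) (by push_cast; ring)]; simp [mul_comm]
  · rw [key _ (-1) (-1) (by push_cast; ring)]; simp [mul_comm]
  · rw [key _ (-1) 0 (by push_cast; ring)]; simp
  · rfl
  · rw [qpow_neg]
  · rw [← qpow_mul_natCast, one_mul]
  · rw [← qpow_mul_natCast, neg_one_mul, qpow_neg]
  · rw [← qpow_mul_natCast, key _ 2 1 (by push_cast; ring), zpow_ofNat, zpow_one]
  · rw [← qpow_mul_natCast, key _ (-2) (-1) (by push_cast; ring)]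
    simp [zpow_neg, mul_comm]
  · rw [← qpow_mul_natCast, key _ (-2) (-1) (by push_cast; ring)]
    simp [zpow_neg, mul_comm]
  · rw [qnum, qpow_neg]
  · rw [qnum, qpow_neg, key _ 0 2 (by push_cast; ring)]
    simp
  · rw [qnum, qpow_neg, key _ 2 0 (by push_cast; ring)]
    simp
  · rw [qnum, qpow_neg, key _ 2 2 (by push_cast; ring)]
    rfl

lemma qnum_neg (x : ℂ) : qnum ħ (-x) = -qnum ħ x := by
  rw [qnum, qnum, neg_neg, ← neg_sub, neg_div]

/-- Genericity makes the denominators `[k m]` and `[2 m]` nonzero in the variables `a`, `b`. -/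
lemma exists_expTable (hgen : Generic ħ k) (m : ℕ+) :
    ∃ a b : ℂ, ExpTable ħ k m a b ∧ a ^ 4 - 1 ≠ 0 ∧ b ^ 4 - 1 ≠ 0 := by
  have ht := expTable (ħ := ħ) (k := k) m
  refine ⟨_, _, ht, fun h => hgen.level m m.pos ?_, fun h => hgen.two m m.pos ?_⟩
  · rw [ht.n3, div_eq_zero_iff]
    have ha := ht.ha
    generalize qpow ħ (k / 2 * (m : ℕ)) = a at *
    left
    field_simp
    linear_combination h
  · rw [ht.n2, div_eq_zero_iff]
    have hb := ht.hb
    generalize qpow ħ (m : ℕ) = b at *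
    left
    field_simp
    linear_combination h

set_option linter.unusedSimpArgs false in
lemma contr_ef_SVertex_same (hgen : Generic ħ k) (s ε : ℤˣ) (m : ℕ+) :
    contr ħ k (ef ħ k s ε) (SVertex ħ k s) m =
      qpow ħ (-(sgn s * sgn ε)) ^ (m : ℕ) / (m : ℕ) := by
  have hD := qdiff_ne_zero hgen
  have hm : ((m : ℕ) : ℂ) ≠ 0 := by exact_mod_cast m.ne_zero
  have hneg : ¬ ((m : ℕ) : ℤ) < 0 := by omega
  obtain ⟨a, b, ht, ha, hb⟩ := exists_expTable hgen m
  have ha0 := ht.ha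
  have hb0 := ht.hb
  rcases Int.units_eq_one_or s with rfl | rfl <;>
  rcases Int.units_eq_one_or ε with rfl | rfl <;>
  simp [contr, Fin.sum_univ_three, ef, e, f, Y, Z, W, add_osc, neg_osc, Vertex.dilate, only,
    SVertex, sgn, comm, hneg, qnum_neg,
    ht.q1, ht.q2, ht.q3, ht.q4, ht.q5, ht.q6, ht.q7, ht.q8, ht.q9, ht.q10,
    ht.p1, ht.p2, ht.p3, ht.p4, ht.p5, ht.n1, ht.n2, ht.n3, ht.n4] <;>
  field_simp <;> ring

set_option linter.unusedSimpArgs false in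
lemma contr_SVertex_ef_same (hgen : Generic ħ k) (s ε : ℤˣ) (m : ℕ+) :
    contr ħ k (SVertex ħ k s) (ef ħ k s ε) m =
      qpow ħ (sgn s * sgn ε) ^ (m : ℕ) / (m : ℕ) := by
  have hD := qdiff_ne_zero hgen
  have hm : ((m : ℕ) : ℂ) ≠ 0 := by exact_mod_cast m.ne_zero
  have hneg : ¬ ((m : ℕ) : ℤ) < 0 := by omega
  obtain ⟨a, b, ht, ha, hb⟩ := exists_expTable hgen m
  have ha0 := ht.ha
  have hb0 := ht.hb
  rcases Int.units_eq_one_or s with rfl | rfl <;>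
  rcases Int.units_eq_one_or ε with rfl | rfl <;>
  simp [contr, Fin.sum_univ_three, ef, e, f, Y, Z, W, add_osc, neg_osc, Vertex.dilate, only,
    SVertex, sgn, comm, hneg, qnum_neg,
    ht.q1, ht.q2, ht.q3, ht.q4, ht.q5, ht.q6, ht.q7, ht.q8, ht.q9, ht.q10,
    ht.p1, ht.p2, ht.p3, ht.p4, ht.p5, ht.n1, ht.n2, ht.n3, ht.n4] <;>
  field_simp <;> ring

set_option linter.unusedSimpArgs false in
lemma contr_ef_SVertex_opp (hgen : Generic ħ k) (s ε : ℤˣ) (m : ℕ+) :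
    contr ħ k (ef ħ k (-s) ε) (SVertex ħ k s) m =
      -(qpow ħ (-(sgn s * sgn ε * (k + 1))) ^ (m : ℕ) / (m : ℕ)) := by
  have hD := qdiff_ne_zero hgen
  have hm : ((m : ℕ) : ℂ) ≠ 0 := by exact_mod_cast m.ne_zero
  have hneg : ¬ ((m : ℕ) : ℤ) < 0 := by omega
  obtain ⟨a, b, ht, ha, hb⟩ := exists_expTable hgen m
  have ha0 := ht.ha
  have hb0 := ht.hb
  rcases Int.units_eq_one_or s with rfl | rfl <;>
  rcases Int.units_eq_one_or ε with rfl | rfl <;>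
  simp [contr, Fin.sum_univ_three, ef, e, f, Y, Z, W, add_osc, neg_osc, Vertex.dilate, only,
    SVertex, sgn, comm, hneg, qnum_neg,
    ht.q1, ht.q2, ht.q3, ht.q4, ht.q5, ht.q6, ht.q7, ht.q8, ht.q9, ht.q10,
    ht.p1, ht.p2, ht.p3, ht.p4, ht.p5, ht.n1, ht.n2, ht.n3, ht.n4] <;>
  field_simp <;> ring

set_option linter.unusedSimpArgs false in
lemma contr_SVertex_ef_opp (hgen : Generic ħ k) (s ε : ℤˣ) (m : ℕ+) :
    contr ħ k (SVertex ħ k s) (ef ħ k (-s) ε) m =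
      -(qpow ħ (sgn s * sgn ε * (k + 1)) ^ (m : ℕ) / (m : ℕ)) := by
  have hD := qdiff_ne_zero hgen
  have hm : ((m : ℕ) : ℂ) ≠ 0 := by exact_mod_cast m.ne_zero
  have hneg : ¬ ((m : ℕ) : ℤ) < 0 := by omega
  obtain ⟨a, b, ht, ha, hb⟩ := exists_expTable hgen m
  have ha0 := ht.ha
  have hb0 := ht.hb
  rcases Int.units_eq_one_or s with rfl | rfl <;>
  rcases Int.units_eq_one_or ε with rfl | rfl <;>
  simp [contr, Fin.sum_univ_three, ef, e, f, Y, Z, W, add_osc, neg_osc, Vertex.dilate, only,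
    SVertex, sgn, comm, hneg, qnum_neg,
    ht.q1, ht.q2, ht.q3, ht.q4, ht.q5, ht.q6, ht.q7, ht.q8, ht.q9, ht.q10,
    ht.p1, ht.p2, ht.p3, ht.p4, ht.p5, ht.n1, ht.n2, ht.n3, ht.n4] <;>
  field_simp <;> ring

set_option linter.unusedSimpArgs false in
lemma ef_add_SVertex_osc_pos (hgen : Generic ħ k) (s : ℤˣ) (i : Fin 3) (m : ℕ+) :
    (ef ħ k s 1 + (SVertex ħ k s).dilate ħ (sgn s)).osc i (m : ℕ) =
      (ef ħ k s (-1) + (SVertex ħ k s).dilate ħ (-sgn s)).osc i (m : ℕ) := by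
  have hD := qdiff_ne_zero hgen
  have hm : ((m : ℕ) : ℂ) ≠ 0 := by exact_mod_cast m.ne_zero
  have hneg : ¬ ((m : ℕ) : ℤ) < 0 := by omega
  obtain ⟨a, b, ht, ha, hb⟩ := exists_expTable hgen m
  have ha0 := ht.ha
  have hb0 := ht.hb
  rcases Int.units_eq_one_or s with rfl | rfl <;> fin_cases i <;>
  simp [ef, e, f, Y, Z, W, add_osc, neg_osc, Vertex.dilate, only,
    SVertex, sgn, comm, hneg, qnum_neg,
    ht.q1, ht.q2, ht.q3, ht.q4, ht.q5, ht.q6, ht.q7, ht.q8, ht.q9, ht.q10,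
    ht.p1, ht.p2, ht.p3, ht.p4, ht.p5, ht.n1, ht.n2, ht.n3, ht.n4] <;>
  try (field_simp; ring)

set_option linter.unusedSimpArgs false in
lemma ef_add_SVertex_osc_neg (hgen : Generic ħ k) (s : ℤˣ) (i : Fin 3) (m : ℕ+) :
    (ef ħ k s 1 + (SVertex ħ k s).dilate ħ (sgn s)).osc i (-(m : ℕ)) =
      (ef ħ k s (-1) + (SVertex ħ k s).dilate ħ (-sgn s)).osc i (-(m : ℕ)) := by
  have hD := qdiff_ne_zero hgen
  have hm : ((m : ℕ) : ℂ) ≠ 0 := by exact_mod_cast m.ne_zero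
  have hneg : ¬ ((m : ℕ) : ℤ) < 0 := by omega
  obtain ⟨a, b, ht, ha, hb⟩ := exists_expTable hgen m
  have ha0 := ht.ha
  have hb0 := ht.hb
  rcases Int.units_eq_one_or s with rfl | rfl <;> fin_cases i <;>
  simp [ef, e, f, Y, Z, W, add_osc, neg_osc, Vertex.dilate, only,
    SVertex, sgn, comm, hneg, qnum_neg,
    ht.q1, ht.q2, ht.q3, ht.q4, ht.q5, ht.q6, ht.q7, ht.q8, ht.q9, ht.q10,
    ht.p1, ht.p2, ht.p3, ht.p4, ht.p5, ht.n1, ht.n2, ht.n3, ht.n4] <;>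
  try (field_simp; ring)

/-- The products `:e_ε(z) S^+(q ^ ε z):` and `:f_ε(z) S^-(q ^ (-ε) z):` at the poles of the exchange
relation do not depend on `ε`; this is why the residues cancel in `G` and `T`. -/
lemma ef_add_SVertex (hgen : Generic ħ k) (s : ℤˣ) :
    ef ħ k s 1 + (SVertex ħ k s).dilate ħ (sgn s) =
      ef ħ k s (-1) + (SVertex ħ k s).dilate ħ (-sgn s) := by
  have h1 : (ef ħ k s 1 + (SVertex ħ k s).dilate ħ (sgn s)).osc =
      (ef ħ k s (-1) + (SVertex ħ k s).dilate ħ (-sgn s)).osc := by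
    funext i m
    rcases lt_trichotomy m 0 with h | rfl | h
    · lift -m to ℕ using (by omega) with n hn
      obtain rfl : m = -n := by omega
      exact ef_add_SVertex_osc_neg hgen s i ⟨n, by omega⟩
    · rcases Int.units_eq_one_or s with rfl | rfl <;> fin_cases i <;>
      simp [ef, e, f, Y, Z, W, add_osc, neg_osc, Vertex.dilate, only, SVertex, sgn]
    · lift m to ℕ using h.le
      exact ef_add_SVertex_osc_pos hgen s i ⟨m, by omega⟩
  have h2 : (ef ħ k s 1 + (SVertex ħ k s).dilate ħ (sgn s)).chg =
      (ef ħ k s (-1) + (SVertex ħ k s).dilate ħ (-sgn s)).chg := by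
    rcases Int.units_eq_one_or s with rfl | rfl <;> rfl
  have h3 : (ef ħ k s 1 + (SVertex ħ k s).dilate ħ (sgn s)).zpw =
      (ef ħ k s (-1) + (SVertex ħ k s).dilate ħ (-sgn s)).zpw := by
    rcases Int.units_eq_one_or s with rfl | rfl <;> rfl
  have h4 : (ef ħ k s 1 + (SVertex ħ k s).dilate ħ (sgn s)).qpw =
      (ef ħ k s (-1) + (SVertex ħ k s).dilate ħ (-sgn s)).qpw := by
    funext i
    rcases Int.units_eq_one_or s with rfl | rfl <;> fin_cases i <;>
    simp [ef, e, f, Y, Z, W, add_qpw, neg_qpw, Vertex.dilate, SVertex, sgn] <;> norm_num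
  revert h1 h2 h3 h4
  generalize ef ħ k s 1 + (SVertex ħ k s).dilate ħ (sgn s) = V
  generalize ef ħ k s (-1) + (SVertex ħ k s).dilate ħ (-sgn s) = W
  rintro h1 h2 h3 h4
  cases V
  cases W
  simp_all

end

/-! ### Exchange relations with the screening current -/

section

variable {ħ k : ℂ}

lemma expSeries_geom (c : ℂ) :
    expSeries (fun m : ℕ+ => c ^ (m : ℕ) / (m : ℕ)) = PowerSeries.mk fun n => c ^ n := by
  refine expSeries_eq (fun _ _ => Commute.all _ _) (by simp) ?_
  ext n
  have h : ∀ a, PowerSeries.coeff a (theta (genSeries fun m : ℕ+ => c ^ (m : ℕ) / (m : ℕ))) =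
      if a = 0 then 0 else c ^ a := fun a => by
    rcases Nat.eq_zero_or_pos a with rfl | ha
    · rw [coeff_theta, coeff_zero_genSeries]
      simp
    · have ha' : (a : ℂ) ≠ 0 := by exact_mod_cast ha.ne'
      lift a to ℕ+ using ha
      rw [coeff_theta, coeff_pnat_genSeries, nsmul_eq_mul, if_neg a.ne_zero]
      field_simp
  rw [coeff_theta, PowerSeries.coeff_mk, PowerSeries.coeff_mul,
    Finset.Nat.sum_antidiagonal_eq_sum_range_succ_mk, Finset.sum_range_succ']
  simp only [h, PowerSeries.coeff_mk, Nat.succ_ne_zero, if_false, if_true, zero_mul, add_zero]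
  rw [Finset.sum_congr rfl (g := fun _ => c ^ n), Finset.sum_const, Finset.card_range]
  intro i hi
  rw [← pow_add]
  congr 1
  have := Finset.mem_range.mp hi
  omega

lemma expSeries_neg (u : ℕ+ → ℂ) : expSeries u * expSeries (-u) = 1 := by
  rw [← expSeries_add (fun _ _ => Commute.all _ _) (fun _ _ => Commute.all _ _)
    (fun _ _ => Commute.all _ _), add_neg_cancel]
  refine expSeries_eq (fun _ _ => Commute.all _ _) (by simp) ?_
  have : genSeries (0 : ℕ+ → ℂ) = 0 := by
    ext n
    simp only [genSeries, PowerSeries.coeff_mk, map_zero]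
    split_ifs <;> rfl
  rw [theta_one, this]
  ext n
  simp

lemma expSeries_zero : expSeries (0 : ℕ+ → ℂ) = 1 := by
  have h := expSeries_neg 0
  rw [neg_zero] at h
  have h0 : expSeries (0 : ℕ+ → ℂ) * expSeries 0 = expSeries (0 + 0 : ℕ+ → ℂ) :=
    (expSeries_add (fun _ _ => Commute.all _ _) (fun _ _ => Commute.all _ _)
      (fun _ _ => Commute.all _ _)).symm
  rw [h, add_zero] at h0
  exact h0.symm

lemma expSeries_neg_geom (c : ℂ) :
    expSeries (fun m : ℕ+ => -(c ^ (m : ℕ) / (m : ℕ))) =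
      1 - PowerSeries.C c * PowerSeries.X := by
  have h := expSeries_neg fun m : ℕ+ => c ^ (m : ℕ) / (m : ℕ)
  rw [expSeries_geom] at h
  have h2 : (PowerSeries.mk fun n => c ^ n) * (1 - PowerSeries.C c * PowerSeries.X) = 1 := by
    ext n
    rcases n with _ | n
    · simp
    · rw [mul_sub, mul_one, map_sub, mul_left_comm, PowerSeries.coeff_C_mul,
        PowerSeries.coeff_succ_mul_X]
      simp [pow_succ', PowerSeries.coeff_one]
  calc _ = ((PowerSeries.mk fun n => c ^ n) * (1 - PowerSeries.C c * PowerSeries.X)) *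
        expSeries (-fun m : ℕ+ => c ^ (m : ℕ) / (m : ℕ)) := by rw [h2, one_mul]; rfl
    _ = (1 - PowerSeries.C c * PowerSeries.X) * ((PowerSeries.mk fun n => c ^ n) *
        expSeries (-fun m : ℕ+ => c ^ (m : ℕ) / (m : ℕ))) := by ring
    _ = _ := by rw [h, mul_one]

lemma coeffZ_of_neg (F : PowerSeries ℂ) {n : ℤ} (h : n < 0) : coeffZ F n = 0 :=
  if_neg (by omega)

lemma coeffZ_natCast (F : PowerSeries ℂ) (n : ℕ) : coeffZ F n = PowerSeries.coeff n F := by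
  simp [coeffZ]

lemma coeffZ_one (n : ℤ) : coeffZ 1 n = if n = 0 then 1 else 0 := by
  rcases lt_or_ge n 0 with h | h
  · rw [coeffZ_of_neg _ h, if_neg h.ne]
  · lift n to ℕ using h
    simp [coeffZ_natCast, PowerSeries.coeff_one]

lemma coeffZ_geom (c : ℂ) (n : ℤ) :
    coeffZ (PowerSeries.mk fun n => c ^ n) n = if 0 ≤ n then c ^ n else 0 := by
  rcases lt_or_ge n 0 with h | h
  · rw [coeffZ_of_neg _ h, if_neg (by omega)]
  · lift n to ℕ using h
    simp [coeffZ_natCast]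

lemma coeffZ_mul_linear (F : PowerSeries ℂ) (c : ℂ) (n : ℤ) :
    coeffZ (F * (1 - PowerSeries.C c * PowerSeries.X)) n = coeffZ F n - c * coeffZ F (n - 1) := by
  rcases lt_or_ge n 0 with h | h
  · rw [coeffZ_of_neg _ h, coeffZ_of_neg _ h, coeffZ_of_neg _ (by omega)]
    simp
  · lift n to ℕ using h
    rw [coeffZ_natCast, coeffZ_natCast, mul_sub, mul_one, map_sub, mul_left_comm,
      PowerSeries.coeff_C_mul]
    rcases n with _ | n
    · rw [coeffZ_of_neg _ (by omega)]
      simp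
    · rw [PowerSeries.coeff_succ_mul_X]
      push_cast
      rw [add_sub_cancel_right, coeffZ_natCast]

namespace OPE

variable {V S : Vertex}

/-- A simple pole: the contraction factor is `1 / (1 - x)`, and the expansions in the two domains
differ by a delta function. -/
lemma of_pole (a : ℂ) (hS : S.qpw = 0) (h1 : V.zExp S.chg = -1) (h2 : S.zExp V.chg = -1)
    (hq : V.qExp S.chg = -a)
    (hl : ∀ m, contr ħ k V S m = qpow ħ (-a) ^ (m : ℕ) / (m : ℕ))
    (hr : ∀ m, contr ħ k S V m = qpow ħ a ^ (m : ℕ) / (m : ℕ)) :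
    OPE ħ k V S (-1) (-1) 1 a where
  qpw_eq := hS
  exp_left := by simp [h1]
  exp_right := by simp [h2]
  coeff_eq j := by
    rw [funext hl, funext hr, expSeries_geom, expSeries_geom, coeffZ_geom, coeffZ_geom, hq,
      qpow_neg]
    have := qpow_ne_zero ħ a
    rcases lt_or_ge 0 j with h | h
    · rw [if_pos (by omega), if_neg (by omega), inv_zpow', zpow_neg, zpow_neg,
        zpow_add₀ this, zpow_neg, zpow_one]
      field_simp
      ring
    · rw [if_neg (by omega), if_pos (by omega)]
      ring

/-- A simple zero: the contraction factor is a polynomial, and the two fields anticommute. -/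
lemma of_zero (c : ℂ) (hS : S.qpw = 0) (h1 : V.zExp S.chg = 1) (h2 : S.zExp V.chg = 1)
    (hq : V.qExp S.chg = c)
    (hl : ∀ m, contr ħ k V S m = -(qpow ħ (-c) ^ (m : ℕ) / (m : ℕ)))
    (hr : ∀ m, contr ħ k S V m = -(qpow ħ c ^ (m : ℕ) / (m : ℕ))) :
    OPE ħ k V S 1 (-1) 0 0 where
  qpw_eq := hS
  exp_left := by simp [h1]
  exp_right := by simp [h2]
  coeff_eq j := by
    rw [funext hl, funext hr, expSeries_neg_geom, expSeries_neg_geom, hq, qpow_neg,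
      ← one_mul (1 - _), ← one_mul (1 - PowerSeries.C (qpow ħ c) * _), coeffZ_mul_linear,
      coeffZ_mul_linear]
    simp only [coeffZ_one]
    have := qpow_ne_zero ħ c
    by_cases h0 : j = 0
    · subst h0
      simp [this]
    · by_cases h1 : j = -1
      · subst h1
        simp
      · rw [if_neg (by omega), if_neg (by omega), if_neg (by omega), if_neg (by omega)]
        simp

/-- The contraction factor has a simple pole and a simple zero; the coefficient of the delta
function is the value of the numerator at the pole, times the power of `q` from the zero modes. -/
lemma of_quot (a c : ℂ) (hS : S.qpw = 0) (h1 : V.zExp S.chg = 0) (h2 : S.zExp V.chg = 0)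
    (hq : V.qExp S.chg = c - a)
    (hl : ∀ m, contr ħ k V S m =
      qpow ħ (-a) ^ (m : ℕ) / (m : ℕ) + -(qpow ħ (-c) ^ (m : ℕ) / (m : ℕ)))
    (hr : ∀ m, contr ħ k S V m =
      qpow ħ a ^ (m : ℕ) / (m : ℕ) + -(qpow ħ c ^ (m : ℕ) / (m : ℕ))) :
    OPE ħ k V S 0 1 (qpow ħ (c - a) - 1) a where
  qpw_eq := hS
  exp_left := by simp [h1]
  exp_right := by simp [h2]
  coeff_eq j := by
    have hexp : ∀ x y : ℂ, expSeries (fun m : ℕ+ => x ^ (m : ℕ) / (m : ℕ) +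
        -(y ^ (m : ℕ) / (m : ℕ))) = (PowerSeries.mk fun n => x ^ n) *
          (1 - PowerSeries.C y * PowerSeries.X) := fun x y => by
      rw [← expSeries_geom, ← expSeries_neg_geom, ← expSeries_add (fun _ _ => Commute.all _ _)
        (fun _ _ => Commute.all _ _) (fun _ _ => Commute.all _ _)]
      rfl
    rw [funext hl, funext hr, hexp, hexp, coeffZ_mul_linear, coeffZ_mul_linear, hq,
      sub_eq_add_neg c, qpow_add, qpow_neg, qpow_neg]
    simp only [coeffZ_geom]
    have ha := qpow_ne_zero ħ a
    have hc := qpow_ne_zero ħ c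
    generalize qpow ħ a = x at *
    generalize qpow ħ c = y at *
    rcases lt_trichotomy 0 j with h | rfl | h
    · rw [if_pos (by omega), if_pos (by omega), if_neg (by omega), if_neg (by omega), add_zero,
        inv_zpow', inv_zpow', zpow_neg, zpow_neg, zpow_sub₀ ha]
      field_simp
      ring
    · simp
    · rw [if_neg (by omega), if_neg (by omega), if_pos (by omega), if_pos (by omega),
        zpow_sub₀ ha]
      field_simp
      ring

/-- Without contractions the two fields commute. -/
lemma of_trivial (hS : S.qpw = 0) (h1 : V.zExp S.chg = 0) (h2 : S.zExp V.chg = 0)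
    (hq : V.qExp S.chg = 0) (hl : ∀ m, contr ħ k V S m = 0) (hr : ∀ m, contr ħ k S V m = 0) :
    OPE ħ k V S 0 1 0 0 where
  qpw_eq := hS
  exp_left := by simp [h1]
  exp_right := by simp [h2]
  coeff_eq j := by
    rw [show contr ħ k V S = 0 from funext hl, show contr ħ k S V = 0 from funext hr,
      expSeries_zero, coeffZ_one, coeffZ_one, hq, qpow_zero]
    simp

end OPE

lemma contr_add_left (V V' W : Vertex) (m : ℕ+) :
    contr ħ k (V + V') W m = contr ħ k V W m + contr ħ k V' W m := by
  simp [contr, add_osc, add_mul, Finset.sum_add_distrib]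

lemma contr_add_right (V W W' : Vertex) (m : ℕ+) :
    contr ħ k V (W + W') m = contr ħ k V W m + contr ħ k V W' m := by
  simp [contr, add_osc, add_mul, mul_add, Finset.sum_add_distrib]

lemma contr_dilate_left (a : ℂ) (V W : Vertex) (m : ℕ+) :
    contr ħ k (V.dilate ħ a) W m = qpow ħ (-a) ^ (m : ℕ) * contr ħ k V W m := by
  rw [contr, contr, Finset.mul_sum, ← qpow_mul_natCast]
  refine Finset.sum_congr rfl fun i _ => ?_
  simp only [Vertex.dilate, Int.cast_natCast]
  ring

lemma contr_dilate_right (a : ℂ) (V W : Vertex) (m : ℕ+) :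
    contr ħ k V (W.dilate ħ a) m = qpow ħ a ^ (m : ℕ) * contr ħ k V W m := by
  rw [contr, contr, Finset.mul_sum, ← qpow_mul_natCast]
  refine Finset.sum_congr rfl fun i _ => ?_
  simp only [Vertex.dilate, Int.cast_natCast, Int.cast_neg, neg_mul_neg]
  ring

lemma contr_Vt_SVertex (t s : ℤˣ) (m : ℕ+) : contr ħ k (Vt ħ k t) (SVertex ħ k s) m = 0 := by
  simp [contr, Vt, SVertex, only]

lemma contr_SVertex_Vt (t s : ℤˣ) (m : ℕ+) : contr ħ k (SVertex ħ k s) (Vt ħ k t) m = 0 := by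
  simp [contr, Vt, SVertex, only]

lemma contr_KVertex_SVertex (t s : ℤˣ) (m : ℕ+) :
    contr ħ k (KVertex ħ t) (SVertex ħ k s) m = 0 := by
  simp [contr, KVertex, SVertex, only]

lemma contr_SVertex_KVertex (t s : ℤˣ) (m : ℕ+) :
    contr ħ k (SVertex ħ k s) (KVertex ħ t) m = 0 := by
  simp [contr, KVertex, SVertex, only]

lemma Generic.k_ne_zero (hgen : Generic ħ k) : k ≠ 0 := by
  rintro rfl
  exact hgen.level 1 one_pos (by simp [qnum])

lemma Generic.k_add_two_ne_zero (hgen : Generic ħ k) : k + 2 ≠ 0 := fun h =>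
  hgen.shifted 1 one_pos (by simp [qnum, h])

lemma sgn_mul_self (s : ℤˣ) : sgn s * sgn s = 1 := by
  rcases Int.units_eq_one_or s with rfl | rfl <;> simp [sgn]

lemma sgn_neg (s : ℤˣ) : sgn (-s) = -sgn s := by simp [sgn]

lemma sgn_one : sgn 1 = 1 := by simp [sgn]

lemma ef_chg (t ε : ℤˣ) : (ef ħ k t ε).chg = ![0, sgn t * 2, 0] := by
  rcases Int.units_eq_one_or t with rfl | rfl
  · show ![(0 : ℂ), sgn 1 * 2, 0] + 0 + 0 = _
    simp
  · show ![(0 : ℂ), sgn (-1) * 2, 0] + 0 + -0 = _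
    simp

lemma ef_zExp (t ε : ℤˣ) (μ : Mom) : (ef ħ k t ε).zExp μ = -(sgn t / k * μ 1) := by
  have : (ef ħ k t ε).zpw = ![0, sgn t / k, 0] := by
    rcases Int.units_eq_one_or t with rfl | rfl
    · show ![(0 : ℂ), sgn 1 / k, 0] + 0 + 0 = _
      simp
    · show ![(0 : ℂ), sgn (-1) / k, 0] + 0 + -0 = _
      simp
  simp [Vertex.zExp, this, Fin.sum_univ_three, zeroEig]

lemma ef_qExp (t ε : ℤˣ) (μ : Mom) :
    (ef ħ k t ε).qExp μ = sgn ε / 2 * (μ 1 - sgn t * μ 2) := by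
  rcases Int.units_eq_one_or t with rfl | rfl
  · simp [ef, e, Vertex.add_qExp, Vertex.dilate_qExp]
    simp [Vertex.qExp, Vertex.zExp, Y, Z, W, Fin.sum_univ_three, zeroEig, sgn]
    ring
  · have hneg : ∀ V : Vertex, (-V).qExp μ = -V.qExp μ := fun V => by
      simp [Vertex.qExp, neg_qpw]
    simp [ef, f, Vertex.add_qExp, Vertex.dilate_qExp, hneg]
    simp [Vertex.qExp, Vertex.zExp, Y, Z, W, Fin.sum_univ_three, zeroEig, sgn]
    ring

lemma SVertex_chg (s : ℤˣ) : (SVertex ħ k s).chg = ![0, sgn s * k, k + 2] := rfl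

lemma SVertex_zExp (s : ℤˣ) (μ : Mom) : (SVertex ħ k s).zExp μ = (-sgn s * μ 1 + μ 2) / 2 := by
  simp [Vertex.zExp, SVertex, Fin.sum_univ_three, zeroEig]
  ring

lemma Vt_chg (s : ℤˣ) : (Vt ħ k s).chg = ![sgn s * (k + 2), 0, 0] := rfl

lemma Vt_zExp (s : ℤˣ) (μ : Mom) : (Vt ħ k s).zExp μ = sgn s / k * μ 0 := by
  simp [Vertex.zExp, Vt, Fin.sum_univ_three, zeroEig]

lemma Vt_qExp (s : ℤˣ) (μ : Mom) : (Vt ħ k s).qExp μ = 0 := by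
  simp [Vertex.qExp, Vt]

lemma GVertex_eq (t ε : ℤˣ) : GVertex ħ k t ε = (Vt ħ k t).dilate ħ (-sgn t * (k + 2)) +
    (ef ħ k t ε).dilate ħ (-sgn t * (3 * k + 4) / 2) := by
  rcases Int.units_eq_one_or t with rfl | rfl
  · simp [GVertex, ef, sgn]
  · simp [GVertex, ef, sgn]

lemma TVertex_eq (ε ε' : ℤˣ) : TVertex ħ k ε ε' = (Vt ħ k 1).dilate ħ (-1) +
    (Vt ħ k (-1)).dilate ħ 1 + (ef ħ k 1 ε).dilate ħ (-(k + 2) / 2) +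
      (ef ħ k (-1) ε').dilate ħ ((k + 2) / 2) := rfl

end

/-! ### Commutation of the currents with the screening charge -/

section

variable {ħ k : ℂ}

instance : AddCommSemigroup Vertex where
  add_assoc U V W := by
    show Vertex.mk _ _ _ _ = Vertex.mk _ _ _ _
    congr 1 <;> exact add_assoc _ _ _
  add_comm U V := by
    show Vertex.mk _ _ _ _ = Vertex.mk _ _ _ _
    congr 1 <;> exact add_comm _ _

lemma Vertex.dilate_add (a : ℂ) (V W : Vertex) :
    (V + W).dilate ħ a = V.dilate ħ a + W.dilate ħ a := by
  show Vertex.mk _ _ _ _ = Vertex.mk _ _ _ _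
  congr 1
  · funext i m
    exact mul_add _ _ _
  · funext i
    show V.qpw i + W.qpw i + a * (V.zpw i + W.zpw i) =
      V.qpw i + a * V.zpw i + (W.qpw i + a * W.zpw i)
    ring

lemma Vertex.dilate_dilate (a b : ℂ) (V : Vertex) :
    (V.dilate ħ a).dilate ħ b = V.dilate ħ (a + b) := by
  show Vertex.mk _ _ _ _ = Vertex.mk _ _ _ _
  congr 1
  · funext i m
    show _ * (_ * _) = _
    rw [← mul_assoc, ← qpow_add]
    congr 2
    ring
  · funext i
    show V.qpw i + a * V.zpw i + b * V.zpw i = V.qpw i + (a + b) * V.zpw i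
    ring

lemma ef_dilate_add_SVertex (hgen : Generic ħ k) (s : ℤˣ) (b : ℂ) :
    (ef ħ k s 1).dilate ħ b + (SVertex ħ k s).dilate ħ (sgn s + b) =
      (ef ħ k s (-1)).dilate ħ b + (SVertex ħ k s).dilate ħ (-sgn s + b) := by
  rw [← Vertex.dilate_dilate, ← Vertex.dilate_dilate, ← Vertex.dilate_add, ← Vertex.dilate_add,
    ef_add_SVertex hgen]

lemma qpow_neg_add (x y : ℂ) : qpow ħ (-(x + y)) = qpow ħ (-x) * qpow ħ (-y) := by
  rw [neg_add, qpow_add]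

lemma ope_G_same (hgen : Generic ħ k) (s ε : ℤˣ) :
    OPE ħ k (GVertex ħ k s ε) (SVertex ħ k s) (-1) (-1) 1
      (sgn s * sgn ε + -sgn s * (3 * k + 4) / 2) := by
  have hk := hgen.k_ne_zero
  have hs := sgn_mul_self s
  rw [GVertex_eq]
  refine OPE.of_pole _ rfl ?_ ?_ ?_ (fun m => ?_) fun m => ?_
  · simp [Vertex.add_zExp, Vertex.dilate_zExp, Vt_zExp, ef_zExp, SVertex_chg]
    field_simp
    linear_combination hs
  · simp [Vertex.add_chg, Vertex.dilate_chg, SVertex_zExp, Vt_chg, ef_chg]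
    linear_combination -hs
  · simp [Vertex.add_qExp, Vertex.dilate_qExp, Vt_qExp, Vt_zExp, ef_qExp, ef_zExp, SVertex_chg]
    field_simp
    linear_combination (3 * k + 4) * sgn s * hs
  · rw [contr_add_left, contr_dilate_left, contr_dilate_left, contr_Vt_SVertex,
      contr_ef_SVertex_same hgen, neg_add, add_comm (-(sgn s * sgn ε)), qpow_add, mul_pow]
    ring
  · rw [contr_add_right, contr_dilate_right, contr_dilate_right, contr_SVertex_Vt,
      contr_SVertex_ef_same hgen, qpow_add, mul_pow]
    ring

lemma ope_G_opp (hgen : Generic ħ k) (s ε : ℤˣ) :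
    OPE ħ k (GVertex ħ k (-s) ε) (SVertex ħ k s) 1 (-1) 0 0 := by
  have hk := hgen.k_ne_zero
  have hs := sgn_mul_self s
  rw [GVertex_eq]
  refine OPE.of_zero (sgn s * sgn ε * (k + 1) + -sgn (-s) * (3 * k + 4) / 2)
    rfl ?_ ?_ ?_ (fun m => ?_) fun m => ?_
  · simp [Vertex.add_zExp, Vertex.dilate_zExp, Vt_zExp, ef_zExp, SVertex_chg, sgn_neg]
    field_simp
    linear_combination hs
  · simp [Vertex.add_chg, Vertex.dilate_chg, SVertex_zExp, Vt_chg, ef_chg,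
      sgn_neg]
    linear_combination hs
  · simp [Vertex.add_qExp, Vertex.dilate_qExp, Vt_qExp, Vt_zExp, ef_qExp, ef_zExp, SVertex_chg,
      sgn_neg]
    field_simp
    linear_combination (3 * k + 4) * sgn s * hs
  · rw [contr_add_left, contr_dilate_left, contr_dilate_left, contr_Vt_SVertex,
      contr_ef_SVertex_opp hgen, neg_add, add_comm (-(sgn s * sgn ε * (k + 1))), qpow_add, mul_pow]
    ring
  · rw [contr_add_right, contr_dilate_right, contr_dilate_right, contr_SVertex_Vt,
      contr_SVertex_ef_opp hgen, qpow_add, mul_pow]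
    ring

lemma ope_T_pos (hgen : Generic ħ k) (ε ε' : ℤˣ) :
    OPE ħ k (TVertex ħ k ε ε') (SVertex ħ k 1) 0 1
      (qpow ħ (sgn ε' * (k + 1) + (k + 2) / 2 - (sgn ε + -(k + 2) / 2)) - 1)
      (sgn ε + -(k + 2) / 2) := by
  have hk := hgen.k_ne_zero
  rw [TVertex_eq]
  refine OPE.of_quot _ _ rfl ?_ ?_ ?_ (fun m => ?_) fun m => ?_
  · simp [Vertex.add_zExp, Vertex.dilate_zExp, Vt_zExp, ef_zExp, SVertex_chg, sgn_neg]
    field_simp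
    ring
  · simp [Vertex.add_chg, Vertex.dilate_chg, SVertex_zExp, Vt_chg, ef_chg,
      sgn_neg]
  · simp [Vertex.add_qExp, Vertex.dilate_qExp, Vt_qExp, Vt_zExp, ef_qExp, ef_zExp, SVertex_chg,
      sgn_neg, sgn_one]
    field_simp
    ring
  · simp only [contr_add_left, contr_dilate_left, contr_Vt_SVertex]
    rw [contr_ef_SVertex_same hgen, contr_ef_SVertex_opp hgen, qpow_neg_add,
      qpow_neg_add, mul_pow, mul_pow, sgn_one, one_mul, one_mul]
    ring
  · simp only [contr_add_right, contr_dilate_right, contr_SVertex_Vt]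
    rw [contr_SVertex_ef_same hgen, contr_SVertex_ef_opp hgen, qpow_add, qpow_add, mul_pow,
      mul_pow, sgn_one, one_mul, one_mul]
    ring

lemma ope_T_neg (hgen : Generic ħ k) (ε ε' : ℤˣ) :
    OPE ħ k (TVertex ħ k ε ε') (SVertex ħ k (-1)) 0 1
      (qpow ħ (-sgn ε * (k + 1) + -(k + 2) / 2 - (-sgn ε' + (k + 2) / 2)) - 1)
      (-sgn ε' + (k + 2) / 2) := by
  have hk := hgen.k_ne_zero
  rw [TVertex_eq]
  refine OPE.of_quot _ _ rfl ?_ ?_ ?_ (fun m => ?_) fun m => ?_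
  · simp [Vertex.add_zExp, Vertex.dilate_zExp, Vt_zExp, ef_zExp, SVertex_chg, sgn_neg]
    field_simp
    ring
  · simp [Vertex.add_chg, Vertex.dilate_chg, SVertex_zExp, Vt_chg, ef_chg,
      sgn_neg]
  · simp [Vertex.add_qExp, Vertex.dilate_qExp, Vt_qExp, Vt_zExp, ef_qExp, ef_zExp, SVertex_chg,
      sgn_neg, sgn_one]
    field_simp
    ring
  · have h := contr_ef_SVertex_opp hgen (-1) ε m
    rw [neg_neg] at h
    simp only [contr_add_left, contr_dilate_left, contr_Vt_SVertex]
    rw [contr_ef_SVertex_same hgen, h, qpow_neg_add,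
      qpow_neg_add, mul_pow, mul_pow, sgn_neg, sgn_one, neg_one_mul, neg_one_mul]
    ring
  · have h := contr_SVertex_ef_opp hgen (-1) ε m
    rw [neg_neg] at h
    simp only [contr_add_right, contr_dilate_right, contr_SVertex_Vt]
    rw [contr_SVertex_ef_same hgen, h, qpow_add, qpow_add, mul_pow,
      mul_pow, sgn_neg, sgn_one, neg_one_mul, neg_one_mul]
    ring

lemma KVertex_chg (t : ℤˣ) : (KVertex ħ t).chg = 0 := rfl

lemma KVertex_zExp (t : ℤˣ) (μ : Mom) : (KVertex ħ t).zExp μ = 0 := by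
  simp [Vertex.zExp, KVertex]

lemma KVertex_qExp (t : ℤˣ) (μ : Mom) : (KVertex ħ t).qExp μ = μ 0 := by
  simp [Vertex.qExp, KVertex, Fin.sum_univ_three, zeroEig]

lemma ope_Kpm (t s : ℤˣ) : OPE ħ k (KVertex ħ t) (SVertex ħ k s) 0 1 0 0 :=
  OPE.of_trivial rfl (KVertex_zExp _ _) (by simp [KVertex_chg, SVertex_zExp])
    (by simp [KVertex_qExp, SVertex_chg]) (contr_KVertex_SVertex t s) (contr_SVertex_KVertex t s)

lemma ope_K (s : ℤˣ) : OPE ħ k (KVertex ħ (-1) + KVertex ħ 1) (SVertex ħ k s) 0 1 0 0 :=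
  OPE.of_trivial rfl (by simp [Vertex.add_zExp, KVertex_zExp])
    (by simp [Vertex.add_chg, KVertex_chg, SVertex_zExp])
    (by simp [Vertex.add_qExp, KVertex_qExp, SVertex_chg])
    (fun m => by simp [contr_add_left, contr_KVertex_SVertex])
    (fun m => by simp [contr_add_right, contr_SVertex_KVertex])

/-- The mode `A_m` of a current, where `L V r` is the coefficient of `z ^ r` of `V(z)`. For
`L = Vertex.left` and `L = Vertex.right` it is definitionally `Current.left` and `Current.right`. -/
def curAct (L : Vertex → ℂ → Module.End ℂ Fock) (A : Current) (m : ℂ) : Module.End ℂ Fock :=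
  (A.map fun t => t.1 • L t.2.2 (-m - t.2.1)).sum

/-- `Q` exchanges with vertex operators, on the vector `v`, like the coefficient of `w ^ (-1)` of
`S(w)`: the residue of the exchange relation. The factor `θ` is `1` for the action from the left
and `-η` for the action from the right. -/
structure Screens (ħ k : ℂ) (S : Vertex) (L : Vertex → ℂ → Module.End ℂ Fock)
    (Q : Module.End ℂ Fock) (θ : ℂ → ℂ) (v : Fock) : Prop where
  rel : ∀ {V : Vertex} {n : ℤ} {η κ a : ℂ}, OPE ħ k V S n η κ a → η * η = 1 → ∀ p : ℂ,
    L V p (Q v) = η • Q (L V p v) +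
      (θ η * κ * qpow ħ (a * (n + 1))) • L (V + S.dilate ħ a) (p - 1 - n) v

namespace Screens

variable {s : ℤˣ} {L : Vertex → ℂ → Module.End ℂ Fock} {Q : Module.End ℂ Fock} {θ : ℂ → ℂ}
  {v : Fock}

lemma commute_Kpm (h : Screens ħ k (SVertex ħ k s) L Q θ v) (t : ℤˣ) (m : ℂ) :
    curAct L (Kpm ħ t) m (Q v) = Q (curAct L (Kpm ħ t) m v) := by
  simp [curAct, Kpm, h.rel (ope_Kpm t s) (one_mul 1)]

lemma commute_K (h : Screens ħ k (SVertex ħ k s) L Q θ v) (m : ℂ) :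
    curAct L (K ħ) m (Q v) = Q (curAct L (K ħ) m v) := by
  simp [curAct, K, h.rel (ope_K s) (one_mul 1)]

lemma anticommute_G (hgen : Generic ħ k) (h : Screens ħ k (SVertex ħ k s) L Q θ v) (t : ℤˣ)
    (m : ℂ) : curAct L (G ħ k t) m (Q v) = -Q (curAct L (G ħ k t) m v) := by
  have hη : (-1 : ℂ) * -1 = 1 := by norm_num
  rcases Int.units_eq_one_or (t * s) with hts | hts
  · obtain rfl : t = s := by rw [← mul_one t, ← Int.units_mul_self s, ← mul_assoc, hts, one_mul]
    have h1 := h.rel (ope_G_same hgen t 1) hη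
    have h2 := h.rel (ope_G_same hgen t (-1)) hη
    have hV : GVertex ħ k t 1 +
        (SVertex ħ k t).dilate ħ (sgn t * sgn 1 + -sgn t * (3 * k + 4) / 2) =
        GVertex ħ k t (-1) +
        (SVertex ħ k t).dilate ħ (sgn t * sgn (-1) + -sgn t * (3 * k + 4) / 2) := by
      rw [GVertex_eq, GVertex_eq, sgn_neg, sgn_one, mul_one, mul_neg_one, add_assoc, add_assoc,
        ef_dilate_add_SVertex hgen]
    rw [hV] at h1
    simp [curAct, G, h1, h2]
    module
  · obtain rfl : t = -s := by
      rw [← mul_one t, ← Int.units_mul_self s, ← mul_assoc, hts, neg_one_mul]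
    simp [curAct, G, h.rel (ope_G_opp hgen s _) hη]
    abel

lemma commute_T (hgen : Generic ħ k) (h : Screens ħ k (SVertex ħ k s) L Q θ v) (m : ℂ) :
    curAct L (T ħ k) m (Q v) = Q (curAct L (T ħ k) m v) := by
  have hD := qdiff_ne_zero hgen
  have hk1 : qpow ħ (k + 1) - qpow ħ (-(k + 1)) ≠ 0 := fun h0 =>
    hgen.kone (by rw [qnum, h0, zero_div])
  have e1 : qnum ħ (k + 2) / qnum ħ (k + 1) = (qpow ħ (k + 2) - qpow ħ (-(k + 2))) /
      (qpow ħ (k + 1) - qpow ħ (-(k + 1))) := by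
    rw [qnum, qnum, div_div_div_cancel_right₀ hD]
  rcases Int.units_eq_one_or s with rfl | rfl
  · have h1 := h.rel (ope_T_pos hgen 1 (-1)) (one_mul 1)
    have h2 := h.rel (ope_T_pos hgen 1 1) (one_mul 1)
    have h3 := h.rel (ope_T_pos hgen (-1) 1) (one_mul 1)
    have hV : TVertex ħ k 1 1 + (SVertex ħ k 1).dilate ħ (sgn 1 + -(k + 2) / 2) =
        TVertex ħ k (-1) 1 + (SVertex ħ k 1).dilate ħ (sgn (-1) + -(k + 2) / 2) := by
      have h0 := ef_dilate_add_SVertex hgen 1 (-(k + 2) / 2)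
      rw [TVertex_eq, TVertex_eq, add_right_comm, add_assoc _ (Vertex.dilate _ _ (ef _ _ _ _)), h0,
        ← add_assoc, add_right_comm, sgn_neg]
    -- In this term the zero of the contraction factor cancels the pole.
    have hκ : qpow ħ (sgn (-1) * (k + 1) + (k + 2) / 2 - (sgn 1 + -(k + 2) / 2)) - 1 = 0 := by
      have h0 : (sgn (-1) * (k + 1) + (k + 2) / 2 - (sgn 1 + -(k + 2) / 2)) = 0 := by
        rw [sgn_neg, sgn_one]
        ring
      rw [h0, qpow_zero, sub_self]
    -- The residues of the other two terms are opposite.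
    have hcoef : qpow ħ 1 * ((qpow ħ (sgn 1 * (k + 1) + (k + 2) / 2 -
        (sgn (-1) + -(k + 2) / 2)) - 1) * qpow ħ ((sgn (-1) + -(k + 2) / 2) * ((0 : ℤ) + 1))) =
        qnum ħ (k + 2) / qnum ħ (k + 1) * ((qpow ħ (sgn 1 * (k + 1) + (k + 2) / 2 -
        (sgn 1 + -(k + 2) / 2)) - 1) * qpow ħ ((sgn 1 + -(k + 2) / 2) * ((0 : ℤ) + 1))) := by
      rw [e1, div_mul_eq_mul_div, eq_div_iff hk1]
      simp only [sub_mul, mul_sub, one_mul, ← qpow_add, sgn_neg, sgn_one]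
      push_cast
      ring_nf
    rw [hV] at h2
    rw [hκ] at h1
    generalize hX : L (TVertex ħ k (-1) 1 +
      (SVertex ħ k 1).dilate ħ (sgn (-1) + -(k + 2) / 2)) (-m - 0 - 1 - (0 : ℤ)) v = X
    simp only [curAct, T, List.map_cons, List.map_nil, List.sum_cons, List.sum_nil, add_zero,
      LinearMap.add_apply, LinearMap.smul_apply, map_add, map_smul, h1, h2, h3, hX]
    linear_combination (norm := module) (θ 1 * hcoef) • X
  · have h1 := h.rel (ope_T_neg hgen 1 (-1)) (one_mul 1)
    have h2 := h.rel (ope_T_neg hgen 1 1) (one_mul 1)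
    have h3 := h.rel (ope_T_neg hgen (-1) 1) (one_mul 1)
    have hV : TVertex ħ k 1 1 + (SVertex ħ k (-1)).dilate ħ (-sgn 1 + (k + 2) / 2) =
        TVertex ħ k 1 (-1) + (SVertex ħ k (-1)).dilate ħ (-sgn (-1) + (k + 2) / 2) := by
      have := ef_dilate_add_SVertex hgen (-1) ((k + 2) / 2)
      rw [TVertex_eq, TVertex_eq, add_assoc, add_assoc, ← sgn_neg, this]
      simp only [add_assoc]
    -- In this term the zero of the contraction factor cancels the pole.
    have hκ : qpow ħ (-sgn (-1) * (k + 1) + -(k + 2) / 2 - (-sgn 1 + (k + 2) / 2)) - 1 = 0 := by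
      have h0 : (-sgn (-1) * (k + 1) + -(k + 2) / 2 - (-sgn 1 + (k + 2) / 2)) = 0 := by
        rw [sgn_neg, sgn_one]
        ring
      rw [h0, qpow_zero, sub_self]
    -- The residues of the other two terms are opposite.
    have hcoef : qpow ħ (-1) * ((qpow ħ (-sgn 1 * (k + 1) + -(k + 2) / 2 -
        (-sgn (-1) + (k + 2) / 2)) - 1) * qpow ħ ((-sgn (-1) + (k + 2) / 2) * ((0 : ℤ) + 1))) =
        qnum ħ (k + 2) / qnum ħ (k + 1) * ((qpow ħ (-sgn 1 * (k + 1) + -(k + 2) / 2 -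
        (-sgn 1 + (k + 2) / 2)) - 1) * qpow ħ ((-sgn 1 + (k + 2) / 2) * ((0 : ℤ) + 1))) := by
      rw [e1, div_mul_eq_mul_div, eq_div_iff hk1]
      simp only [sub_mul, mul_sub, one_mul, ← qpow_add, sgn_neg, sgn_one]
      push_cast
      ring_nf
    rw [hV] at h2
    rw [hκ] at h3
    generalize hX : L (TVertex ħ k 1 (-1) +
      (SVertex ħ k (-1)).dilate ħ (-sgn (-1) + (k + 2) / 2)) (-m - 0 - 1 - (0 : ℤ)) v = X
    simp only [curAct, T, List.map_cons, List.map_nil, List.sum_cons, List.sum_nil, add_zero,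
      LinearMap.add_apply, LinearMap.smul_apply, map_add, map_smul, h1, h2, h3, hX]
    linear_combination (norm := module) (θ 1 * hcoef) • X

end Screens

end

/-! ### The screening charges on the Fock spaces -/

section

variable {ħ k : ℂ}

/-- The momentum of the `n`-th summand of `fockA k A ρ σ`. As a submodule of `Mom →₀ Osc`,
`dualFockA k A ρ σ` is the same, so that facts about `fockA` serve both actions. -/
def momA (k : ℂ) (A : Sector) (ρ σ : ℂ) (n : ℤ) : Mom :=
  ![A.eps k + ρ + (k + 2) * n, ρ + 2 * n, σ]

lemma single_mem_fockA (A : Sector) (ρ σ : ℂ) (n : ℤ) (x : Osc) :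
    Finsupp.single (momA k A ρ σ n) x ∈ fockA k A ρ σ :=
  Submodule.mem_iSup_of_mem n ⟨x, rfl⟩

lemma map_mem_of_mem_fockA {M : Type*} [AddCommGroup M] [Module ℂ M] {A : Sector} {ρ σ : ℂ}
    {f : Fock →ₗ[ℂ] M} {W : Submodule ℂ M}
    (h : ∀ n x, f (Finsupp.single (momA k A ρ σ n) x) ∈ W) {v : Fock} (hv : v ∈ fockA k A ρ σ) :
    f v ∈ W := by
  have : fockA k A ρ σ ≤ W.comap f := iSup_le fun n => by
    rintro _ ⟨x, rfl⟩
    exact h n x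
  exact this hv

lemma eq_of_mem_fockA {M : Type*} [AddCommGroup M] [Module ℂ M] {A : Sector} {ρ σ : ℂ}
    {f g : Fock →ₗ[ℂ] M}
    (h : ∀ n x, f (Finsupp.single (momA k A ρ σ n) x) = g (Finsupp.single (momA k A ρ σ n) x))
    {v : Fock} (hv : v ∈ fockA k A ρ σ) : f v = g v := by
  have := map_mem_of_mem_fockA (f := f - g) (W := ⊥) (fun n x => by simp [h]) hv
  simpa [sub_eq_zero] using this

lemma sgn_mul_intCast (s : ℤˣ) (n : ℤ) : (sgn s * n : ℂ) = (((s : ℤ) * n : ℤ) : ℂ) := by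
  simp [sgn]

lemma SVertex_zExp_momA (s : ℤˣ) (A : Sector) (ρ σ : ℂ) (n : ℤ) :
    (SVertex ħ k s).zExp (momA k A ρ σ n) = (-sgn s * ρ + σ) / 2 - ((s : ℤ) * n : ℤ) := by
  rw [SVertex_zExp, ← sgn_mul_intCast]
  simp [momA]
  ring

lemma SVertex_zExp_momA_int {s : ℤˣ} (A : Sector) {ρ σ : ℂ} (n : ℤ)
    (h : ∃ N : ℤ, (-sgn s * ρ + σ) / 2 = N) :
    ∃ N : ℤ, (SVertex ħ k s).zExp (momA k A ρ σ n) = N := by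
  obtain ⟨N, hN⟩ := h
  exact ⟨N - s * n, by rw [SVertex_zExp_momA, hN]; push_cast; ring⟩

lemma SVertex_zExp_chg (s : ℤˣ) : (SVertex ħ k s).zExp (SVertex ħ k s).chg = 1 := by
  rw [SVertex_zExp, SVertex_chg]
  simp
  linear_combination (-k / 2) * sgn_mul_self s

lemma SVertex_qExp (s : ℤˣ) (μ : Mom) : (SVertex ħ k s).qExp μ = 0 := by
  simp [Vertex.qExp, SVertex]

lemma S_left (s : ℤˣ) (m : ℂ) : (S ħ k s).left ħ k m = (SVertex ħ k s).left ħ k (-m) := by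
  simp [S, Current.left]

lemma S_right (s : ℤˣ) (m : ℂ) : (S ħ k s).right ħ k m = (SVertex ħ k s).right ħ k (-m) := by
  simp [S, Current.right]

lemma QLeft_eq (s : ℤˣ) : QLeft ħ k s = (SVertex ħ k s).left ħ k ((-1 : ℤ) : ℂ) := by
  rw [QLeft, S_left]
  simp

lemma QRight_eq (s : ℤˣ) : QRight ħ k s = (SVertex ħ k s).right ħ k ((-1 : ℤ) : ℂ) := by
  rw [QRight, S_right]
  simp

lemma screens_left {s : ℤˣ} {μ : Mom} (hμ : ∃ N : ℤ, (SVertex ħ k s).zExp μ = N) (x : Osc) :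
    Screens ħ k (SVertex ħ k s) (Vertex.left ħ k) (QLeft ħ k s) (fun _ => 1)
      (Finsupp.single μ x) where
  rel {V n η κ a} h _ p := by
    have h1 := h.left p (-1) hμ x
    rw [sub_eq_iff_eq_add'] at h1
    rw [QLeft_eq, h1, one_mul]
    push_cast
    rw [sub_neg_eq_add, ← sub_eq_add_neg]

lemma screens_right {s : ℤˣ} {μ : Mom} (hμ : ∃ N : ℤ, (SVertex ħ k s).zExp μ = N) (x : Osc) :
    Screens ħ k (SVertex ħ k s) (Vertex.right ħ k) (QRight ħ k s) (fun η => -η)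
      (Finsupp.single μ x) where
  rel {V n η κ a} h hη p := by
    have h1 := h.right hη ⟨1, by rw [SVertex_zExp_chg, Int.cast_one]⟩ p (-1) hμ x
    rw [sub_eq_iff_eq_add'] at h1
    rw [QRight_eq, h1]
    push_cast
    rw [sub_neg_eq_add, ← sub_eq_add_neg]

lemma comm_mul_dCoeff (hgen : Generic ħ k) (j : Fin 3 × ℕ+) :
    dCoeff ħ k j * comm ħ k j.1 j.2 = (j.2 : ℕ) := by
  obtain ⟨i, m⟩ := j
  have h1 := hgen.two m m.pos
  have h2 := hgen.level m m.pos
  have h3 := hgen.shifted m m.pos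
  have h4 : ((m : ℕ) : ℂ) ≠ 0 := by simp
  generalize e1 : qnum ħ (2 * (m : ℕ)) = a at h1
  generalize e2 : qnum ħ (k * (m : ℕ)) = b at h2
  generalize e3 : qnum ħ ((k + 2) * (m : ℕ)) = c at h3
  fin_cases i <;> simp [dCoeff, comm, e1, e2, e3] <;> field_simp

/-- The oscillator part of `d` measures the weight, since `dCoeff` and `comm` multiply to `m`. -/
lemma dOsc_eq_degDer (hgen : Generic ħ k) : dOsc ħ k = degDer.toLinearMap := by
  refine (MvPolynomial.basisMonomials _ ℂ).ext fun s => ?_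
  rw [dOsc, Module.Basis.constr_basis, MvPolynomial.coe_basisMonomials, Derivation.coeFn_coe,
    degDer_monomial, weight, Finsupp.sum, Nat.cast_sum, Finset.sum_smul]
  refine Finset.sum_congr rfl fun j _ => ?_
  rw [raise, lower, LinearMap.smul_apply, map_smul, smul_smul, comm_mul_dCoeff hgen,
    LinearMap.mulLeft_apply, Derivation.coeFn_coe, MvPolynomial.X_mul_pderiv_monomial,
    ← Nat.cast_smul_eq_nsmul ℂ, smul_smul]
  congr 1
  push_cast
  ring

/-- `d_0` as a function of the momentum; the sign in `zeroEig` is immaterial, because `ᾱ_0` enters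
through its square. -/
def d0Mom (k : ℂ) (μ : Mom) : ℂ := d0 k (μ 0) (μ 1) (μ 2)

lemma dOp_single (hgen : Generic ħ k) (μ : Mom) (x : Osc) :
    dOp ħ k (Finsupp.single μ x) = Finsupp.single μ (d0Mom k μ • x + degDer x) := by
  rw [dOp, dOsc_eq_degDer hgen]
  simp [d0Mom, d0, zeroEig]

lemma dOp_left_single (hgen : Generic ħ k) (V : Vertex) (r : ℂ) (μ : Mom) (x : Osc) :
    dOp ħ k (V.left ħ k r (Finsupp.single μ x)) =
      V.left ħ k r (dOp ħ k (Finsupp.single μ x)) +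
      (d0Mom k (μ + V.chg) - d0Mom k μ + (r - V.zExp μ)) •
        V.left ħ k r (Finsupp.single μ x) := by
  rw [dOp_single hgen]
  by_cases h : ∃ N : ℤ, r - V.zExp μ = N
  · obtain ⟨N, hN⟩ := h
    rw [V.left_single_intCast ħ k μ hN, V.left_single_intCast ħ k μ hN, map_smul, dOp_single hgen,
      degDer_oscLeft, map_add, map_smul, hN, smul_comm _ (qpow _ _), ← smul_add]
    congr 1
    rw [Finsupp.smul_single, ← Finsupp.single_add]
    congr 1
    module
  · push Not at h
    simp [V.left_single_eq_zero ħ k μ h]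

/-- `S(w)` has conformal weight one: this is why its residue commutes with `d`. -/
lemma d0Mom_add_SVertex_chg (hgen : Generic ħ k) (s : ℤˣ) (μ : Mom) :
    d0Mom k (μ + (SVertex ħ k s).chg) - d0Mom k μ = (SVertex ħ k s).zExp μ + 1 := by
  have hk := hgen.k_ne_zero
  have hk2 := hgen.k_add_two_ne_zero
  have hs := sgn_mul_self s
  rw [SVertex_zExp, SVertex_chg]
  simp [d0Mom, d0]
  field_simp
  linear_combination (-2*(k+2)*k^2) * hs

lemma dOp_QLeft (hgen : Generic ħ k) (s : ℤˣ) (μ : Mom) (x : Osc) :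
    dOp ħ k (QLeft ħ k s (Finsupp.single μ x)) = QLeft ħ k s (dOp ħ k (Finsupp.single μ x)) := by
  rw [QLeft_eq, dOp_left_single hgen, d0Mom_add_SVertex_chg hgen]
  push_cast
  have h : (SVertex ħ k s).zExp μ + 1 + (-1 - (SVertex ħ k s).zExp μ) = 0 := by ring
  rw [h, zero_smul, add_zero]

lemma dOp_QRight (hgen : Generic ħ k) (s : ℤˣ) (μ : Mom) (x : Osc) :
    dOp ħ k (QRight ħ k s (Finsupp.single μ x)) = QRight ħ k s (dOp ħ k (Finsupp.single μ x)) := by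
  have h := d0Mom_add_SVertex_chg hgen s (μ + -(SVertex ħ k s).chg)
  rw [neg_add_cancel_right, Vertex.zExp_add, Vertex.zExp_neg, SVertex_zExp_chg] at h
  have h0 : d0Mom k (μ + (SVertex ħ k s).rev.chg) - d0Mom k μ +
      (-((-1 : ℤ) : ℂ) - (SVertex ħ k s).zExp (SVertex ħ k s).chg - (SVertex ħ k s).rev.zExp μ) =
      0 := by
    rw [Vertex.rev_chg, Vertex.rev_zExp, SVertex_zExp_chg]
    push_cast
    linear_combination -h
  rw [QRight_eq, Vertex.right_eq, LinearMap.smul_apply, map_smul, dOp_left_single hgen, h0]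
  simp

/-- Every vertex operator shifts momenta by `δ` times its charge. -/
def ShiftsBy (L : Vertex → ℂ → Module.End ℂ Fock) (δ : ℤ) : Prop :=
  ∀ V r μ x, ∃ y, L V r (Finsupp.single μ x) = Finsupp.single (μ + δ • V.chg) y

lemma shiftsBy_left : ShiftsBy (Vertex.left ħ k) 1 := fun V r μ x =>
  ⟨qpow ħ (V.qExp μ) • intPart (oscLeft ħ k V) (r - V.zExp μ) x, by
    rw [Vertex.left_single, Finsupp.smul_single, one_smul]⟩

lemma shiftsBy_right : ShiftsBy (Vertex.right ħ k) (-1) := fun V r μ x => by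
  obtain ⟨y, hy⟩ := shiftsBy_left (ħ := ħ) (k := k) V.rev (-r - V.zExp V.chg) μ x
  refine ⟨qpow ħ (-V.qExp V.chg) • y, ?_⟩
  rw [Vertex.right_eq, LinearMap.smul_apply, hy, Finsupp.smul_single, Vertex.rev_chg, one_smul,
    neg_one_smul]

lemma curAct_mem {L : Vertex → ℂ → Module.End ℂ Fock} {A : Current} {W : Submodule ℂ Fock}
    {v : Fock} (h : ∀ t ∈ A, ∀ r, L t.2.2 r v ∈ W) (m : ℂ) : curAct L A m v ∈ W := by
  rw [curAct]
  induction A with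
  | nil => simp
  | cons t A ih =>
    rw [List.map_cons, List.sum_cons, LinearMap.add_apply]
    exact W.add_mem (W.smul_mem _ (h t (by simp) _)) (ih fun t' ht' => h t' (by simp [ht']))

lemma TVertex_chg (ε ε' : ℤˣ) : (TVertex ħ k ε ε').chg = 0 := by
  rw [TVertex_eq]
  simp [Vertex.add_chg, Vertex.dilate_chg, Vt_chg, ef_chg, sgn]

lemma GVertex_chg (t ε : ℤˣ) : (GVertex ħ k t ε).chg = ![sgn t * (k + 2), sgn t * 2, 0] := by
  rw [GVertex_eq]
  simp [Vertex.add_chg, Vertex.dilate_chg, Vt_chg, ef_chg]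

lemma momA_add_GVertex_chg (A : Sector) (ρ σ : ℂ) (n δ : ℤ) (t ε : ℤˣ) :
    momA k A ρ σ n + δ • (GVertex ħ k t ε).chg = momA k A ρ σ (n + δ * t) := by
  rw [GVertex_chg]
  funext i
  fin_cases i <;> simp [momA, sgn] <;> ring

/-- The action of the generators through `L`, which unifies `Gen.left` and `Gen.right`. -/
def genAct (ħ k : ℂ) (L : Vertex → ℂ → Module.End ℂ Fock) (A : Sector) : Gen → Module.End ℂ Fock
  | .K s m => curAct L (Kpm ħ s) m
  | .T m => curAct L (T ħ k) m
  | .G s n => curAct L (G ħ k s) (A.idx n)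

lemma genAct_left (A : Sector) : genAct ħ k (Vertex.left ħ k) A = Gen.left ħ k A := by
  funext g
  cases g <;> rfl

lemma genAct_right (A : Sector) : genAct ħ k (Vertex.right ħ k) A = Gen.right ħ k A := by
  funext g
  cases g <;> rfl

lemma genAct_mem {L : Vertex → ℂ → Module.End ℂ Fock} {δ : ℤ} (hL : ShiftsBy L δ) {A : Sector}
    {ρ σ : ℂ} (g : Gen) {v : Fock} (hv : v ∈ fockA k A ρ σ) :
    genAct ħ k L A g v ∈ fockA k A ρ σ := by
  refine map_mem_of_mem_fockA (fun n x => ?_) hv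
  have h0 : ∀ V r, V.chg = 0 → L V r (Finsupp.single (momA k A ρ σ n) x) ∈ fockA k A ρ σ := by
    intro V r hV
    obtain ⟨y, hy⟩ := hL V r (momA k A ρ σ n) x
    rw [hy, hV, smul_zero, add_zero]
    exact single_mem_fockA _ _ _ _ _
  cases g with
  | K s m =>
    refine curAct_mem (fun t ht r => h0 _ _ ?_) _
    simp only [Kpm, List.mem_singleton] at ht
    rw [ht, KVertex_chg]
  | T m =>
    refine curAct_mem (fun t ht r => h0 _ _ ?_) _
    simp only [T, List.mem_cons, List.not_mem_nil, or_false] at ht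
    rcases ht with rfl | rfl | rfl <;> exact TVertex_chg _ _
  | G s m =>
    refine curAct_mem (fun t ht r => ?_) _
    obtain ⟨ε, hε⟩ : ∃ ε, t.2.2 = GVertex ħ k s ε := by
      simp only [G, List.mem_cons, List.not_mem_nil, or_false] at ht
      rcases ht with rfl | rfl
      exacts [⟨_, rfl⟩, ⟨_, rfl⟩]
    obtain ⟨y, hy⟩ := hL t.2.2 r (momA k A ρ σ n) x
    rw [hy, hε, momA_add_GVertex_chg]
    exact single_mem_fockA _ _ _ _ _

lemma S_mem {L : Vertex → ℂ → Module.End ℂ Fock} {δ : ℤ} (hL : ShiftsBy L δ) (A : Sector)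
    {ρ σ : ℂ} (s : ℤˣ) (r : ℂ) {v : Fock} (hv : v ∈ fockA k A ρ σ) :
    L (SVertex ħ k s) r v ∈ fockA k A (ρ + δ * (sgn s * (k + 2))) (σ + δ * (k + 2)) := by
  refine map_mem_of_mem_fockA (fun n x => ?_) hv
  obtain ⟨y, hy⟩ := hL (SVertex ħ k s) r (momA k A ρ σ n) x
  have h : momA k A ρ σ n + δ • (SVertex ħ k s).chg =
      momA k A (ρ + δ * (sgn s * (k + 2))) (σ + δ * (k + 2)) (n - δ * s) := by
    rw [SVertex_chg]
    funext i
    fin_cases i <;> simp [momA, sgn] <;> ring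
  rw [hy, h]
  exact single_mem_fockA _ _ _ _ _

lemma cre_zero (V : Vertex) : cre V 0 = 1 := by
  rw [← Nat.cast_zero, cre_natCast, coeff_zero_expSeries]

lemma left_single_one_ne_zero (V : Vertex) (μ : Mom) :
    V.left ħ k (V.zExp μ) (Finsupp.single μ 1) ≠ 0 := by
  rw [V.left_single_intCast ħ k μ (N := 0) (by simp), oscLeft_one, cre_zero]
  simp [qpow_ne_zero]

lemma right_single_one_ne_zero (V : Vertex) (μ : Mom) :
    V.right ħ k (V.zExp μ - V.zExp V.chg) (Finsupp.single μ 1) ≠ 0 := by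
  have h := left_single_one_ne_zero (ħ := ħ) (k := k) V.rev μ
  rw [Vertex.rev_zExp] at h
  rw [Vertex.right_eq, LinearMap.smul_apply]
  refine smul_ne_zero (qpow_ne_zero _ _) ?_
  rwa [neg_sub, sub_sub_cancel_left]

/-- The exponents of `S(z)` on a Fock space lie in one class modulo `ℤ`, and the leading coefficient
on a vacuum vector does not vanish. The constant `c` is `0` for the action from the left, and the
exponent of `S` on its own charge for the action from the right. -/
lemma hasFourierExpansion_iff {L : Vertex → ℂ → Module.End ℂ Fock} (s : ℤˣ) (c : ℂ) (A : Sector)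
    (ρ σ : ℂ) {N₀ : ℤ} (hc : c = N₀)
    (h0 : ∀ r μ x, (∀ N : ℤ, r - (SVertex ħ k s).zExp μ ≠ N) →
      L (SVertex ħ k s) r (Finsupp.single μ x) = 0)
    (h1 : ∀ μ, L (SVertex ħ k s) ((SVertex ħ k s).zExp μ - c) (Finsupp.single μ 1) ≠ 0) :
    HasFourierExpansion (fun m => L (SVertex ħ k s) (-m)) (fockA k A ρ σ) ↔
      ∃ N : ℤ, (-sgn s * ρ + σ) / 2 = N := by
  constructor
  · intro h
    by_contra! hN
    refine h1 (momA k A ρ σ 0) ?_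
    have := h _ (single_mem_fockA A ρ σ 0 1) (-((SVertex ħ k s).zExp (momA k A ρ σ 0) - c))
      fun n hn => hN (N₀ - n) ?_
    · simpa only [neg_neg] using this
    · rw [SVertex_zExp_momA, hc] at hn
      push_cast at hn ⊢
      linear_combination -hn
  · intro hN v hv m hm
    refine eq_of_mem_fockA (g := 0) (fun n x => h0 _ _ _ fun N h => ?_) hv
    obtain ⟨M, hM⟩ := SVertex_zExp_momA_int (ħ := ħ) (k := k) A n hN
    rw [hM] at h
    refine hm (-(N + M)) ?_
    push_cast
    linear_combination -h

lemma hasFourierExpansion_left_iff (s : ℤˣ) (A : Sector) (ρ σ : ℂ) :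
    HasFourierExpansion ((S ħ k s).left ħ k) (fockA k A ρ σ) ↔
      ∃ N : ℤ, (-sgn s * ρ + σ) / 2 = N := by
  have h := hasFourierExpansion_iff (ħ := ħ) (k := k) (L := Vertex.left ħ k) s 0 A ρ σ (N₀ := 0)
    (by simp) (fun r μ x h => Vertex.left_single_eq_zero _ _ _ _ h x) fun μ => by
      rw [sub_zero]
      exact left_single_one_ne_zero _ _
  rwa [show (fun m => (SVertex ħ k s).left ħ k (-m)) = (S ħ k s).left ħ k from
    funext fun m => (S_left s m).symm] at h

lemma right_single_eq_zero (V : Vertex) (μ : Mom) {r : ℂ}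
    (h : ∀ N : ℤ, -r - V.zExp V.chg + V.zExp μ ≠ N) (x : Osc) :
    V.right ħ k r (Finsupp.single μ x) = 0 := by
  rw [Vertex.right_eq, LinearMap.smul_apply, Vertex.left_single_eq_zero, smul_zero]
  intro N hN
  exact h N (by rw [← hN, Vertex.rev_zExp, sub_neg_eq_add])

lemma hasFourierExpansion_right_iff (s : ℤˣ) (A : Sector) (ρ σ : ℂ) :
    HasFourierExpansion ((S ħ k s).right ħ k) (dualFockA k A ρ σ) ↔
      ∃ N : ℤ, (-sgn s * ρ + σ) / 2 = N := by
  have h := hasFourierExpansion_iff (ħ := ħ) (k := k) (L := Vertex.right ħ k) s 1 A ρ σ (N₀ := 1)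
    (by simp) (fun r μ x h => right_single_eq_zero _ _ (fun N hN => h (-N - 1) (by
      rw [SVertex_zExp_chg] at hN
      push_cast
      linear_combination -hN)) x) fun μ => by
      rw [← SVertex_zExp_chg (ħ := ħ) (k := k) s]
      exact right_single_one_ne_zero _ _
  rwa [show (fun m => (SVertex ħ k s).right ħ k (-m)) = (S ħ k s).right ħ k from
    funext fun m => (S_right s m).symm] at h

lemma isIntertwiner_of_screens {L : Vertex → ℂ → Module.End ℂ Fock} {δ : ℤ} (hgen : Generic ħ k)
    (hL : ShiftsBy L δ) {A : Sector} {s : ℤˣ} {ρ σ : ℂ} {Q : Module.End ℂ Fock} {θ : ℂ → ℂ} {r : ℂ}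
    (hQ : Q = L (SVertex ħ k s) r)
    (h : ∀ n x, Screens ħ k (SVertex ħ k s) L Q θ (Finsupp.single (momA k A ρ σ n) x)) :
    IsIntertwiner (genAct ħ k L A) Q (fockA k A ρ σ)
      (fockA k A (ρ + δ * (sgn s * (k + 2))) (σ + δ * (k + 2))) where
  stable_source g _ hv := genAct_mem hL g hv
  stable_target g _ hv := genAct_mem hL g hv
  maps v hv := by
    rw [hQ]
    exact S_mem hL A s r hv
  intertwines g v hv := by
    refine eq_of_mem_fockA (f := genAct ħ k L A g ∘ₗ Q) (g := g.parity • Q ∘ₗ genAct ħ k L A g)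
      (fun n x => ?_) hv
    simp only [LinearMap.comp_apply, LinearMap.smul_apply]
    cases g with
    | K t m =>
      rw [Gen.parity, one_smul]
      exact (h n x).commute_Kpm t m
    | T m =>
      rw [Gen.parity, one_smul]
      exact (h n x).commute_T hgen m
    | G t m =>
      rw [Gen.parity, neg_one_smul]
      exact (h n x).anticommute_G hgen t (A.idx m)

end

/-! ### Singular vectors -/

section

variable {ħ k : ℂ}

/-- The contraction of `e_+` or `f_+` with `S` is geometric, so an annihilation operator takes this
polynomial to a nonzero constant. -/
lemma cre_SVertex_ne_zero (hgen : Generic ħ k) (s : ℤˣ) (m : ℕ) : cre (SVertex ħ k s) m ≠ 0 := by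
  intro h
  have h1 := ann_cre ħ k (ef ħ k s 1) (SVertex ħ k s) m m
  rw [h, map_zero, sub_self, cre_zero, funext (contr_ef_SVertex_same hgen s 1), expSeries_geom,
    PowerSeries.coeff_mk, eq_comm] at h1
  simp [qpow_ne_zero] at h1

lemma cre_rev_SVertex_ne_zero (hgen : Generic ħ k) (s : ℤˣ) (m : ℕ) :
    cre (SVertex ħ k s).rev m ≠ 0 := by
  intro h
  have h1 := ann_cre ħ k (ef ħ k s 1).rev (SVertex ħ k s).rev m m
  rw [h, map_zero, sub_self, cre_zero, OPE.contr_rev, funext (contr_SVertex_ef_same hgen s 1),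
    expSeries_geom, PowerSeries.coeff_mk, eq_comm] at h1
  simp [qpow_ne_zero] at h1

lemma QLeft_single_one {s : ℤˣ} {m : ℕ} {μ : Mom} (h : -1 - (SVertex ħ k s).zExp μ = m) :
    QLeft ħ k s (Finsupp.single μ 1) =
      Finsupp.single (μ + (SVertex ħ k s).chg) (cre (SVertex ħ k s) m) := by
  rw [QLeft_eq, Vertex.left_single_intCast (N := m) (h := by rw [Int.cast_natCast, ← h]; simp),
    oscLeft_one, SVertex_qExp, qpow_zero, one_smul]

lemma QRight_single_one {s : ℤˣ} {m : ℕ} {μ : Mom} (h : (SVertex ħ k s).zExp μ = m) :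
    QRight ħ k s (Finsupp.single μ 1) =
      Finsupp.single (μ - (SVertex ħ k s).chg) (cre (SVertex ħ k s).rev m) := by
  rw [QRight_eq, Vertex.right_eq, LinearMap.smul_apply,
    Vertex.left_single_intCast (N := m) (h := by
      rw [Vertex.rev_zExp, SVertex_zExp_chg, h]; push_cast; ring),
    oscLeft_one, Vertex.rev_qExp, SVertex_qExp, SVertex_qExp, neg_zero, qpow_zero, one_smul,
    one_smul, Vertex.rev_chg, sub_eq_add_neg]

lemma left_single_one_eq_zero (V : Vertex) (μ : Mom) {r : ℂ} {n : ℤ} (hn : n < 0)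
    (h : r - V.zExp μ = n) : V.left ħ k r (Finsupp.single μ 1) = 0 := by
  rw [V.left_single_intCast ħ k μ h, oscLeft_one, cre_of_neg _ hn]
  simp

lemma right_single_one_eq_zero (V : Vertex) (μ : Mom) {r : ℂ} {n : ℤ} (hn : n < 0)
    (h : -r - V.zExp V.chg + V.zExp μ = n) : V.right ħ k r (Finsupp.single μ 1) = 0 := by
  rw [Vertex.right_eq, LinearMap.smul_apply, left_single_one_eq_zero _ _ hn, smul_zero]
  rw [Vertex.rev_zExp, ← h, sub_neg_eq_add]

lemma left_zero_single_one {V : Vertex} {μ : Mom} (hV : V.chg = 0) (h : V.zExp μ = 0) :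
    V.left ħ k 0 (Finsupp.single μ 1) = qpow ħ (V.qExp μ) • Finsupp.single μ 1 := by
  rw [V.left_single_intCast ħ k μ (N := 0) (by simp [h]), oscLeft_one, cre_zero, hV, add_zero]

lemma right_zero_single_one {V : Vertex} {μ : Mom} (hV : V.chg = 0) (h : V.zExp μ = 0) :
    V.right ħ k 0 (Finsupp.single μ 1) = qpow ħ (V.qExp μ) • Finsupp.single μ 1 := by
  have h0 : V.zExp 0 = 0 := by simpa only [add_zero, left_eq_add] using V.zExp_add 0 0
  have h1 : V.qExp 0 = 0 := by simpa only [add_zero, left_eq_add] using V.qExp_add 0 0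
  rw [Vertex.right_eq, hV, h0, h1, neg_zero, qpow_zero, one_smul, sub_zero,
    left_zero_single_one (by rw [Vertex.rev_chg, hV, neg_zero])
      (by rw [Vertex.rev_zExp, h, neg_zero]), Vertex.rev_qExp]

lemma TVertex_zExp (ε ε' : ℤˣ) (μ : Mom) : (TVertex ħ k ε ε').zExp μ = 0 := by
  rw [TVertex_eq]
  simp [Vertex.add_zExp, Vertex.dilate_zExp, Vt_zExp, ef_zExp, sgn_neg]
  ring

lemma GVertex_zExp (t ε : ℤˣ) (μ : Mom) :
    (GVertex ħ k t ε).zExp μ = sgn t * ((μ 0 - μ 1) / k) := by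
  rw [GVertex_eq]
  simp [Vertex.add_zExp, Vertex.dilate_zExp, Vt_zExp, ef_zExp]
  ring

lemma GVertex_zExp_chg (hgen : Generic ħ k) (t ε : ℤˣ) :
    (GVertex ħ k t ε).zExp (GVertex ħ k t ε).chg = 1 := by
  have hk := hgen.k_ne_zero
  rw [GVertex_zExp, GVertex_chg]
  simp
  field_simp
  linear_combination k * sgn_mul_self t

lemma curAct_eq_zero {L : Vertex → ℂ → Module.End ℂ Fock} {A : Current} {m : ℂ} {v : Fock}
    (h : ∀ t ∈ A, L t.2.2 (-m - t.2.1) v = 0) : curAct L A m v = 0 := by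
  rw [curAct]
  induction A with
  | nil => simp
  | cons t A ih =>
    rw [List.map_cons, List.sum_cons, LinearMap.add_apply, LinearMap.smul_apply, h t (by simp),
      ih fun t' ht' => h t' (by simp [ht']), smul_zero, add_zero]

/-- Together with the momentum shift of `Q`, this separates the `K_0`-eigenvalue of `Q|…⟩` from
that of the highest weight vector. -/
lemma qpow_sgn_mul_ne_one (hgen : Generic ħ k) (s : ℤˣ) : qpow ħ (sgn s * (k + 2)) ≠ 1 := by
  intro h
  have h1 : qpow ħ (k + 2) = 1 := by
    rcases Int.units_eq_one_or s with rfl | rfl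
    · simpa [sgn] using h
    · rwa [sgn_neg, sgn_one, neg_one_mul, qpow_neg, inv_eq_one] at h
  refine hgen.shifted 1 one_pos ?_
  rw [Nat.cast_one, mul_one, qnum, qpow_neg, h1, inv_one, sub_self, zero_div]

lemma hwK_eq (A : Sector) (ρ : ℂ) : hwK ħ k A (qpow ħ ρ) = qpow ħ (A.eps k + ρ) := by
  cases A
  · simp [hwK, Sector.eps]
  · simp [hwK, Sector.eps, qpow_add]

/-- For `δ = 1` (`δ = -1`), the modes `G^t` with index `A.idx n` that are required to kill singular
vectors of Fock spaces (dual Fock spaces): `δ (n + 1/2) > 0` in the NS sector, and in the R sector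
`δ n > 0`, or `n = 0` and `t = δ`. -/
def Sector.IsAnnihilator (δ t : ℤˣ) (n : ℤ) : Sector → Prop
  | NS => 0 < (δ : ℤ) * (2 * n + 1)
  | R => 0 < (δ : ℤ) * (2 * n + t)

/-- `w` is a joint eigenvector of `K^±_0` and `T_0`, with eigenvalues `κ` and `τ`, that is killed
by the modes which kill singular vectors. -/
structure IsHighest (ħ k : ℂ) (A : Sector) (L : Vertex → ℂ → Module.End ℂ Fock) (δ : ℤˣ)
    (κ τ : ℂ) (w : Fock) : Prop where
  K_zero : ∀ t, curAct L (Kpm ħ t) 0 w = κ • w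
  T_zero : curAct L (T ħ k) 0 w = τ • w
  K_pos : ∀ m : ℤ, 0 < (δ : ℤ) * m → curAct L (Kpm ħ δ) m w = 0
  T_pos : ∀ m : ℤ, 0 < (δ : ℤ) * m → curAct L (T ħ k) m w = 0
  G_pos : ∀ (t : ℤˣ) (n : ℤ), A.IsAnnihilator δ t n → curAct L (G ħ k t) (A.idx n) w = 0

lemma IsHighest.screen {A : Sector} {L : Vertex → ℂ → Module.End ℂ Fock} {δ : ℤˣ} {κ τ : ℂ}
    {w : Fock} {s : ℤˣ} {Q : Module.End ℂ Fock} {θ : ℂ → ℂ} (hgen : Generic ħ k)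
    (hw : IsHighest ħ k A L δ κ τ w) (h : Screens ħ k (SVertex ħ k s) L Q θ w) :
    IsHighest ħ k A L δ κ τ (Q w) where
  K_zero t := by rw [h.commute_Kpm, hw.K_zero, map_smul]
  T_zero := by rw [h.commute_T hgen, hw.T_zero, map_smul]
  K_pos m hm := by rw [h.commute_Kpm, hw.K_pos m hm, map_zero]
  T_pos m hm := by rw [h.commute_T hgen, hw.T_pos m hm, map_zero]
  G_pos t n hn := by rw [h.anticommute_G hgen, hw.G_pos t n hn, map_zero, neg_zero]

lemma IsHighest.of_vertex {A : Sector} {L : Vertex → ℂ → Module.End ℂ Fock} {δ : ℤˣ} {μ : Mom}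
    {w : Fock} (h0 : ∀ V : Vertex, V.chg = 0 → V.zExp μ = 0 → L V 0 w = qpow ħ (V.qExp μ) • w)
    (h1 : ∀ V : Vertex, V.chg = 0 → V.zExp μ = 0 → ∀ m : ℤ, 0 < (δ : ℤ) * m → L V (-m) w = 0)
    (hG : ∀ (t ε : ℤˣ) (n : ℤ), A.IsAnnihilator δ t n →
      L (GVertex ħ k t ε) (-A.idx n - 1 / 2) w = 0) :
    ∃ τ, IsHighest ħ k A L δ (qpow ħ (μ 0)) τ w := by
  have hT : ∀ ε ε', L (TVertex ħ k ε ε') 0 w = qpow ħ ((TVertex ħ k ε ε').qExp μ) • w :=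
    fun ε ε' => h0 _ (TVertex_chg ε ε') (TVertex_zExp ε ε' μ)
  obtain ⟨τ, hτ⟩ : ∃ τ : ℂ, curAct L (T ħ k) 0 w = τ • w := by
    simp only [curAct, T, List.map_cons, List.map_nil, List.sum_cons, List.sum_nil, add_zero,
      LinearMap.add_apply, LinearMap.smul_apply, neg_zero, sub_zero, hT, smul_smul, ← add_smul]
    exact ⟨_, rfl⟩
  refine ⟨τ, fun t => ?_, hτ, fun m hm => ?_, fun m hm => ?_, fun t n hn => ?_⟩
  · have := h0 _ (KVertex_chg (ħ := ħ) t) (KVertex_zExp t μ)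
    rw [KVertex_qExp] at this
    simp [curAct, Kpm, this]
  · refine curAct_eq_zero fun t ht => ?_
    simp only [Kpm, List.mem_singleton] at ht
    rw [ht, sub_zero]
    exact h1 _ (KVertex_chg _) (KVertex_zExp _ _) m hm
  · refine curAct_eq_zero fun t ht => ?_
    simp only [T, List.mem_cons, List.not_mem_nil, or_false] at ht
    rcases ht with rfl | rfl | rfl <;> rw [sub_zero] <;>
      exact h1 _ (TVertex_chg _ _) (TVertex_zExp _ _ μ) m hm
  · refine curAct_eq_zero fun t' ht => ?_
    simp only [G, List.mem_cons, List.not_mem_nil, or_false] at ht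
    rcases ht with rfl | rfl <;> exact hG t _ n hn

lemma isHighest_ket (hgen : Generic ħ k) (A : Sector) (ρ σ : ℂ) :
    ∃ τ, IsHighest ħ k A (Vertex.left ħ k) 1 (qpow ħ (A.eps k + ρ)) τ
      (ket (A.eps k + ρ) ρ σ) := by
  have hk := hgen.k_ne_zero
  refine IsHighest.of_vertex (μ := ![A.eps k + ρ, ρ, σ]) (fun V hV h => left_zero_single_one hV h)
    (fun V hV h m hm => ?_) fun t ε n hn => ?_
  · rw [Units.val_one, one_mul] at hm
    exact left_single_one_eq_zero _ _ (neg_neg_of_pos hm) (by rw [h]; push_cast; ring)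
  · cases A with
    | NS =>
      have hn : 0 < (1 : ℤ) * (2 * n + 1) := hn
      refine left_single_one_eq_zero (n := -n - 1) _ _ (by omega) ?_
      rw [GVertex_zExp]
      simp [Sector.idx, Sector.eps]
      ring
    | R =>
      have hn : 0 < (1 : ℤ) * (2 * n + t) := hn
      rcases Int.units_eq_one_or t with rfl | rfl
      · have hn : 0 < (1 : ℤ) * (2 * n + 1) := hn
        refine left_single_one_eq_zero (n := -n - 1) _ _ (by omega) ?_
        rw [GVertex_zExp]
        simp [Sector.idx, Sector.eps, sgn]
        field_simp
        ring
      · have hn : 0 < (1 : ℤ) * (2 * n + -1) := hn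
        refine left_single_one_eq_zero (n := -n) _ _ (by omega) ?_
        rw [GVertex_zExp]
        simp [Sector.idx, Sector.eps, sgn]
        field_simp
        ring

lemma isHighest_bra (hgen : Generic ħ k) (A : Sector) (ρ σ : ℂ) :
    ∃ τ, IsHighest ħ k A (Vertex.right ħ k) (-1) (qpow ħ (A.eps k + ρ)) τ
      (bra (A.eps k + ρ) ρ σ) := by
  have hk := hgen.k_ne_zero
  refine IsHighest.of_vertex (μ := ![A.eps k + ρ, ρ, σ]) (fun V hV h => right_zero_single_one hV h)
    (fun V hV h m hm => ?_) fun t ε n hn => ?_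
  · rw [Units.val_neg, Units.val_one, neg_one_mul] at hm
    have h0 : V.zExp 0 = 0 := by simpa only [add_zero, left_eq_add] using V.zExp_add 0 0
    exact right_single_one_eq_zero (n := m) _ _ (by omega) (by rw [hV, h, h0]; ring)
  · cases A with
    | NS =>
      have hn : 0 < (-1 : ℤ) * (2 * n + 1) := hn
      refine right_single_one_eq_zero (n := n) _ _ (by omega) ?_
      rw [GVertex_zExp_chg hgen, GVertex_zExp]
      simp [Sector.idx, Sector.eps]
      ring
    | R =>
      have hn : 0 < (-1 : ℤ) * (2 * n + t) := hn
      rcases Int.units_eq_one_or t with rfl | rfl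
      · have hn : 0 < (-1 : ℤ) * (2 * n + 1) := hn
        refine right_single_one_eq_zero (n := n) _ _ (by omega) ?_
        rw [GVertex_zExp_chg hgen, GVertex_zExp]
        simp [Sector.idx, Sector.eps, sgn]
        field_simp
        ring
      · have hn : 0 < (-1 : ℤ) * (2 * n + -1) := hn
        refine right_single_one_eq_zero (n := n - 1) _ _ (by omega) ?_
        rw [GVertex_zExp_chg hgen, GVertex_zExp]
        simp [Sector.idx, Sector.eps, sgn]
        field_simp
        ring

lemma IsHighest.isSingular {A : Sector} {κ τ ρ σ : ℂ} {χ : Fock}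
    (h : IsHighest ħ k A (Vertex.left ħ k) 1 κ τ χ) (hχ : χ ∈ fockA k A ρ σ) (h0 : χ ≠ 0)
    (hκ : κ ≠ qpow ħ (A.eps k + ρ)) : IsSingular ħ k A ρ σ χ := by
  have hp : ∀ m : ℤ, 0 < m → 0 < ((1 : ℤˣ) : ℤ) * m := fun m hm => by simpa using hm
  refine ⟨hχ, h0, ⟨κ, τ, h.K_zero, h.T_zero, fun e => hκ ?_⟩, fun m hm =>
    ⟨h.K_pos m (hp m hm), h.T_pos m (hp m hm)⟩, ?_⟩
  · rw [← hwK_eq]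
    exact (Prod.mk.inj e).2
  · cases A with
    | NS => exact fun t n hn => h.G_pos t n (show 0 < (1 : ℤ) * (2 * n + 1) by omega)
    | R => exact ⟨fun n hn => h.G_pos 1 n (show 0 < (1 : ℤ) * (2 * n + 1) by omega),
        fun n hn => h.G_pos (-1) n (show 0 < (1 : ℤ) * (2 * n + -1) by omega)⟩

lemma IsHighest.isDualSingular {A : Sector} {κ τ ρ σ : ℂ} {χ : DualFock}
    (h : IsHighest ħ k A (Vertex.right ħ k) (-1) κ τ χ) (hχ : χ ∈ dualFockA k A ρ σ) (h0 : χ ≠ 0)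
    (hκ : κ ≠ qpow ħ (A.eps k + ρ)) : IsDualSingular ħ k A ρ σ χ := by
  have hp : ∀ m : ℤ, m < 0 → 0 < ((-1 : ℤˣ) : ℤ) * m := fun m hm => by simpa using hm
  refine ⟨hχ, h0, ⟨κ, τ, h.K_zero, h.T_zero, fun e => hκ ?_⟩, fun m hm =>
    ⟨h.K_pos m (hp m hm), h.T_pos m (hp m hm)⟩, ?_⟩
  · rw [← hwK_eq]
    exact (Prod.mk.inj e).2
  · cases A with
    | NS => exact fun t n hn => h.G_pos t n (show 0 < (-1 : ℤ) * (2 * n + 1) by omega)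
    | R => exact ⟨fun n hn => h.G_pos (-1) n (show 0 < (-1 : ℤ) * (2 * n + -1) by omega),
        fun n hn => h.G_pos 1 n (show 0 < (-1 : ℤ) * (2 * n + 1) by omega)⟩

lemma JOp_single (μ : Mom) (x : Osc) :
    JOp k (Finsupp.single μ x) = ((μ 0 - μ 1) / k) • Finsupp.single μ x := by
  simp [JOp, zeroEig, sub_eq_add_neg]

lemma dOp_single_one (hgen : Generic ħ k) (μ : Mom) :
    dOp ħ k (Finsupp.single μ 1) = d0Mom k μ • Finsupp.single μ 1 := by
  rw [dOp_single hgen]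
  simp

lemma d0Mom_ket (hgen : Generic ħ k) (A : Sector) (s : ℤˣ) {ρ σ : ℂ} {m : ℕ}
    (h : -1 - (-sgn s * ρ + σ) / 2 = m) :
    d0Mom k ![A.eps k + (ρ - sgn s * (k + 2)), ρ - sgn s * (k + 2), σ - (k + 2)] =
      d0 k (A.eps k + ρ) ρ σ + A.pdeg m (-sgn s) := by
  have hk := hgen.k_ne_zero
  have hk2 := hgen.k_add_two_ne_zero
  obtain rfl : σ = sgn s * ρ - 2 - 2 * m := by linear_combination (-2) * h
  rcases Int.units_eq_one_or s with rfl | rfl <;> cases A <;>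
    simp [d0Mom, d0, Sector.eps, Sector.pdeg, sgn] <;> field_simp <;> ring

lemma d0Mom_bra (hgen : Generic ħ k) (A : Sector) (s : ℤˣ) {ρ σ : ℂ} {m : ℕ}
    (h : (-sgn s * ρ + σ) / 2 = m) :
    d0Mom k ![A.eps k + (ρ + sgn s * (k + 2)), ρ + sgn s * (k + 2), σ + (k + 2)] =
      d0 k (A.eps k + ρ) ρ σ + A.pdeg m (sgn s) := by
  have hk := hgen.k_ne_zero
  have hk2 := hgen.k_add_two_ne_zero
  obtain rfl : σ = sgn s * ρ + 2 * m := by linear_combination 2 * h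
  rcases Int.units_eq_one_or s with rfl | rfl <;> cases A <;>
    simp [d0Mom, d0, Sector.eps, Sector.pdeg, sgn] <;> field_simp <;> ring

/-- The eigenvalue `κ` of `K^±_0` on `Q^±|…⟩` is inherited from the vacuum vector of the source, and
differs from `q ^ (ε + ρ)` by the factor `q ^ (∓(k + 2)) ≠ 1`. -/
theorem singular_of_ket (hgen : Generic ħ k) (A : Sector) (s : ℤˣ) {ρ σ : ℂ} {m : ℕ}
    (h : -1 - (-sgn s * ρ + σ) / 2 = m) {χ : Fock}
    (hχ : χ = QLeft ħ k s
      (ket (A.eps k + (ρ - sgn s * (k + 2))) (ρ - sgn s * (k + 2)) (σ - (k + 2)))) :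
    χ ∈ fock0 (A.eps k + ρ - sgn s * (k + 2)) (ρ - sgn s * 2) σ ∧ IsSingular ħ k A ρ σ χ ∧
      HasDegree ħ k A ρ σ χ (A.pdeg m (-sgn s)) (-sgn s) := by
  have hk := hgen.k_ne_zero
  set μ : Mom := ![A.eps k + (ρ - sgn s * (k + 2)), ρ - sgn s * (k + 2), σ - (k + 2)] with hμ
  have hz : (SVertex ħ k s).zExp μ = (-sgn s * ρ + σ) / 2 := by
    rw [SVertex_zExp]
    simp [hμ]
    linear_combination (k + 2) * sgn_mul_self s
  have hzm : -1 - (SVertex ħ k s).zExp μ = m := by rw [hz, h]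
  have hzi : ∃ N : ℤ, (SVertex ħ k s).zExp μ = N :=
    ⟨-1 - m, by push_cast; linear_combination -hzm⟩
  have hν : μ + (SVertex ħ k s).chg = ![A.eps k + ρ - sgn s * (k + 2), ρ - sgn s * 2, σ] := by
    rw [SVertex_chg]
    funext i
    fin_cases i <;> simp [hμ] <;> ring
  have hχ' : χ = Finsupp.single ![A.eps k + ρ - sgn s * (k + 2), ρ - sgn s * 2, σ]
      (cre (SVertex ħ k s) m) := by
    rw [hχ, ← hν]
    exact QLeft_single_one hzm
  have hmem : momA k A ρ σ (-(s : ℤ)) = ![A.eps k + ρ - sgn s * (k + 2), ρ - sgn s * 2, σ] := by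
    funext i
    fin_cases i <;> simp [momA, sgn] <;> ring
  refine ⟨⟨_, hχ'.symm⟩, ?_, ?_, ?_⟩
  · obtain ⟨τ, hw⟩ := isHighest_ket hgen A (ρ - sgn s * (k + 2)) (σ - (k + 2))
    have := hw.screen hgen (screens_left hzi 1)
    rw [← hχ] at this
    refine this.isSingular ?_ ?_ fun e => ?_
    · rw [hχ', ← hmem]
      exact single_mem_fockA _ _ _ _ _
    · rw [hχ']
      simpa using cre_SVertex_ne_zero hgen s m
    · refine qpow_sgn_mul_ne_one hgen s ?_
      rw [← add_sub_assoc, sub_eq_add_neg, qpow_add, mul_eq_left₀ (qpow_ne_zero _ _), qpow_neg,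
        inv_eq_one] at e
      exact e
  · rw [hχ]
    have h1 := dOp_QLeft hgen s μ 1
    rw [dOp_single_one hgen, map_smul, d0Mom_ket hgen A s h] at h1
    exact h1
  · rw [hχ', JOp_single]
    congr 1
    simp
    field_simp
    ring

theorem singular_of_bra (hgen : Generic ħ k) (A : Sector) (s : ℤˣ) {ρ σ : ℂ} {m : ℕ}
    (h : (-sgn s * ρ + σ) / 2 = m) {χ : DualFock}
    (hχ : χ = QRight ħ k s
      (bra (A.eps k + (ρ + sgn s * (k + 2))) (ρ + sgn s * (k + 2)) (σ + (k + 2)))) :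
    χ ∈ dualFock0 (A.eps k + ρ + sgn s * (k + 2)) (ρ + sgn s * 2) σ ∧
      IsDualSingular ħ k A ρ σ χ ∧ HasDegree ħ k A ρ σ χ (A.pdeg m (sgn s)) (sgn s) := by
  have hk := hgen.k_ne_zero
  set μ : Mom := ![A.eps k + (ρ + sgn s * (k + 2)), ρ + sgn s * (k + 2), σ + (k + 2)] with hμ
  have hzm : (SVertex ħ k s).zExp μ = m := by
    rw [SVertex_zExp, ← h]
    simp [hμ]
    linear_combination (-(k + 2)) * sgn_mul_self s
  have hν : μ - (SVertex ħ k s).chg = ![A.eps k + ρ + sgn s * (k + 2), ρ + sgn s * 2, σ] := by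
    rw [SVertex_chg]
    funext i
    fin_cases i <;> simp [hμ] <;> ring
  have hχ' : χ = Finsupp.single ![A.eps k + ρ + sgn s * (k + 2), ρ + sgn s * 2, σ]
      (cre (SVertex ħ k s).rev m) := by
    rw [hχ, ← hν]
    exact QRight_single_one hzm
  have hmem : momA k A ρ σ (s : ℤ) = ![A.eps k + ρ + sgn s * (k + 2), ρ + sgn s * 2, σ] := by
    funext i
    fin_cases i <;> simp [momA, sgn] <;> ring
  refine ⟨⟨_, hχ'.symm⟩, ?_, ?_, ?_⟩
  · obtain ⟨τ, hw⟩ := isHighest_bra hgen A (ρ + sgn s * (k + 2)) (σ + (k + 2))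
    have := hw.screen hgen (screens_right ⟨m, hzm⟩ 1)
    rw [← hχ] at this
    refine this.isDualSingular ?_ ?_ fun e => ?_
    · rw [hχ', ← hmem]
      exact single_mem_fockA _ _ _ _ _
    · rw [hχ']
      simpa using cre_rev_SVertex_ne_zero hgen s m
    · refine qpow_sgn_mul_ne_one hgen s ?_
      rwa [← add_assoc, qpow_add, mul_eq_left₀ (qpow_ne_zero _ _)] at e
  · rw [hχ]
    have h1 := dOp_QRight hgen s μ 1
    rw [dOp_single_one hgen, map_smul, d0Mom_bra hgen A s h] at h1
    exact h1
  · rw [hχ', JOp_single]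
    congr 1
    simp
    field_simp
    ring

end

/-! ### The vanishing lines -/

section

variable {ħ k : ℂ}

lemma g_eq (s : ℤˣ) (u v : ℂ) (m : ℕ) :
    g ħ (sgn s * (2 * m + 1)) u v = u / qdiff ħ ^ 2 *
      (qpow ħ (m + 1) * u ^ (sgn s / 2) * v ^ (1 / 2 : ℂ) -
        qpow ħ (-m - 1) * u ^ (-sgn s / 2) * v ^ (-1 / 2 : ℂ)) *
      (qpow ħ (-m) * u ^ (-sgn s / 2) * v ^ (1 / 2 : ℂ) -
        qpow ħ m * u ^ (sgn s / 2) * v ^ (-1 / 2 : ℂ)) := by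
  rcases Int.units_eq_one_or s with rfl | rfl
  · have e1 : (sgn 1 * (2 * m + 1) + 1) / 2 = (m + 1 : ℂ) := by rw [sgn_one]; ring
    have e2 : -(sgn 1 * (2 * m + 1) + 1) / 2 = (-m - 1 : ℂ) := by rw [sgn_one]; ring
    have e3 : (sgn 1 * (2 * m + 1) - 1) / 2 = (m : ℂ) := by rw [sgn_one]; ring
    have e4 : -(sgn 1 * (2 * m + 1) - 1) / 2 = (-m : ℂ) := by rw [sgn_one]; ring
    rw [g, e1, e2, e3, e4, sgn_one]
    ring
  · have e1 : (sgn (-1) * (2 * m + 1) + 1) / 2 = (-m : ℂ) := by rw [sgn_neg, sgn_one]; ring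
    have e2 : -(sgn (-1) * (2 * m + 1) + 1) / 2 = (m : ℂ) := by rw [sgn_neg, sgn_one]; ring
    have e3 : (sgn (-1) * (2 * m + 1) - 1) / 2 = (-m - 1 : ℂ) := by rw [sgn_neg, sgn_one]; ring
    have e4 : -(sgn (-1) * (2 * m + 1) - 1) / 2 = (m + 1 : ℂ) := by rw [sgn_neg, sgn_one]; ring
    rw [g, e1, e2, e3, e4, sgn_neg, sgn_one, neg_neg]
    ring

/-- A factor of `g` is `x - x⁻¹` with `x ^ 2` on the left-hand side of the equation. -/
lemma factor_eq_zero_iff (s : ℤˣ) (c : ℂ) {u v : ℂ} (hu : u ≠ 0) (hv : v ≠ 0) :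
    qpow ħ c * u ^ (sgn s / 2) * v ^ (1 / 2 : ℂ) -
        qpow ħ (-c) * u ^ (-sgn s / 2) * v ^ (-1 / 2 : ℂ) = 0 ↔
      qpow ħ (2 * c) * u ^ (s : ℤ) * v = 1 := by
  have h1 : qpow ħ (2 * c) = qpow ħ c ^ 2 := by
    rw [mul_comm]; exact_mod_cast qpow_mul_natCast ħ c 2
  have h2 : u ^ (s : ℤ) = (u ^ (sgn s / 2)) ^ 2 := by
    rw [← Complex.cpow_intCast, ← Complex.cpow_nat_mul]
    congr 1
    rw [sgn]
    push_cast
    ring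
  have h3 : v = (v ^ (1 / 2 : ℂ)) ^ 2 := by
    rw [← Complex.cpow_nat_mul]
    norm_num
  have hu' : u ^ (sgn s / 2) ≠ 0 := by simp [Complex.cpow_eq_zero_iff, hu]
  have hv' : v ^ (1 / 2 : ℂ) ≠ 0 := by simp [Complex.cpow_eq_zero_iff, hv]
  have hc := qpow_ne_zero ħ c
  rw [h1, h2, neg_div, neg_div, Complex.cpow_neg, Complex.cpow_neg, qpow_neg, sub_eq_zero,
    ← mul_inv, ← mul_inv, ← mul_eq_one_iff_eq_inv₀ (by positivity)]
  have h4 : qpow ħ c * u ^ (sgn s / 2) * v ^ (1 / 2 : ℂ) *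
      (qpow ħ c * u ^ (sgn s / 2) * v ^ (1 / 2 : ℂ)) =
      qpow ħ c ^ 2 * (u ^ (sgn s / 2)) ^ 2 * v := by
    linear_combination -(qpow ħ c ^ 2 * (u ^ (sgn s / 2)) ^ 2) * h3
  rw [h4]

lemma g_eq_zero_iff (hgen : Generic ħ k) (s : ℤˣ) {u v : ℂ} (m : ℕ) (hu : u ≠ 0) (hv : v ≠ 0) :
    g ħ (sgn s * (2 * m + 1)) u v = 0 ↔
      qpow ħ (2 * (m + 1)) * u ^ (s : ℤ) * v = 1 ∨
        qpow ħ (2 * -m) * u ^ (-(s : ℤ)) * v = 1 := by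
  have h1 := factor_eq_zero_iff (ħ := ħ) s (m + 1) hu hv
  have h2 := factor_eq_zero_iff (ħ := ħ) (-s) (-m) hu hv
  rw [sgn_neg, neg_neg, neg_neg, Units.val_neg] at h2
  rw [neg_add'] at h1
  rw [g_eq s u v m, mul_eq_zero, mul_eq_zero, h1, h2]
  simp [hu, qdiff_ne_zero hgen]

lemma qpow_zpow (x : ℂ) (n : ℤ) : qpow ħ x ^ n = qpow ħ (n * x) := by
  rw [mul_comm, qpow_mul_intCast]

lemma g_eq_zero_of_ket (hgen : Generic ħ k) (s : ℤˣ) {ρ σ : ℂ} {m : ℕ}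
    (h : -1 - (-sgn s * ρ + σ) / 2 = m) :
    g ħ (-sgn s * (2 * m + 1)) (qpow ħ ρ) (qpow ħ σ) = 0 := by
  rw [← sgn_neg, g_eq_zero_iff hgen _ _ (qpow_ne_zero _ _) (qpow_ne_zero _ _)]
  left
  have e : 2 * (m + 1) + ((-s : ℤˣ) : ℤ) * ρ + σ = 0 := by
    rw [sgn] at h
    push_cast
    linear_combination (-2) * h
  rw [qpow_zpow, ← qpow_add, ← qpow_add, e, qpow_zero]

lemma g_eq_zero_of_bra (hgen : Generic ħ k) (s : ℤˣ) {ρ σ : ℂ} {m : ℕ}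
    (h : (-sgn s * ρ + σ) / 2 = m) :
    g ħ (sgn s * (2 * m + 1)) (qpow ħ ρ) (qpow ħ σ) = 0 := by
  rw [g_eq_zero_iff hgen _ _ (qpow_ne_zero _ _) (qpow_ne_zero _ _)]
  right
  have e : 2 * -m + (-(s : ℤ) : ℤ) * ρ + σ = 0 := by
    rw [sgn] at h
    push_cast
    linear_combination 2 * h
  rw [qpow_zpow, ← qpow_add, ← qpow_add, e, qpow_zero]

lemma exists_qpow_eq (hgen : Generic ħ k) {u : ℂ} (hu : u ≠ 0) : ∃ ρ, qpow ħ ρ = u := by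
  have hħ : ħ ≠ 0 := by
    rintro rfl
    exact qdiff_ne_zero hgen (by simp [qdiff, qpow])
  exact ⟨Complex.log u / ħ, by rw [qpow, mul_div_cancel₀ _ hħ, Complex.exp_log hu]⟩

lemma exists_of_g_eq_zero (hgen : Generic ħ k) (s : ℤˣ) {u v : ℂ} {m : ℕ} (hu : u ≠ 0)
    (hv : v ≠ 0) (h : g ħ (sgn s * (2 * m + 1)) u v = 0) :
    ∃ ρ σ : ℂ, qpow ħ ρ = u ∧ qpow ħ σ = v ∧
      (-1 - (sgn s * ρ + σ) / 2 = m ∨ (-sgn s * ρ + σ) / 2 = m) := by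
  obtain ⟨ρ, rfl⟩ := exists_qpow_eq hgen hu
  have key : ∀ x : ℂ, qpow ħ x * v = 1 → qpow ħ (-x) = v := fun x hx => by
    rw [qpow_neg, inv_eq_of_mul_eq_one_right hx]
  rw [g_eq_zero_iff hgen s m hu hv, qpow_zpow, qpow_zpow, ← qpow_add, ← qpow_add] at h
  rcases h with h | h
  · refine ⟨ρ, _, rfl, key _ h, Or.inl ?_⟩
    rw [sgn]
    ring
  · refine ⟨ρ, _, rfl, key _ h, Or.inr ?_⟩
    rw [sgn]
    push_cast
    ring

lemma commute_of_mem_fockA {A : Sector} {ρ σ : ℂ} {P Q : Module.End ℂ Fock}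
    (h : ∀ n x, P (Q (Finsupp.single (momA k A ρ σ n) x)) =
      Q (P (Finsupp.single (momA k A ρ σ n) x))) {v : Fock} (hv : v ∈ fockA k A ρ σ) :
    P (Q v) = Q (P v) :=
  eq_of_mem_fockA (f := P ∘ₗ Q) (g := Q ∘ₗ P) h hv

theorem screening_left (hgen : Generic ħ k) (A : Sector) {s : ℤˣ} {ρ σ : ℂ}
    (hN : ∃ N : ℤ, (-sgn s * ρ + σ) / 2 = N) :
    (∀ m : ℤ, ∀ v ∈ fockA k A ρ σ,
      (S ħ k s).left ħ k m v ∈ fockA k A (ρ + sgn s * (k + 2)) (σ + (k + 2))) ∧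
    (∀ v ∈ fockA k A ρ σ, dOp ħ k (QLeft ħ k s v) = QLeft ħ k s (dOp ħ k v)) ∧
    (∀ v ∈ fockA k A ρ σ, ∀ m : ℤ,
      (K ħ).left ħ k m (QLeft ħ k s v) = QLeft ħ k s ((K ħ).left ħ k m v)) ∧
    IsIntertwiner (Gen.left ħ k A) (QLeft ħ k s)
      (fockA k A ρ σ) (fockA k A (ρ + sgn s * (k + 2)) (σ + (k + 2))) := by
  have hl : ∀ n x, Screens ħ k (SVertex ħ k s) (Vertex.left ħ k) (QLeft ħ k s) (fun _ => 1)
      (Finsupp.single (momA k A ρ σ n) x) :=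
    fun n x => screens_left (SVertex_zExp_momA_int A n hN) x
  have il := isIntertwiner_of_screens hgen shiftsBy_left (QLeft_eq s) hl
  rw [genAct_left, Int.cast_one, one_mul, one_mul] at il
  refine ⟨fun m v hv => ?_, fun v hv => ?_, fun v hv m => ?_, il⟩
  · have := S_mem (ħ := ħ) (shiftsBy_left (ħ := ħ) (k := k)) A s (-m) hv
    rwa [← S_left, Int.cast_one, one_mul, one_mul] at this
  · exact commute_of_mem_fockA (fun n x => dOp_QLeft hgen s _ x) hv
  · have h0 : (K ħ).left ħ k m = curAct (Vertex.left ħ k) (K ħ) m := rfl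
    rw [h0]
    exact commute_of_mem_fockA (fun n x => (hl n x).commute_K m) hv

theorem screening_right (hgen : Generic ħ k) (A : Sector) {s : ℤˣ} {ρ σ : ℂ}
    (hN : ∃ N : ℤ, (-sgn s * ρ + σ) / 2 = N) :
    (∀ m : ℤ, ∀ w ∈ dualFockA k A ρ σ,
      (S ħ k s).right ħ k m w ∈ dualFockA k A (ρ - sgn s * (k + 2)) (σ - (k + 2))) ∧
    (∀ w ∈ dualFockA k A ρ σ, dOp ħ k (QRight ħ k s w) = QRight ħ k s (dOp ħ k w)) ∧
    (∀ w ∈ dualFockA k A ρ σ, ∀ m : ℤ,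
      (K ħ).right ħ k m (QRight ħ k s w) = QRight ħ k s ((K ħ).right ħ k m w)) ∧
    IsIntertwiner (Gen.right ħ k A) (QRight ħ k s)
      (dualFockA k A ρ σ) (dualFockA k A (ρ - sgn s * (k + 2)) (σ - (k + 2))) := by
  have hr : ∀ n x, Screens ħ k (SVertex ħ k s) (Vertex.right ħ k) (QRight ħ k s) (fun η => -η)
      (Finsupp.single (momA k A ρ σ n) x) :=
    fun n x => screens_right (SVertex_zExp_momA_int A n hN) x
  have ir := isIntertwiner_of_screens hgen shiftsBy_right (QRight_eq s) hr
  rw [genAct_right, Int.cast_neg, Int.cast_one, neg_one_mul, neg_one_mul, ← sub_eq_add_neg,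
    ← sub_eq_add_neg] at ir
  refine ⟨fun m w hw => ?_, fun w hw => ?_, fun w hw m => ?_, ir⟩
  · have := S_mem (ħ := ħ) (shiftsBy_right (ħ := ħ) (k := k)) A s (-m) hw
    rwa [← S_right, Int.cast_neg, Int.cast_one, neg_one_mul, neg_one_mul, ← sub_eq_add_neg,
      ← sub_eq_add_neg] at this
  · exact commute_of_mem_fockA (fun n x => dOp_QRight hgen s _ x) hw
  · have h0 : (K ħ).right ħ k m = curAct (Vertex.right ħ k) (K ħ) m := rfl
    rw [h0]
    exact commute_of_mem_fockA (fun n x => (hr n x).commute_K m) hw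

end

end

end SVir

open SVir in
theorem mainTheorem6 (ħ k : ℂ) (hgen : Generic ħ k) (A : Sector) (s : ℤˣ) :
    -- the Fourier expansion of the screening current
    (∀ ρ' σ' : ℂ,
      (HasFourierExpansion ((S ħ k s).left ħ k) (fockA k A ρ' σ') ↔
        ∃ N : ℤ, (-sgn s * ρ' + σ') / 2 = N) ∧
      (HasFourierExpansion ((S ħ k s).right ħ k) (dualFockA k A ρ' σ') ↔
        ∃ N : ℤ, (-sgn s * ρ' + σ') / 2 = N)) ∧
    -- the modes and the screening charge
    (∀ ρ' σ' : ℂ, (∃ N : ℤ, (-sgn s * ρ' + σ') / 2 = N) →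
      (∀ m : ℤ, ∀ v ∈ fockA k A ρ' σ',
        (S ħ k s).left ħ k m v ∈ fockA k A (ρ' + sgn s * (k + 2)) (σ' + (k + 2))) ∧
      (∀ m : ℤ, ∀ v ∈ dualFockA k A ρ' σ',
        (S ħ k s).right ħ k m v ∈ dualFockA k A (ρ' - sgn s * (k + 2)) (σ' - (k + 2))) ∧
      (∀ v ∈ fockA k A ρ' σ',
        dOp ħ k (QLeft ħ k s v) = QLeft ħ k s (dOp ħ k v) ∧
        (∀ m : ℤ, (K ħ).left ħ k m (QLeft ħ k s v) = QLeft ħ k s ((K ħ).left ħ k m v)) ∧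
        (∀ (t : ℤˣ) (m : ℤ),
          (Kpm ħ t).left ħ k m (QLeft ħ k s v) = QLeft ħ k s ((Kpm ħ t).left ħ k m v)) ∧
        (∀ m : ℤ, (T ħ k).left ħ k m (QLeft ħ k s v) = QLeft ħ k s ((T ħ k).left ħ k m v)) ∧
        (∀ (t : ℤˣ) (n : ℤ), (G ħ k t).left ħ k (A.idx n) (QLeft ħ k s v) =
          -QLeft ħ k s ((G ħ k t).left ħ k (A.idx n) v))) ∧
      (∀ w ∈ dualFockA k A ρ' σ',
        dOp ħ k (QRight ħ k s w) = QRight ħ k s (dOp ħ k w) ∧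
        (∀ m : ℤ, (K ħ).right ħ k m (QRight ħ k s w) = QRight ħ k s ((K ħ).right ħ k m w)) ∧
        (∀ (t : ℤˣ) (m : ℤ),
          (Kpm ħ t).right ħ k m (QRight ħ k s w) = QRight ħ k s ((Kpm ħ t).right ħ k m w)) ∧
        (∀ m : ℤ, (T ħ k).right ħ k m (QRight ħ k s w) = QRight ħ k s ((T ħ k).right ħ k m w)) ∧
        (∀ (t : ℤˣ) (n : ℤ), (G ħ k t).right ħ k (A.idx n) (QRight ħ k s w) =
          -QRight ħ k s ((G ħ k t).right ħ k (A.idx n) w))) ∧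
      IsIntertwiner (Gen.left ħ k A) (QLeft ħ k s)
        (fockA k A ρ' σ') (fockA k A (ρ' + sgn s * (k + 2)) (σ' + (k + 2))) ∧
      IsIntertwiner (Gen.right ħ k A) (QRight ħ k s)
        (dualFockA k A ρ' σ') (dualFockA k A (ρ' - sgn s * (k + 2)) (σ' - (k + 2)))) ∧
    -- singular vectors in the Fock spaces
    (∀ (ρ σ : ℂ) (m : ℕ), -1 - (-sgn s * ρ + σ) / 2 = m →
      ∀ χ, χ = QLeft ħ k s
          (ket (A.eps k + (ρ - sgn s * (k + 2))) (ρ - sgn s * (k + 2)) (σ - (k + 2))) →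
        χ ∈ fock0 (A.eps k + ρ - sgn s * (k + 2)) (ρ - sgn s * 2) σ ∧
        IsSingular ħ k A ρ σ χ ∧
        HasDegree ħ k A ρ σ χ (A.pdeg m (-sgn s)) (-sgn s) ∧
        g ħ (-sgn s * (2 * m + 1)) (qpow ħ ρ) (qpow ħ σ) = 0) ∧
    -- singular vectors in the dual Fock spaces
    (∀ (ρ σ : ℂ) (m : ℕ), (-sgn s * ρ + σ) / 2 = m →
      ∀ χ, χ = QRight ħ k s
          (bra (A.eps k + (ρ + sgn s * (k + 2))) (ρ + sgn s * (k + 2)) (σ + (k + 2))) →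
        χ ∈ dualFock0 (A.eps k + ρ + sgn s * (k + 2)) (ρ + sgn s * 2) σ ∧
        IsDualSingular ħ k A ρ σ χ ∧
        HasDegree ħ k A ρ σ χ (A.pdeg m (sgn s)) (sgn s) ∧
        g ħ (sgn s * (2 * m + 1)) (qpow ħ ρ) (qpow ħ σ) = 0) ∧
    -- the vanishing lines
    (∀ (u v : ℂ) (m : ℕ), u ≠ 0 → v ≠ 0 →
      g ħ (sgn s * (2 * m + 1)) u v = u / qdiff ħ ^ 2 *
        (qpow ħ (m + 1) * u ^ (sgn s / 2) * v ^ (1 / 2 : ℂ) -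
          qpow ħ (-m - 1) * u ^ (-sgn s / 2) * v ^ (-1 / 2 : ℂ)) *
        (qpow ħ (-m) * u ^ (-sgn s / 2) * v ^ (1 / 2 : ℂ) -
          qpow ħ m * u ^ (sgn s / 2) * v ^ (-1 / 2 : ℂ)) ∧
      (g ħ (sgn s * (2 * m + 1)) u v = 0 → ∃ ρ σ : ℂ, qpow ħ ρ = u ∧ qpow ħ σ = v ∧
        ((-1 - (sgn s * ρ + σ) / 2 = m ∧
          ∃ χ, χ = QLeft ħ k (-s)
              (ket (A.eps k + (ρ + sgn s * (k + 2))) (ρ + sgn s * (k + 2)) (σ - (k + 2))) ∧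
            IsSingular ħ k A ρ σ χ ∧
            HasDegree ħ k A ρ σ χ (A.pdeg m (sgn s)) (sgn s)) ∨
         ((-sgn s * ρ + σ) / 2 = m ∧
          ∃ χ, χ = QRight ħ k s
              (bra (A.eps k + (ρ + sgn s * (k + 2))) (ρ + sgn s * (k + 2)) (σ + (k + 2))) ∧
            IsDualSingular ħ k A ρ σ χ ∧
            HasDegree ħ k A ρ σ χ (A.pdeg m (sgn s)) (sgn s))))) := by
  refine ⟨fun ρ' σ' => ⟨hasFourierExpansion_left_iff s A ρ' σ',
    hasFourierExpansion_right_iff s A ρ' σ'⟩, fun ρ' σ' hN => ?_, fun ρ σ m h χ hχ => ?_,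
    fun ρ σ m h χ hχ => ?_, fun u v m hu hv => ⟨g_eq s u v m, fun h => ?_⟩⟩
  · obtain ⟨hSl, hdl, hKl, il⟩ := screening_left hgen A hN
    obtain ⟨hSr, hdr, hKr, ir⟩ := screening_right hgen A hN
    refine ⟨hSl, hSr, fun v hv => ⟨hdl v hv, hKl v hv, fun t m => ?_, fun m => ?_, fun t n => ?_⟩,
      fun w hw => ⟨hdr w hw, hKr w hw, fun t m => ?_, fun m => ?_, fun t n => ?_⟩, il, ir⟩
    · simpa only [Gen.parity, Gen.left, one_smul] using il.intertwines (.K t m) v hv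
    · simpa only [Gen.parity, Gen.left, one_smul] using il.intertwines (.T m) v hv
    · simpa only [Gen.parity, Gen.left, neg_one_smul] using il.intertwines (.G t n) v hv
    · simpa only [Gen.parity, Gen.right, one_smul] using ir.intertwines (.K t m) w hw
    · simpa only [Gen.parity, Gen.right, one_smul] using ir.intertwines (.T m) w hw
    · simpa only [Gen.parity, Gen.right, neg_one_smul] using ir.intertwines (.G t n) w hw
  · obtain ⟨h1, h2, h3⟩ := singular_of_ket hgen A s h hχ
    exact ⟨h1, h2, h3, g_eq_zero_of_ket hgen s h⟩
  · obtain ⟨h1, h2, h3⟩ := singular_of_bra hgen A s h hχ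
    exact ⟨h1, h2, h3, g_eq_zero_of_bra hgen s h⟩
  · obtain ⟨ρ, σ, hρ, hσ, h' | h'⟩ := exists_of_g_eq_zero hgen s hu hv h
    · have h1 : -1 - (-sgn (-s) * ρ + σ) / 2 = m := by rw [sgn_neg, neg_neg, h']
      have h2 := singular_of_ket (χ := QLeft ħ k (-s)
        (ket (A.eps k + (ρ + sgn s * (k + 2))) (ρ + sgn s * (k + 2)) (σ - (k + 2))))
        hgen A (-s) h1 (by rw [sgn_neg, neg_mul, sub_neg_eq_add])
      rw [sgn_neg, neg_neg] at h2
      exact ⟨ρ, σ, hρ, hσ, Or.inl ⟨h', _, rfl, h2.2⟩⟩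
    · have h2 := singular_of_bra (χ := QRight ħ k s
        (bra (A.eps k + (ρ + sgn s * (k + 2))) (ρ + sgn s * (k + 2)) (σ + (k + 2)))) hgen A s h' rfl
      exact ⟨ρ, σ, hρ, hσ, Or.inr ⟨h', _, rfl, h2.2⟩⟩
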